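/- **Conventions.** Let $V$ be a $3$-dimensional vector space over a field $k$ with basis $e_1,e_2,e_3$. For a quadratic form $q$ on $V$ put $b_q(x,y)=q(x+y)-q(x)-q(y)$, $\lambda_i=q(e_i)$, $\lambda_{ij}=b_q(e_i,e_j)$. The form $q$ is *semiregular* if its half-discriminant $4\lambda_1\lambda_2\lambda_3+\lambda_{12}\lambda_{13}\lambda_{23}-(\lambda_1\lambda_{23}^2+\lambda_2\lambda_{13}^2+\lambda_3\lambda_{12}^2)$ is nonzero (this does not depend on the basis), and *regular* on a subspace $U$ if $b_q|_{U\times U}$ is nondegenerate. A *similarity* $(V,q)\to(V',q')$ is a linear isomorphism $g:V\to V'$ with $q'\circ g=l\,q$ for some $l\in k^*$. The group $\mathrm{GL}_V$ acts on the space $\mathrm{Quad}_V$ of quadratic forms on $V$ by $(g\cdot q)(x)=q(g^{-1}x)$. A field is *quadratically closed* if every polynomial of degree $2$ over it has a root in it. **Theorem.** (1) Let $k$ be quadratically closed. The set of ternary quadratic modules over $k$ up to similarity has exactly $4$ elements, which correspond to (a) semiregular quadratic modules; (b) rank $2$ quadratic modules, i.e. those that are not semiregular but are regular on a two-dimensional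 subspace; (c) nonzero perfect squares of linear forms; (d) the zero form. In $\mathrm{Quad}_V$ each of these four classes is a single $\mathrm{GL}_V$-orbit, with representatives respectively $$q^{(1)}=x_1x_2+x_3^2,\qquad q^{(2)}=x_1x_2,\qquad q^{(3)}=x_3^2,\qquad q^{(4)}=0,$$ evaluated at $x_1e_1+x_2e_2+x_3e_3$. (2) Let $k$ be algebraically closed. The four orbits $\mathrm{Quad}_V^{(i)}=\mathrm{GL}_V\cdot q^{(i)}$ partition the $k$-variety $\mathrm{Quad}_V\cong\mathbb A^6_k$ and stratify it in the sense that, for Zariski closures, $$\overline{\mathrm{Quad}_V^{(1)}}=\mathrm{Quad}_V,\qquad \overline{\mathrm{Quad}_V^{(i+1)}}=\overline{\mathrm{Quad}_V^{(i)}}\setminus \mathrm{Quad}_V^{(i)}\quad(1\le i\le 3).$$ With the reduced structure on closures, $$\mathrm{Sing}\big(\overline{\mathrm{Quad}_V^{(i+1)}}\big)=\overline{\mathrm{Quad}_V^{(i+1)}}\setminus \mathrm{Quad}_V^{(i+1)}$$ for $i=1$ in every characteristic and for $i=2$ if $\operatorname{char}k\ne2$; if $\operatorname{char}k=2$, then $\overline{\mathrm{Quad}_V^{(3)}}$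 is smooth. (3) Let $k$ be algebraically closed, $W=\Lambda^{even}(V)$ and $w=1\in W$. Let $\mathrm{SpAzu}$ be the Zariski closure, in the affine space of bilinear multiplications $W\times W\to W$, of the set of Azumaya algebra structures on $W$ with identity $w$. Let $H=\mathrm{Stab}_w\subset\mathrm{GL}_W$ be the stabiliser of $w$, acting by transport of structure, and let $\mathsf L_w\subset H$ be the subgroup of the $t$ with $t(x)-x\in k\,w$ for all $x\in W$. For $q\in\mathrm{Quad}_V$ let $b(q)$ be the bilinear form $\sum_i\lambda_ix_iy_i+\lambda_{12}x_2y_1+\lambda_{23}x_3y_2+\lambda_{13}x_1y_3$, which induces $q$, and let $\theta(q)$ be the multiplication on $W$ obtained from the even Clifford algebra $C_0(V,q)$ through the linear isomorphism $\psi_{b(q)}:C_0(V,q)\cong\Lambda^{even}(V)$, the restriction of the linear map $\psi:C(V,q)\to\Lambda(V)$ with $\psi(1)=1$ and $\psi(x\cdot z)=x\wedge\psi(z)+b(q)(x,-)\lrcorner\,\psi(z)$ for $x\in V$. Put $\Theta(q,t)=t\cdot\theta(q)$ for $t\in\mathsf L_w$. Then the four orbits $\mathrm{SpAzu}^{(i)}=H\cdot\Theta(q^{(i)},\mathrm{Id})$,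 $1\le i\le4$, partition $\mathrm{SpAzu}$ and stratify it in the same sense: $$\overline{\mathrm{SpAzu}^{(1)}}=\mathrm{SpAzu},\qquad \overline{\mathrm{SpAzu}^{(i+1)}}=\overline{\mathrm{SpAzu}^{(i)}}\setminus \mathrm{SpAzu}^{(i)}\quad(1\le i\le 3),$$ and $\mathrm{Sing}\big(\overline{\mathrm{SpAzu}^{(i+1)}}\big)=\overline{\mathrm{SpAzu}^{(i+1)}}\setminus \mathrm{SpAzu}^{(i+1)}$ for $i=1$ in every characteristic and for $i=2$ if $\operatorname{char}k\ne2$; if $\operatorname{char}k=2$, then $\overline{\mathrm{SpAzu}^{(3)}}$ is smooth. -/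

import Mathlib

universe u v

namespace TernaryForms

/-! ### Ternary quadratic forms over a field -/

section Forms

variable {k : Type u} [Field k] {V : Type v} [AddCommGroup V] [Module k V]

/-- A field is quadratically closed if it has no quadratic extension, i.e. if every quadratic
polynomial over it has a root in it. (In characteristic `2` this asks for roots of separable as
well as of inseparable quadratic polynomials.) -/
def IsQuadraticallyClosed (k : Type u) [Field k] : Prop :=
  ∀ a b : k, ∃ x : k, x ^ 2 + a * x + b = 0

/-- The half-discriminant of a ternary quadratic form relative to a basis: with
`ζᵢ = q (eᵢ)` and `ζᵢⱼ = q (eᵢ + eⱼ) - q (eᵢ) - q (eⱼ)` it is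
`4 ζ₁ ζ₂ ζ₃ + ζ₁₂ ζ₁₃ ζ₂₃ - (ζ₁ ζ₂₃² + ζ₂ ζ₁₃² + ζ₃ ζ₁₂²)`. -/
noncomputable def halfDiscriminant (e : Module.Basis (Fin 3) k V) (q : QuadraticForm k V) : k :=
  4 * q (e 0) * q (e 1) * q (e 2)
    + QuadraticMap.polar q (e 0) (e 1) * QuadraticMap.polar q (e 0) (e 2)
      * QuadraticMap.polar q (e 1) (e 2)
    - (q (e 0) * QuadraticMap.polar q (e 1) (e 2) ^ 2
      + q (e 1) * QuadraticMap.polar q (e 0) (e 2) ^ 2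
      + q (e 2) * QuadraticMap.polar q (e 0) (e 1) ^ 2)

/-- A ternary quadratic form is semiregular if its half-discriminant (relative to a basis) is a
unit. Changing the basis multiplies the half-discriminant by the square of a unit. -/
def IsSemiregular (q : QuadraticForm k V) : Prop :=
  ∃ e : Module.Basis (Fin 3) k V, IsUnit (halfDiscriminant e q)

/-- The restriction of `q` to the subspace `U` is regular: its associated symmetric bilinear form
`(x, y) ↦ q (x + y) - q x - q y` is nondegenerate on `U`. -/
def IsRegularOn (q : QuadraticForm k V) (U : Submodule k V) : Prop :=
  (QuadraticMap.polarBilin (q.comp U.subtype)).Nondegenerate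

/-- Ternary forms of rank `2`: not semiregular, but regular on a two-dimensional subspace. -/
def IsRankTwo (q : QuadraticForm k V) : Prop :=
  ¬ IsSemiregular q ∧ ∃ U : Submodule k V, Module.finrank k U = 2 ∧ IsRegularOn q U

/-- Nonzero perfect squares, i.e. nonzero squares of linear forms. -/
def IsNonzeroSquare (q : QuadraticForm k V) : Prop :=
  q ≠ 0 ∧ ∃ f : Module.Dual k V, ∀ x, q x = f x ^ 2

/-- The four types of ternary quadratic forms, indexed by `0, 1, 2, 3`. -/
def HasType (q : QuadraticForm k V) : Fin 4 → Prop :=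
  ![IsSemiregular q, IsRankTwo q, IsNonzeroSquare q, q = 0]

/-- The four standard forms `x₁ x₂ + x₃²`, `x₁ x₂`, `x₃²` and `0` relative to a basis. -/
noncomputable def stdForm (e : Module.Basis (Fin 3) k V) : Fin 4 → QuadraticForm k V :=
  ![QuadraticMap.linMulLin (e.coord 0) (e.coord 1)
      + QuadraticMap.linMulLin (e.coord 2) (e.coord 2),
    QuadraticMap.linMulLin (e.coord 0) (e.coord 1),
    QuadraticMap.linMulLin (e.coord 2) (e.coord 2),
    0]

/-- The action of `GL(V)` on quadratic forms: `(g · q)(x) = q (g⁻¹ x)`. -/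
def formAct (g : V ≃ₗ[k] V) (q : QuadraticForm k V) : QuadraticForm k V :=
  q.comp (g.symm : V →ₗ[k] V)

/-- The orbit `GL(V) · q`. -/
def formOrbit (q : QuadraticForm k V) : Set (QuadraticForm k V) :=
  Set.range fun g : V ≃ₗ[k] V => formAct g q

/-- Ternary quadratic modules over `k`. -/
abbrev TernaryQuadraticModule (k : Type u) [Field k] :=
  {M : QuadraticModuleCat.{v} k // Module.finrank k M = 3}

/-- A similarity from `(V, q)` to `(V', q')`: a linear isomorphism `g` with `q' ∘ g = l q` for a
unit `l` (the multiplier). -/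
def AreSimilar {V' : Type*} [AddCommGroup V'] [Module k V'] (q : QuadraticForm k V)
    (q' : QuadraticForm k V') : Prop :=
  ∃ (g : V ≃ₗ[k] V') (l : kˣ), ∀ x, q' (g x) = (l : k) * q x

/-- Similarity of ternary quadratic modules, as an equivalence relation. -/
def similaritySetoid (k : Type u) [Field k] : Setoid (TernaryQuadraticModule.{u, v} k) where
  r M N := AreSimilar M.1.form N.1.form
  iseqv :=
    { refl := fun _ => ⟨LinearEquiv.refl k _, 1, fun _ => by simp⟩
      symm := by
        rintro M N ⟨g, l, h⟩
        refine ⟨g.symm, l⁻¹, fun x => ?_⟩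
        have := h (g.symm x)
        rw [LinearEquiv.apply_symm_apply] at this
        rw [this, Units.inv_mul_cancel_left]
      trans := by
        rintro M N P ⟨g, l, h⟩ ⟨g', l', h'⟩
        refine ⟨g.trans g', l' * l, fun x => ?_⟩
        rw [LinearEquiv.trans_apply, h', h, Units.val_mul, mul_assoc] }

end Forms

/-! ### Affine varieties

The `k`-variety underlying a finite-dimensional vector space `E` over an algebraically closed
field `k`, and its closed subvarieties, through their `k`-points. -/

section Variety

variable (k : Type u) [Field k] {E : Type v} [AddCommGroup E] [Module k E]

variable (E) in
/-- The polynomial functions on `E`: the `k`-algebra of functions generated by the linear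
forms. -/
def polyFun : Subalgebra k (E → k) :=
  Algebra.adjoin k (Set.range fun l : Module.Dual k E => (l : E → k))

/-- The Zariski closure of `S ⊆ E`: the common zeros of the polynomial functions vanishing
on `S`. -/
def zariskiClosure (S : Set E) : Set E :=
  {x | ∀ f ∈ polyFun k E, (∀ s ∈ S, f s = 0) → f x = 0}

/-- The (reduced) coordinate ring of `T ⊆ E`: the restrictions to `T` of the polynomial functions
on `E`, i.e. the `k`-algebra of functions on `T` generated by the linear forms. -/
def coordRing (T : Set E) : Subalgebra k (T → k) :=
  Algebra.adjoin k (Set.range fun (l : Module.Dual k E) (t : T) => l t)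

/-- Evaluation of regular functions at a point of `T`. -/
def evalAt {T : Set E} (x : T) : coordRing k T →ₐ[k] k :=
  (Pi.evalAlgHom k (fun _ : T => k) x).comp (coordRing k T).val

/-- The maximal ideal of the coordinate ring of `T` at a point of `T`. -/
def pointIdeal {T : Set E} (x : T) : Ideal (coordRing k T) :=
  RingHom.ker (evalAt k x)

instance pointIdeal_isPrime {T : Set E} (x : T) : (pointIdeal k x).IsPrime :=
  RingHom.ker_isPrime _

/-- The singular points of the closed subvariety `T` of `E`, with its reduced structure: the
points at which `T` is not smooth over `k`. -/
def singularLocus (T : Set E) : Set E :=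
  {x | ∃ h : x ∈ T, ¬ Algebra.IsSmoothAt k (pointIdeal k (⟨x, h⟩ : T))}

/-- The four subsets `S 0, …, S 3` partition `X`, the closure of `S 0` is `X`, and the closure of
each following one is the previous closure minus the previous subset. -/
def IsStratification (X : Set E) (S : Fin 4 → Set E) : Prop :=
  (⋃ i, S i) = X ∧ (Pairwise fun i j => Disjoint (S i) (S j)) ∧
  zariskiClosure k (S 0) = X ∧
  ∀ i : Fin 3, zariskiClosure k (S i.succ) = zariskiClosure k (S i.castSucc) \ S i.castSucc

/-- The claim on singular loci: the closures of `S 1` and `S 2` are singular exactly along their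
boundaries, except that in characteristic `2` the closure of `S 2` is smooth. -/
def HasStatedSingularLoci (S : Fin 4 → Set E) : Prop :=
  singularLocus k (zariskiClosure k (S 1)) = zariskiClosure k (S 1) \ S 1 ∧
  (¬ CharP k 2 → singularLocus k (zariskiClosure k (S 2)) = zariskiClosure k (S 2) \ S 2) ∧
  (CharP k 2 → Algebra.Smooth k (coordRing k (zariskiClosure k (S 2))))

end Variety

/-! ### Algebra structures on a vector space with a fixed unit -/

section Structures

variable {k : Type u} [Field k] {W : Type v} [AddCommGroup W] [Module k W]

/-- The bilinear multiplication `m` makes `W` an (associative) Azumaya `k`-algebra with identity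
element `w`. -/
def IsAzumayaStructure (w : W) (m : W →ₗ[k] W →ₗ[k] W) : Prop :=
  ∃ (A : Type v) (_ : Ring A) (_ : Algebra k A) (φ : W ≃ₗ[k] A),
    IsAzumaya k A ∧ φ w = 1 ∧ ∀ x y, φ (m x y) = φ x * φ y

/-- The variety of specialisations of Azumaya algebra structures on `W` with identity `w`: the
closure of the set of Azumaya structures in the affine space of all bilinear multiplications
on `W`. (Associative structures with identity `w` form a Zariski closed subset, so this is also
the closure in that subset, the variety underlying the schematic image.) -/
def SpAzu (w : W) : Set (W →ₗ[k] W →ₗ[k] W) :=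
  zariskiClosure k {m | IsAzumayaStructure w m}

/-- The action of `GL(W)` on multiplications by transport of structure:
`(h · m)(x, y) = h (m (h⁻¹ x, h⁻¹ y))`. -/
def algAct (h : W ≃ₗ[k] W) (m : W →ₗ[k] W →ₗ[k] W) : W →ₗ[k] W →ₗ[k] W :=
  (m.compl₁₂ (h.symm : W →ₗ[k] W) (h.symm : W →ₗ[k] W)).compr₂ (h : W →ₗ[k] W)

/-- The stabiliser of `w` in `GL(W)`. -/
def Stab (k : Type u) [Field k] [Module k W] (w : W) : Subgroup (W ≃ₗ[k] W) :=
  MulAction.stabilizer (W ≃ₗ[k] W) w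

/-- The orbit of a multiplication under the stabiliser of `w`. -/
def stabOrbit (w : W) (m : W →ₗ[k] W →ₗ[k] W) : Set (W →ₗ[k] W →ₗ[k] W) :=
  Set.range fun h : Stab k w => algAct (h : W ≃ₗ[k] W) m

/-- The subgroup of `Stab w` of the elements which are the identity modulo `w`; in a basis
`w, ε₁, ε₂, ε₃` these are the maps `w ↦ w`, `εᵢ ↦ εᵢ + tᵢ w`. -/
def Lw (k : Type u) [Field k] [Module k W] (w : W) : Subgroup (W ≃ₗ[k] W) where
  carrier := {h | h w = w ∧ ∀ x, h x - x ∈ Submodule.span k {w}}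
  one_mem' := ⟨rfl, fun x => by simp⟩
  mul_mem' := by
    rintro g h ⟨hg, hg'⟩ ⟨hh, hh'⟩
    refine ⟨by rw [LinearEquiv.mul_apply, hh, hg], fun x => ?_⟩
    have := add_mem (hg' (h x)) (hh' x)
    rwa [sub_add_sub_cancel] at this
  inv_mem' := by
    rintro h ⟨hh, hh'⟩
    have h1 : ∀ x, h (h⁻¹ x) = x := fun x => h.apply_symm_apply x
    have h2 : ∀ x, h⁻¹ (h x) = x := fun x => h.symm_apply_apply x
    refine ⟨by nth_rw 1 [← hh]; rw [h2], fun x => ?_⟩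
    have := neg_mem (hh' (h⁻¹ x))
    rwa [h1, neg_sub] at this

end Structures

/-! ### The parametrisation of specialised algebra structures by quadratic forms -/

section Theta

open CliffordAlgebra

variable {k : Type u} [Field k] {V : Type v} [AddCommGroup V] [Module k V]

/-- The even exterior algebra of `V`, i.e. the even Clifford algebra of the zero form. -/
abbrev EvenExterior (k : Type u) [Field k] (V : Type v) [AddCommGroup V] [Module k V] :=
  CliffordAlgebra.even (0 : QuadraticForm k V)

/-- The bilinear form `b(q)` inducing `q`, relative to a basis: with `λᵢ = q (eᵢ)` and `λᵢⱼ` the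
values of the associated symmetric form it is
`∑ᵢ λᵢ xᵢ yᵢ + λ₁₂ x₂ y₁ + λ₂₃ x₃ y₂ + λ₁₃ x₁ y₃`. -/
noncomputable def bilOf (e : Module.Basis (Fin 3) k V) (q : QuadraticForm k V) :
    LinearMap.BilinForm k V :=
  Matrix.toBilin e
    !![q (e 0), 0, QuadraticMap.polar q (e 0) (e 2);
       QuadraticMap.polar q (e 0) (e 1), q (e 1), 0;
       0, QuadraticMap.polar q (e 1) (e 2), q (e 2)]

theorem bilOf_toQuadraticMap (e : Module.Basis (Fin 3) k V) (q : QuadraticForm k V) :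
    (bilOf e q).toQuadraticMap = q := by
  ext x
  obtain ⟨a, b, c, rfl⟩ : ∃ a b c : k, x = a • e 0 + b • e 1 + c • e 2 :=
    ⟨e.repr x 0, e.repr x 1, e.repr x 2, by
      rw [← Fin.sum_univ_three fun i => e.repr x i • e i, e.sum_repr]⟩
  have h1 : q (a • e 0 + b • e 1 + c • e 2) = a * a * q (e 0) + b * b * q (e 1) + c * c * q (e 2)
      + a * b * QuadraticMap.polar q (e 0) (e 1) + a * c * QuadraticMap.polar q (e 0) (e 2)
      + b * c * QuadraticMap.polar q (e 1) (e 2) := by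
    rw [QuadraticMap.map_add q, QuadraticMap.map_add q]
    simp only [QuadraticMap.map_smul, QuadraticMap.polar_add_left, QuadraticMap.polar_smul_left,
      QuadraticMap.polar_smul_right, smul_eq_mul]
    ring
  rw [h1]
  have hB : ∀ i j, bilOf e q (e i) (e j) =
      !![q (e 0), 0, QuadraticMap.polar q (e 0) (e 2);
         QuadraticMap.polar q (e 0) (e 1), q (e 1), 0;
         0, QuadraticMap.polar q (e 1) (e 2), q (e 2)] i j := fun i j => by
    rw [← LinearMap.BilinForm.toMatrix_apply e, bilOf, LinearMap.BilinForm.toMatrix_toBilin]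
  simp only [LinearMap.BilinMap.toQuadraticMap_apply, map_add, map_smul, LinearMap.add_apply,
    LinearMap.smul_apply, hB, smul_eq_mul]
  simp
  ring

theorem neg_bilOf_toQuadraticMap (e : Module.Basis (Fin 3) k V) (q : QuadraticForm k V) :
    (-bilOf e q).toQuadraticMap = 0 - q := by
  rw [zero_sub, ← congrArg Neg.neg (bilOf_toQuadraticMap e q)]
  rfl

theorem contractLeft_mem_evenOdd {Q : QuadraticForm k V} (d : Module.Dual k V) (n : ZMod 2)
    (x : CliffordAlgebra Q) (hx : x ∈ evenOdd Q n) : contractLeft d x ∈ evenOdd Q (n + 1) := by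
  have hcomm : ∀ (m : V) (y : CliffordAlgebra Q), y ∈ evenOdd Q (n + 1) →
      ∀ m' : V, ι Q m' * (ι Q m * y) ∈ evenOdd Q (n + 1) := fun m y hy m' => by
    rw [← mul_assoc, ← zero_add (n + 1)]
    exact SetLike.mul_mem_graded (ι_mul_ι_mem_evenOdd_zero Q m' m) hy
  induction x, hx using evenOdd_induction with
  | range_ι_pow v hv =>
    obtain rfl | rfl : n = 0 ∨ n = 1 :=
        (by decide : ∀ n : ZMod 2, n = 0 ∨ n = 1) n
    · obtain ⟨r, rfl⟩ := Submodule.mem_one.mp ((pow_zero (LinearMap.range (ι Q))) ▸ hv :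
        v ∈ (1 : Submodule k (CliffordAlgebra Q)))
      rw [contractLeft_algebraMap]
      exact zero_mem _
    · obtain ⟨w, rfl⟩ : v ∈ LinearMap.range (ι Q) :=
        (pow_one (LinearMap.range (ι Q))) ▸ hv
      rw [contractLeft_ι, show (1 : ZMod 2) + 1 = 0 from rfl]
      exact SetLike.algebraMap_mem_graded _ _
  | add x y hx hy ihx ihy => rw [map_add]; exact add_mem ihx ihy
  | ι_mul_ι_mul m₁ m₂ x hx ih =>
    have hm : ∀ m : V, ι Q m * x ∈ evenOdd Q (n + 1) := fun m => by
      rw [add_comm]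
      exact SetLike.mul_mem_graded (ι_mem_evenOdd_one Q m) hx
    rw [mul_assoc, contractLeft_ι_mul, contractLeft_ι_mul, mul_sub, mul_smul_comm]
    exact sub_mem (Submodule.smul_mem _ _ (hm _))
      (sub_mem (Submodule.smul_mem _ _ (hm _)) (hcomm _ _ ih _))

theorem changeForm_mem_even {Q Q' : QuadraticForm k V} {B : LinearMap.BilinForm k V}
    (h : B.toQuadraticMap = Q' - Q) (x : CliffordAlgebra Q) (hx : x ∈ even Q) :
    changeForm h x ∈ even Q' := by
  change changeForm h x ∈ evenOdd Q' 0
  change x ∈ evenOdd Q 0 at hx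
  induction x, hx using even_induction with
  | algebraMap r => rw [changeForm_algebraMap]; exact SetLike.algebraMap_mem_graded _ _
  | add x y hx hy ihx ihy => rw [map_add]; exact add_mem ihx ihy
  | ι_mul_ι_mul m₁ m₂ x hx ih =>
    have h3 := SetLike.mul_mem_graded (ι_mem_evenOdd_one Q' m₂) ih
    have h4 := contractLeft_mem_evenOdd (B m₂) 0 _ ih
    rw [add_zero] at h3
    rw [zero_add] at h4
    have hodd := sub_mem h3 h4
    rw [mul_assoc, changeForm_ι_mul, changeForm_ι_mul]
    have h1 := SetLike.mul_mem_graded (ι_mem_evenOdd_one Q' m₁) hodd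
    have h2 := contractLeft_mem_evenOdd (B m₁) 1 _ hodd
    rw [show (1 : ZMod 2) + 1 = 0 from rfl] at h1 h2
    exact sub_mem h1 h2

/-- The linear isomorphism `ψ : C₀(V, q) ≃ Λ^even V` defined by the bilinear form `b(q)`, which
is characterised by `ψ 1 = 1` and `ψ (x · z) = x ∧ ψ z + b(q)(x, -) ⌋ ψ z` on the full Clifford
algebra; in particular `ψ (x · y) = x ∧ y + b(q)(x, y)` for `x`, `y` in `V`. -/
noncomputable def psi (e : Module.Basis (Fin 3) k V) (q : QuadraticForm k V) :
    even q ≃ₗ[k] EvenExterior k V where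
  toFun x := ⟨changeForm (neg_bilOf_toQuadraticMap e q) x, changeForm_mem_even _ _ x.2⟩
  map_add' x y := Subtype.ext (map_add (changeForm (neg_bilOf_toQuadraticMap e q)) x.1 y.1)
  map_smul' r x := Subtype.ext (map_smul (changeForm (neg_bilOf_toQuadraticMap e q)) r x.1)
  invFun x := ⟨changeForm (changeForm.neg_proof (neg_bilOf_toQuadraticMap e q)) x,
    changeForm_mem_even _ _ x.2⟩
  left_inv x := Subtype.ext ((changeFormEquiv (neg_bilOf_toQuadraticMap e q)).left_inv x.1)
  right_inv x := Subtype.ext ((changeFormEquiv (neg_bilOf_toQuadraticMap e q)).right_inv x.1)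

/-- The multiplication `θ(q)` on `Λ^even V` obtained by transporting that of the even Clifford
algebra `C₀(V, q)` along `ψ`. -/
noncomputable def theta (e : Module.Basis (Fin 3) k V) (q : QuadraticForm k V) :
    EvenExterior k V →ₗ[k] EvenExterior k V →ₗ[k] EvenExterior k V :=
  ((LinearMap.mul k (even q)).compl₁₂ ((psi e q).symm : EvenExterior k V →ₗ[k] even q)
    ((psi e q).symm : EvenExterior k V →ₗ[k] even q)).compr₂
    (psi e q : even q →ₗ[k] EvenExterior k V)

/-- The map `Θ(q, t) = t · θ(q)`. -/
noncomputable def Theta (e : Module.Basis (Fin 3) k V) (q : QuadraticForm k V)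
    (t : Lw k (1 : EvenExterior k V)) :
    EvenExterior k V →ₗ[k] EvenExterior k V →ₗ[k] EvenExterior k V :=
  algAct (t : EvenExterior k V ≃ₗ[k] EvenExterior k V) (theta e q)

end Theta

end TernaryForms

/-! Everything geometric happens in one affine space, whose coordinates are the coefficients `lam i`
of `xᵢ²` and `mu i` of `xᵢ₊₁ xᵢ₊₂`, together with free coordinates indexed by `τ`. Forms are the
case `τ = Empty`, specialised multiplications the case `τ = Fin 3`, where the free coordinates
describe an element of `Lw`. Both are images of this space under a polynomial map `Φ` with a linear
retraction (`IsPolySection`), that is, under a closed embedding. Closures, coordinate rings and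
smoothness can therefore be computed for the strata `discr ≠ 0`, `discr = 0` but not a square,
nonzero square, and zero.

Closures: the discriminant is a nonzero polynomial, squares are cut out by 2×2 minors
(`isSq_of_minors`), and each boundary point is the limit of a curve of products of linear forms
(`polyClosure_stratum`).

Smooth points: where some coordinates have a nonvanishing denominator `d` and determine all the
others rationally, the local ring is that of a polynomial ring (`IsChart.isSmoothAt`). On `discr =
0` one solves for `lam i`, whose coefficient is a principal minor. On squares one divides by some
`lam i`. In characteristic 2 the squares form the linear space `mu = 0`.

Singular points: a 1-jet killed by all differentials of equations, but with no lift to a higher jet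
on a given equation `G`, contradicts formal smoothness (`not_isSmoothAt_of_gradAt`). The
differentials vanish because enough curves lie on the variety (`gradAt_eq_zero_of_curve`). This
avoids determining the full vanishing ideal.

Classification: if some plane has nonzero discriminant, it contains a hyperbolic pair, and a vector
orthogonal to it decides between `x₁x₂ + x₃²` and `x₁x₂`. Otherwise the form is a square
(`exists_eq_stdForm`).

Multiplications: `b(q)` vanishes on the pairs `(eᵢ₊₁, eᵢ₊₂)`, so `ψ` carries the products `eᵢ₊₁eᵢ₊₂`
to a fixed basis of `Λ^even`, and the structure constants of `Θ(q, t)` are explicit polynomials from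
which `q` and `t` are read off linearly (`structureCoords_thetaPt`). An element of `Stab w` acts on
`W / kw ≅ Λ²V` as `Λ²g` for some `g`, so up to `Lw` it comes from an isometry `q → g·q`; hence the
`Stab w`-orbits are the images of the strata (`image_thetaPt_stratum`). Finally, Azumaya structures
are all isomorphic to `M₂(k)`, which is the even Clifford algebra of `x₁x₂ + x₃²`
(`setOf_isAzumayaStructure`). -/

namespace TernaryForms

open MvPolynomial

/-! ### Closed embeddings of affine spaces by polynomial sections of linear maps -/

section Embedding

variable {k : Type u} [Field k] {M : Type v} [AddCommGroup M] [Module k M] {σ : Type*}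

/-- `Φ` is a polynomial section of the linear map `ψ`. Such a map is a closed embedding of the
affine space with coordinates indexed by `σ` into `M`. -/
structure IsPolySection (ψ : M →ₗ[k] (σ → k)) (Φ : (σ → k) → M) : Prop where
  left_inv : ∀ z, ψ (Φ z) = z
  poly : ∀ l : Module.Dual k M, ∃ N : MvPolynomial σ k, ∀ z, l (Φ z) = eval z N

/-- The Zariski closure in a coordinate space. -/
def polyClosure (S : Set (σ → k)) : Set (σ → k) :=
  {z | ∀ f : MvPolynomial σ k, (∀ s ∈ S, eval s f = 0) → eval z f = 0}

variable {ψ : M →ₗ[k] (σ → k)} {Φ : (σ → k) → M}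

theorem IsPolySection.injective (h : IsPolySection ψ Φ) : Function.Injective Φ :=
  Function.LeftInverse.injective h.left_inv

theorem IsPolySection.exists_eval_of_mem_polyFun (h : IsPolySection ψ Φ) {f : M → k}
    (hf : f ∈ polyFun k M) : ∃ N : MvPolynomial σ k, ∀ z, f (Φ z) = eval z N := by
  induction hf using Algebra.adjoin_induction with
  | mem f hf => obtain ⟨l, rfl⟩ := hf; exact h.poly l
  | algebraMap r => exact ⟨C r, fun z => by simp⟩
  | add f g _ _ hf hg =>
    obtain ⟨N, hN⟩ := hf
    obtain ⟨N', hN'⟩ := hg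
    exact ⟨N + N', fun z => by simp [hN, hN']⟩
  | mul f g _ _ hf hg =>
    obtain ⟨N, hN⟩ := hf
    obtain ⟨N', hN'⟩ := hg
    exact ⟨N * N', fun z => by simp [hN, hN']⟩

theorem eval_comp_mem_polyFun (ψ : M →ₗ[k] (σ → k)) (N : MvPolynomial σ k) :
    (fun x => eval (ψ x) N) ∈ polyFun k M := by
  induction N using MvPolynomial.induction_on with
  | C a =>
    simp only [eval_C]
    exact Subalgebra.algebraMap_mem (polyFun k M) a
  | add p q hp hq =>
    simp only [map_add]
    exact add_mem hp hq
  | mul_X p s hp =>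
    have : (fun x => ψ x s) ∈ polyFun k M :=
      Algebra.subset_adjoin ⟨(LinearMap.proj s).comp ψ, rfl⟩
    simp only [map_mul, eval_X]
    exact mul_mem hp this

/-- The image of `Φ` is closed: it is defined by the polynomial equations `l (Φ (ψ x)) = l x`, one
for each linear form `l`, and linear forms separate points. Polynomial functions pull back along
both `ψ` and `Φ`, so vanishing conditions correspond. -/
theorem IsPolySection.zariskiClosure_image (h : IsPolySection ψ Φ) (S : Set (σ → k)) :
    zariskiClosure k (Φ '' S) = Φ '' polyClosure S := by
  ext x
  constructor
  · intro hx
    have hfix : Φ (ψ x) = x := by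
      rw [← sub_eq_zero, ← Module.forall_dual_apply_eq_zero_iff k]
      intro l
      obtain ⟨N, hN⟩ := h.poly l
      have hmem : (fun y => eval (ψ y) N - l y) ∈ polyFun k M :=
        sub_mem (eval_comp_mem_polyFun ψ N) (Algebra.subset_adjoin ⟨l, rfl⟩)
      have := hx _ hmem (by
        rintro _ ⟨z, -, rfl⟩
        simp only [h.left_inv, hN, sub_self])
      rwa [map_sub, hN]
    refine ⟨ψ x, fun f hf => ?_, hfix⟩
    refine hx _ (eval_comp_mem_polyFun ψ f) ?_
    rintro _ ⟨z, hz, rfl⟩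
    rw [h.left_inv]
    exact hf z hz
  · rintro ⟨z, hz, rfl⟩ f hf hfS
    obtain ⟨N, hN⟩ := h.exists_eval_of_mem_polyFun hf
    rw [hN]
    exact hz N fun s hs => by rw [← hN]; exact hfS _ ⟨s, hs, rfl⟩

/-- The restriction of polynomials in the coordinates `ψ` to a subset. -/
noncomputable def coordMap (ψ : M →ₗ[k] (σ → k)) (T : Set M) :
    MvPolynomial σ k →ₐ[k] coordRing k T :=
  aeval fun s => ⟨fun t => ψ t s, Algebra.subset_adjoin ⟨(LinearMap.proj s).comp ψ, rfl⟩⟩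

theorem coordMap_apply (ψ : M →ₗ[k] (σ → k)) (T : Set M) (N : MvPolynomial σ k) (t : T) :
    (coordMap ψ T N).1 t = eval (ψ t) N := by
  induction N using MvPolynomial.induction_on with
  | C a => simp [coordMap]
  | add p q hp hq => simp [hp, hq]
  | mul_X p s hp => simp [hp]; simp [coordMap]

theorem coordMap_eq_zero_iff (h : IsPolySection ψ Φ) (Z : Set (σ → k)) (N : MvPolynomial σ k) :
    coordMap ψ (Φ '' Z) N = 0 ↔ ∀ z ∈ Z, eval z N = 0 := by
  constructor
  · intro h0 z hz
    have := coordMap_apply ψ (Φ '' Z) N ⟨Φ z, z, hz, rfl⟩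
    rw [h0, h.left_inv] at this
    exact this.symm
  · intro h0
    apply Subtype.ext
    funext t
    obtain ⟨_, z, hz, rfl⟩ := t
    rw [coordMap_apply]
    simpa [h.left_inv] using h0 z hz

theorem coordMap_mem_pointIdeal_iff (h : IsPolySection ψ Φ) (Z : Set (σ → k))
    (N : MvPolynomial σ k) (z : σ → k) (hz : Φ z ∈ Φ '' Z) :
    coordMap ψ (Φ '' Z) N ∈ pointIdeal k (⟨Φ z, hz⟩ : Φ '' Z) ↔ eval z N = 0 := by
  rw [pointIdeal, RingHom.mem_ker]
  have := coordMap_apply ψ (Φ '' Z) N ⟨Φ z, hz⟩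
  rw [h.left_inv] at this
  rw [← this]
  rfl

/-- On the image of `Φ` every linear form is a polynomial in the coordinates `ψ`, so the coordinate
ring is a quotient of the polynomial ring. -/
theorem coordMap_surjective (h : IsPolySection ψ Φ) (Z : Set (σ → k)) :
    Function.Surjective (coordMap ψ (Φ '' Z)) := by
  rintro ⟨f, hf⟩
  suffices ∃ N, (coordMap ψ (Φ '' Z) N).1 = f from this.imp fun N hN => Subtype.ext hN
  induction hf using Algebra.adjoin_induction with
  | mem f hf =>
    obtain ⟨l, rfl⟩ := hf
    obtain ⟨N, hN⟩ := h.poly l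
    refine ⟨N, funext ?_⟩
    rintro ⟨_, z, hz, rfl⟩
    rw [coordMap_apply]
    simp only [h.left_inv, hN]
  | algebraMap r => exact ⟨C r, by funext t; rw [coordMap_apply]; simp⟩
  | add f g _ _ hf hg =>
    obtain ⟨N, rfl⟩ := hf
    obtain ⟨N', rfl⟩ := hg
    exact ⟨N + N', by simp⟩
  | mul f g _ _ hf hg =>
    obtain ⟨N, rfl⟩ := hf
    obtain ⟨N', rfl⟩ := hg
    exact ⟨N * N', by simp⟩

end Embedding

/-! ### Smoothness from a chart -/

section Chart

variable {k : Type u} [Field k]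

/-- The hypotheses say that `P` and `A` agree after inverting `d`. As `d` is a unit at `𝔭`, the
local ring of `A` at `𝔭` is a localisation of `P`, hence formally smooth over `P` and so over `k`.
-/
theorem isSmoothAt_of_chart {P A : Type*} [CommRing P] [CommRing A] [Algebra k P] [Algebra k A]
    [Algebra.FormallySmooth k P] (φ : P →ₐ[k] A) (hφ : Function.Injective φ) (d : P)
    (hd : ∀ a, ∃ (n : ℕ) (b : P), φ d ^ n * a = φ b) (𝔭 : Ideal A) [h𝔭 : 𝔭.IsPrime]
    (hd𝔭 : φ d ∉ 𝔭) : Algebra.IsSmoothAt k 𝔭 := by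
  let _ : Algebra P A := φ.toRingHom.toAlgebra
  have : IsScalarTower k P A := IsScalarTower.of_algebraMap_eq fun r => (φ.commutes r).symm
  have hPA : ∀ x, algebraMap P A x = φ x := fun _ => rfl
  let 𝔮 : Ideal P := 𝔭.comap φ
  have : 𝔮.IsPrime := Ideal.IsPrime.comap φ
  have hcomp : ∀ x, algebraMap P (Localization.AtPrime 𝔭) x =
      algebraMap A (Localization.AtPrime 𝔭) (φ x) := fun x => by
    rw [IsScalarTower.algebraMap_apply P A (Localization.AtPrime 𝔭), hPA]
  have hpow : ∀ n, φ d ^ n ∉ 𝔭 := fun n hn => hd𝔭 (h𝔭.mem_of_pow_mem n hn)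
  have : IsLocalization 𝔮.primeCompl (Localization.AtPrime 𝔭) :=
    { map_units := by
        rintro ⟨x, hx⟩
        rw [hcomp]
        exact IsLocalization.map_units (Localization.AtPrime 𝔭) (⟨φ x, hx⟩ : 𝔭.primeCompl)
      surj := by
        intro z
        obtain ⟨⟨a, s, hs⟩, has⟩ := IsLocalization.surj 𝔭.primeCompl z
        obtain ⟨n, b, hb⟩ := hd a
        obtain ⟨m, c, hc⟩ := hd s
        -- Cross-multiplication: `a = b / d ^ n` and `s = c / d ^ m`, so `a / s` is `b d ^ m` over
        -- `c d ^ n`.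
        have hcs : c * d ^ n ∈ 𝔮.primeCompl := by
          change φ (c * d ^ n) ∉ 𝔭
          rw [map_mul, map_pow, ← hc]
          exact fun h' => (h𝔭.mem_or_mem h').elim
            (fun h'' => (h𝔭.mem_or_mem h'').elim (hpow _) hs) (hpow _)
        refine ⟨⟨b * d ^ m, ⟨c * d ^ n, hcs⟩⟩, ?_⟩
        simp only [hcomp]
        rw [map_mul φ, map_mul φ, map_pow, map_pow, ← hb, ← hc]
        simp only [map_mul]
        simp only at has
        rw [← has]
        ring
      exists_of_eq := by
        intro x y hxy
        rw [hcomp, hcomp] at hxy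
        obtain ⟨⟨s, hs⟩, hsx⟩ := IsLocalization.exists_of_eq (M := 𝔭.primeCompl) hxy
        obtain ⟨m, c, hc⟩ := hd s
        refine ⟨⟨c, ?_⟩, hφ ?_⟩
        · change φ c ∉ 𝔭
          rw [← hc]
          exact fun h' => (h𝔭.mem_or_mem h').elim (hpow _) hs
        · simp only [map_mul, ← hc]
          simp only at hsx
          rw [mul_assoc, hsx, mul_assoc] }
  have : Algebra.FormallySmooth P (Localization.AtPrime 𝔭) :=
    Algebra.FormallySmooth.of_isLocalization 𝔮.primeCompl
  exact Algebra.FormallySmooth.comp k P (Localization.AtPrime 𝔭)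

variable {M : Type v} [AddCommGroup M] [Module k M] {σ : Type*}
  {ψ : M →ₗ[k] (σ → k)} {Φ : (σ → k) → M}

/-- A set of coordinates `K` and a polynomial `d` in them form a chart of `Z`: on the locus
`d ≠ 0` the projection to these coordinates has a rational inverse. -/
structure IsChart (Z : Set (σ → k)) (K : Set σ) (d : MvPolynomial K k) : Prop where
  ne_zero : d ≠ 0
  surj : ∀ y : K → k, eval y d ≠ 0 → ∃ z ∈ Z, ∀ s : K, z s = y s
  inv : ∀ s, ∃ (n : ℕ) (b : MvPolynomial K k), ∀ z ∈ Z,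
    eval (fun s : K => z s) d ^ n * z s = eval (fun s : K => z s) b

theorem IsChart.exists_pow_mul {Z : Set (σ → k)} {K : Set σ} {d : MvPolynomial K k}
    (hc : IsChart Z K d) (f : MvPolynomial σ k) :
    ∃ (n : ℕ) (b : MvPolynomial K k), ∀ z ∈ Z,
      eval (fun s : K => z s) d ^ n * eval z f = eval (fun s : K => z s) b := by
  induction f using MvPolynomial.induction_on with
  | C a => exact ⟨0, C a, fun z _ => by simp⟩
  | add p q hp hq =>
    obtain ⟨n, b, hb⟩ := hp
    obtain ⟨n', b', hb'⟩ := hq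
    refine ⟨n + n', d ^ n' * b + d ^ n * b', fun z hz => ?_⟩
    simp only [map_add, map_mul, map_pow, ← hb z hz, ← hb' z hz]
    ring
  | mul_X p s hp =>
    obtain ⟨n, b, hb⟩ := hp
    obtain ⟨n', b', hb'⟩ := hc.inv s
    refine ⟨n + n', b * b', fun z hz => ?_⟩
    simp only [map_mul, eval_X, ← hb z hz, ← hb' z hz]
    ring

/-- The projection of `Z` covers the locus `d ≠ 0`, so a polynomial in the chart coordinates that
vanishes on `Z` vanishes everywhere after multiplication by `d`. -/
theorem coordMap_rename_injective [Infinite k] (h : IsPolySection ψ Φ) {Z : Set (σ → k)}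
    {K : Set σ} {d : MvPolynomial K k} (hc : IsChart Z K d) :
    Function.Injective ((coordMap ψ (Φ '' Z)).comp (rename ((↑) : K → σ))) := by
  rw [injective_iff_map_eq_zero]
  intro N hN
  rw [AlgHom.comp_apply, coordMap_eq_zero_iff h] at hN
  have : N * d = 0 := by
    refine MvPolynomial.funext fun y => ?_
    rw [map_mul, map_zero]
    by_cases hy : eval y d = 0
    · rw [hy, mul_zero]
    · obtain ⟨z, hz, hzy⟩ := hc.surj y hy
      have := hN z hz
      rw [eval_rename] at this
      rw [show y = z ∘ ((↑) : K → σ) from funext fun s => (hzy s).symm, this, zero_mul]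
  exact (mul_eq_zero.mp this).resolve_right hc.ne_zero

theorem IsChart.isSmoothAt [Infinite k] (h : IsPolySection ψ Φ) {Z : Set (σ → k)}
    {K : Set σ} {d : MvPolynomial K k} (hc : IsChart Z K d) (z : σ → k) (hz : Φ z ∈ Φ '' Z)
    (hd : eval (fun s : K => z s) d ≠ 0) :
    Algebra.IsSmoothAt k (pointIdeal k (⟨Φ z, hz⟩ : Φ '' Z)) := by
  refine isSmoothAt_of_chart _ (coordMap_rename_injective h hc) d ?_ _ ?_
  · intro a
    obtain ⟨f, rfl⟩ := coordMap_surjective h Z a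
    obtain ⟨n, b, hb⟩ := hc.exists_pow_mul f
    refine ⟨n, b, ?_⟩
    rw [AlgHom.comp_apply, AlgHom.comp_apply, ← map_pow, ← map_mul, ← sub_eq_zero, ← map_sub,
      coordMap_eq_zero_iff h]
    intro z hz
    rw [map_sub, map_mul, map_pow, eval_rename, eval_rename, sub_eq_zero]
    exact hb z hz
  · rw [AlgHom.comp_apply, coordMap_mem_pointIdeal_iff h, eval_rename]
    exact hd

/-- With denominator `1` the chart is global and the coordinate ring is a polynomial ring. -/
theorem IsChart.smooth [Infinite k] [Finite σ] (h : IsPolySection ψ Φ) {Z : Set (σ → k)}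
    {K : Set σ} (hc : IsChart Z K (1 : MvPolynomial K k)) :
    Algebra.Smooth k (coordRing k (Φ '' Z)) := by
  have hsurj : Function.Surjective ((coordMap ψ (Φ '' Z)).comp (rename ((↑) : K → σ))) := by
    intro a
    obtain ⟨f, rfl⟩ := coordMap_surjective h Z a
    obtain ⟨n, b, hb⟩ := hc.exists_pow_mul f
    refine ⟨b, ?_⟩
    rw [AlgHom.comp_apply, ← sub_eq_zero, ← map_sub, coordMap_eq_zero_iff h]
    intro z hz
    have := hb z hz
    rw [map_one, one_pow, one_mul] at this
    rw [map_sub, eval_rename, this, sub_eq_zero]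
    rfl
  have : Algebra.Smooth k (MvPolynomial K k) := {}
  exact Algebra.Smooth.of_equiv (AlgEquiv.ofBijective _ ⟨coordMap_rename_injective h hc, hsurj⟩)

end Chart

/-! ### Taylor expansion along curves, and closures -/

section Taylor

variable {k : Type u} [Field k] {σ : Type*}

/-- The differential of a polynomial at a point. -/
noncomputable def gradAt [Fintype σ] (f : MvPolynomial σ k) (p : σ → k) : (σ → k) →ₗ[k] k :=
  ∑ s, eval p (pderiv s f) • LinearMap.proj s

theorem gradAt_apply [Fintype σ] (f : MvPolynomial σ k) (p v : σ → k) :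
    gradAt f p v = ∑ s, eval p (pderiv s f) * v s := by
  simp [gradAt]

theorem gradAt_mul_X [Fintype σ] (f : MvPolynomial σ k) (s : σ) (p v : σ → k) :
    gradAt (f * X s) p v = gradAt f p v * p s + eval p f * v s := by
  classical
  simp only [gradAt_apply, Derivation.leibniz, smul_eq_mul, map_add, map_mul, pderiv_X, eval_X,
    add_mul, Finset.sum_add_distrib]
  rw [add_comm, Finset.sum_mul]
  congr 1
  · exact Finset.sum_congr rfl fun i _ => by ring
  · rw [Finset.sum_eq_single s]
    · simp
    · intro b _ hb
      rw [Pi.single_eq_of_ne' hb]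
      simp
    · simp

/-- The point is that `q`, the second-order term along `v`, does not depend on `w`: curves with the
same velocity but different accelerations can then be compared. The ring `B` is left free so as to
cover both polynomials and power series. -/
theorem exists_taylor [Fintype σ] (f : MvPolynomial σ k) (p v : σ → k) :
    ∃ q : k, ∀ (B : Type u) [CommRing B] [Algebra k B] (x : B) (w : σ → k), ∃ R : B,
      aeval (fun s => algebraMap k B (p s) + x * algebraMap k B (v s)
        + x ^ 2 * algebraMap k B (w s)) f =
      algebraMap k B (eval p f) + x * algebraMap k B (gradAt f p v)
        + x ^ 2 * algebraMap k B (q + gradAt f p w) + x ^ 3 * R := by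
  induction f using MvPolynomial.induction_on with
  | C a =>
    refine ⟨0, fun B _ _ x w => ⟨0, ?_⟩⟩
    simp [gradAt_apply, algHom_C]
  | add f g hf hg =>
    obtain ⟨q, hq⟩ := hf
    obtain ⟨q', hq'⟩ := hg
    refine ⟨q + q', fun B _ _ x w => ?_⟩
    obtain ⟨R, hR⟩ := hq B x w
    obtain ⟨R', hR'⟩ := hq' B x w
    refine ⟨R + R', ?_⟩
    have hgrad : ∀ u, gradAt (f + g) p u = gradAt f p u + gradAt g p u := fun u => by
      simp [gradAt_apply, add_mul, Finset.sum_add_distrib]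
    rw [map_add, hR, hR', hgrad, hgrad]
    simp only [map_add]
    ring
  | mul_X f s hf =>
    obtain ⟨q, hq⟩ := hf
    refine ⟨q * p s + gradAt f p v * v s, fun B _ _ x w => ?_⟩
    obtain ⟨R, hR⟩ := hq B x w
    rw [map_mul, hR, aeval_X, gradAt_mul_X, gradAt_mul_X]
    simp only [map_add, map_mul, eval_X]
    refine ⟨R * (algebraMap k B (p s) + x * algebraMap k B (v s)
        + x ^ 2 * algebraMap k B (w s)) + algebraMap k B (gradAt f p v) * algebraMap k B (w s)
        + (algebraMap k B q + algebraMap k B (gradAt f p w)) * (algebraMap k B (v s)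
        + x * algebraMap k B (w s)), ?_⟩
    ring

theorem aeval_polynomial_eval (f : MvPolynomial σ k) (c : σ → Polynomial k) (t : k) :
    (aeval c f).eval t = eval (fun s => (c s).eval t) f := by
  induction f using MvPolynomial.induction_on with
  | C a => simp [algHom_C]
  | add p q hp hq => simp [hp, hq]
  | mul_X p s hp => simp [hp]

/-- A polynomial vanishing on `S` restricts to a polynomial in `t` that is zero for all `t ≠ 0`,
hence identically. -/
theorem mem_polyClosure_of_curve [Infinite k] {S : Set (σ → k)} (c : σ → Polynomial k)
    (hc : ∀ t, t ≠ 0 → (fun s => (c s).eval t) ∈ S) : (fun s => (c s).eval 0) ∈ polyClosure S := by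
  intro f hf
  have : Polynomial.X * aeval c f = 0 := by
    refine Polynomial.funext fun t => ?_
    by_cases ht : t = 0
    · simp [ht]
    · rw [Polynomial.eval_mul, aeval_polynomial_eval, hf _ (hc t ht)]
      simp
  rw [← aeval_polynomial_eval, (mul_eq_zero.mp this).resolve_left Polynomial.X_ne_zero]
  simp

/-- The line gives vanishing of the first-order term and of the second-order term `q`. For the
parabola the coefficient of `t²` is `q` plus the differential along `w`, so that differential
vanishes too. This second-order information replaces a division by `2`, and so works in
characteristic 2. -/
theorem gradAt_eq_zero_of_curve [Fintype σ] [Infinite k] {Z : Set (σ → k)} {f : MvPolynomial σ k}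
    (hf : ∀ z ∈ Z, eval z f = 0) {p v : σ → k} (hline : ∀ t : k, p + t • v ∈ Z) :
    gradAt f p v = 0 ∧ ∀ w : σ → k, (∀ t : k, p + t • v + t ^ 2 • w ∈ Z) → gradAt f p w = 0 := by
  obtain ⟨q, hq⟩ := exists_taylor f p v
  have key : ∀ w : σ → k, (∀ t : k, p + t • v + t ^ 2 • w ∈ Z) →
      gradAt f p v = 0 ∧ q + gradAt f p w = 0 := by
    intro w hw
    obtain ⟨R, hR⟩ := hq (Polynomial k) Polynomial.X w
    have h0 : aeval (fun s => algebraMap k (Polynomial k) (p s)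
        + Polynomial.X * algebraMap k (Polynomial k) (v s)
        + Polynomial.X ^ 2 * algebraMap k (Polynomial k) (w s)) f = 0 := by
      refine Polynomial.funext fun t => ?_
      rw [aeval_polynomial_eval, Polynomial.eval_zero]
      rw [← hf _ (hw t)]
      congr 2
      funext s
      simp only [Polynomial.eval_add, Polynomial.eval_mul, Polynomial.eval_pow, Polynomial.eval_X,
        Polynomial.algebraMap_eq, Polynomial.eval_C, Pi.add_apply, Pi.smul_apply, smul_eq_mul]
    rw [h0] at hR
    have h1 := congrArg (Polynomial.coeff · 1) hR
    have h2 := congrArg (Polynomial.coeff · 2) hR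
    simp [Polynomial.algebraMap_eq, Polynomial.coeff_X_pow_mul', Polynomial.coeff_C] at h1 h2
    exact ⟨h1.symm, h2.symm⟩
  have hz := key 0 (by simpa using hline)
  rw [map_zero, add_zero] at hz
  refine ⟨hz.1, fun w hw => ?_⟩
  have := (key w hw).2
  rwa [hz.2, zero_add] at this

end Taylor

/-! ### Failure of smoothness from jets that do not lift -/

section Jet

variable {k : Type u} [Field k] {σ : Type*}

-- The jet `γ` modulo `X ^ r` satisfies the equations of `A` and is centred at `𝔭`, so it defines a
-- map from the local ring to `k⟦X⟧ / X ^ r`. Formal smoothness would lift it to `k⟦X⟧ / X ^ N`, and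
-- the lift would satisfy `G` modulo `X ^ N`.
open PowerSeries in
theorem not_formallySmooth_of_jet {A S : Type*} [CommRing A] [Algebra k A] [CommRing S]
    [Algebra A S] [Algebra k S] [IsScalarTower k A S] (π : MvPolynomial σ k →ₐ[k] A)
    (hπ : Function.Surjective π) (𝔭 : Ideal A) [𝔭.IsPrime] (γ : σ → k⟦X⟧)
    (h𝔭 : ∀ f, PowerSeries.constantCoeff (aeval γ f) = 0 → π f ∈ 𝔭) {r N : ℕ} (hr : r ≠ 0)
    (hrN : r ≤ N) (hker : ∀ f, π f = 0 → (PowerSeries.X : k⟦X⟧) ^ r ∣ aeval γ f)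
    (G : MvPolynomial σ k) (hG : π G = 0)
    (hlift : ∀ γ' : σ → k⟦X⟧, (∀ s, (PowerSeries.X : k⟦X⟧) ^ r ∣ γ' s - γ s) →
      ¬ (PowerSeries.X : k⟦X⟧) ^ N ∣ aeval γ' G) [IsLocalization.AtPrime S 𝔭] :
    ¬ Algebra.FormallySmooth k S := by
  intro hsm
  let J : Ideal k⟦X⟧ := Ideal.span {PowerSeries.X ^ N}
  let q : k⟦X⟧ →ₐ[k] k⟦X⟧ ⧸ J := Ideal.Quotient.mkₐ k J
  let I : Ideal (k⟦X⟧ ⧸ J) := Ideal.span {q (PowerSeries.X ^ r)}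
  let q' : k⟦X⟧ →ₐ[k] (k⟦X⟧ ⧸ J) ⧸ I := (Ideal.Quotient.mkₐ k I).comp q
  have hq : ∀ x, q x = 0 ↔ PowerSeries.X ^ N ∣ x := fun x => by
    rw [← Ideal.mem_span_singleton]; exact Ideal.Quotient.eq_zero_iff_mem
  have hq' : ∀ x, q' x = 0 ↔ PowerSeries.X ^ r ∣ x := fun x => by
    have h1 : q' x = 0 ↔ q x ∈ I := Ideal.Quotient.eq_zero_iff_mem
    rw [h1, Ideal.mem_span_singleton]
    constructor
    · rintro ⟨y, hy⟩
      obtain ⟨y, rfl⟩ := Ideal.Quotient.mkₐ_surjective k J y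
      change q x = q _ * q y at hy
      rw [← map_mul, ← sub_eq_zero, ← map_sub, hq] at hy
      have := ((pow_dvd_pow _ hrN).trans hy).add (dvd_mul_right (PowerSeries.X ^ r) y)
      rwa [sub_add_cancel] at this
    · exact fun h => map_dvd q h
  have hI : IsNilpotent I := by
    refine ⟨N, ?_⟩
    rw [Ideal.span_singleton_pow, ← map_pow, ← pow_mul, Ideal.zero_eq_bot,
      Ideal.span_singleton_eq_bot, hq]
    exact pow_dvd_pow _ (Nat.le_mul_of_pos_left N (Nat.pos_of_ne_zero hr))
  let g₀ : A →ₐ[k] (k⟦X⟧ ⧸ J) ⧸ I :=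
    (Ideal.Quotient.liftₐ (RingHom.ker π) (q'.comp (aeval γ)) fun f hf => by
      rw [AlgHom.comp_apply, hq']
      exact hker f hf).comp (Ideal.quotientKerAlgEquivOfSurjective hπ).symm.toAlgHom
  have hg₀ : ∀ f, g₀ (π f) = q' (aeval γ f) := fun f => by
    have : (Ideal.quotientKerAlgEquivOfSurjective hπ).symm (π f) = Ideal.Quotient.mk _ f := by
      rw [AlgEquiv.symm_apply_eq]; rfl
    simp only [g₀, AlgHom.comp_apply]
    erw [this]
    rfl
  have hunit : ∀ s : 𝔭.primeCompl, IsUnit (g₀ s) := by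
    rintro ⟨s, hs⟩
    obtain ⟨f, rfl⟩ := hπ s
    change IsUnit (g₀ (π f))
    rw [hg₀]
    refine IsUnit.map q' ?_
    rw [PowerSeries.isUnit_iff_constantCoeff, isUnit_iff_ne_zero]
    exact fun h0 => hs (h𝔭 f h0)
  let g : S →ₐ[k] (k⟦X⟧ ⧸ J) ⧸ I := 
    IsLocalization.liftAlgHom (M := 𝔭.primeCompl) (P := (k⟦X⟧ ⧸ J) ⧸ I) (f := g₀) hunit
  obtain ⟨F, hF⟩ := Algebra.FormallySmooth.exists_lift I hI g
  let F' : MvPolynomial σ k →ₐ[k] k⟦X⟧ ⧸ J :=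
    (F.comp (IsScalarTower.toAlgHom k A S)).comp π
  have hF' : ∀ f, Ideal.Quotient.mkₐ k I (F' f) = q' (aeval γ f) := fun f => by
    rw [← hg₀]
    have h1 := AlgHom.congr_fun hF (algebraMap A _ (π f))
    have h2 : g (algebraMap A _ (π f)) = g₀ (π f) := by
      simp only [g, IsLocalization.liftAlgHom_apply]
      exact IsLocalization.lift_eq _ _
    rw [← h2, ← h1]
    rfl
  choose γ' hγ' using fun s => Ideal.Quotient.mkₐ_surjective k J (F' (MvPolynomial.X s))
  have hF'' : F' = q.comp (aeval γ') := MvPolynomial.algHom_ext fun s => by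
    rw [q.comp_apply, aeval_X]; exact (hγ' s).symm
  refine hlift γ' (fun s => ?_) ?_
  · rw [← hq', map_sub, sub_eq_zero]
    have := hF' (MvPolynomial.X s)
    rw [← hγ', aeval_X] at this
    exact this
  · rw [← hq, ← AlgHom.comp_apply, ← hF'']
    change F (algebraMap A _ (π G)) = 0
    rw [hG, map_zero, map_zero]

variable {M : Type v} [AddCommGroup M] [Module k M] {ψ : M →ₗ[k] (σ → k)} {Φ : (σ → k) → M}

-- The case `r = 2` of the jet criterion: the jet `p + X v` satisfies the equations modulo `X ^ 2`
-- exactly because their differentials at `p` kill `v`.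
open PowerSeries in
theorem not_isSmoothAt_of_gradAt [Fintype σ] (h : IsPolySection ψ Φ) {Z : Set (σ → k)}
    {p : σ → k} (hp : Φ p ∈ Φ '' Z) (v : σ → k)
    (hgrad : ∀ f, (∀ z ∈ Z, eval z f = 0) → gradAt f p v = 0)
    (G : MvPolynomial σ k) (hG : ∀ z ∈ Z, eval z G = 0) {N : ℕ} (hN : 2 ≤ N)
    (hlift : ∀ u : σ → k⟦X⟧, ¬ (PowerSeries.X : k⟦X⟧) ^ N ∣
      aeval (fun s => PowerSeries.C (p s) + PowerSeries.X * PowerSeries.C (v s)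
        + PowerSeries.X ^ 2 * u s) G) :
    ¬ Algebra.IsSmoothAt k (pointIdeal k (⟨Φ p, hp⟩ : Φ '' Z)) := by
  have hpZ : p ∈ Z := by
    obtain ⟨z, hz, hzp⟩ := hp
    rwa [← h.injective hzp]
  have htaylor : ∀ f : MvPolynomial σ k, ∃ R : k⟦X⟧,
      aeval (fun s => PowerSeries.C (p s) + PowerSeries.X * PowerSeries.C (v s)) f =
        PowerSeries.C (eval p f) + PowerSeries.X * PowerSeries.C (gradAt f p v)
        + PowerSeries.X ^ 2 * R := fun f => by
    obtain ⟨q, hq⟩ := exists_taylor f p v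
    obtain ⟨R, hR⟩ := hq k⟦X⟧ PowerSeries.X 0
    simp only [Pi.zero_apply, map_zero, mul_zero, add_zero] at hR
    exact ⟨PowerSeries.C q + PowerSeries.X * R, hR.trans (by
      simp only [PowerSeries.algebraMap_eq]; ring)⟩
  refine not_formallySmooth_of_jet (coordMap ψ (Φ '' Z)) (coordMap_surjective h Z)
    (pointIdeal k (⟨Φ p, hp⟩ : Φ '' Z))
    (fun s => PowerSeries.C (p s) + PowerSeries.X * PowerSeries.C (v s)) ?_ two_ne_zero hN ?_ G
    ((coordMap_eq_zero_iff h Z G).mpr hG) ?_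
  · intro f hf
    rw [coordMap_mem_pointIdeal_iff h]
    obtain ⟨R, hR⟩ := htaylor f
    rw [hR] at hf
    simpa using hf
  · intro f hf
    rw [coordMap_eq_zero_iff h] at hf
    obtain ⟨R, hR⟩ := htaylor f
    rw [hR, hf p hpZ, hgrad f hf]
    simp
  · intro γ' hγ'
    choose u hu using hγ'
    have : γ' = fun s => PowerSeries.C (p s) + PowerSeries.X * PowerSeries.C (v s)
        + PowerSeries.X ^ 2 * u s := funext fun s => by rw [← hu]; ring
    rw [this]
    exact hlift u

end Jet

end TernaryForms

namespace TernaryForms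

open MvPolynomial

/-! ### The stratification of the coordinate space of ternary quadratic forms -/

section Discr

/-- The half-discriminant in terms of the coefficients: `l i` is the coefficient of `xᵢ²` and `m i`
the coefficient of `xᵢ₊₁ xᵢ₊₂` (indices modulo `3`). -/
def discr {R : Type*} [CommRing R] (l m : Fin 3 → R) : R :=
  4 * l 0 * l 1 * l 2 + m 0 * m 1 * m 2 - (l 0 * m 0 ^ 2 + l 1 * m 1 ^ 2 + l 2 * m 2 ^ 2)

/-- Cyclic symmetry lets every later argument single out an arbitrary index `i` without splitting
into three cases. -/
theorem discr_cyclic {R : Type*} [CommRing R] (l m : Fin 3 → R) (i : Fin 3) :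
    discr l m = 4 * l i * l (i + 1) * l (i + 2) + m i * m (i + 1) * m (i + 2)
      - (l i * m i ^ 2 + l (i + 1) * m (i + 1) ^ 2 + l (i + 2) * m (i + 2) ^ 2) := by
  fin_cases i
  · rfl
  · change _ = 4 * l 1 * l 2 * l 0 + m 1 * m 2 * m 0
      - (l 1 * m 1 ^ 2 + l 2 * m 2 ^ 2 + l 0 * m 0 ^ 2)
    rw [discr]; ring
  · change _ = 4 * l 2 * l 0 * l 1 + m 2 * m 0 * m 1
      - (l 2 * m 2 ^ 2 + l 0 * m 0 ^ 2 + l 1 * m 1 ^ 2)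
    rw [discr]; ring

theorem map_discr {R S : Type*} [CommRing R] [CommRing S] (φ : R →+* S) (l m : Fin 3 → R) :
    φ (discr l m) = discr (fun i => φ (l i)) (fun i => φ (m i)) := by
  simp [discr, map_ofNat φ 4]

theorem Fin.three_cases (i j : Fin 3) : j = i ∨ j = i + 1 ∨ j = i + 2 := by
  revert i j; decide

theorem Fin.exists_three {α : Type*} (i : Fin 3) (x y z : α) :
    ∃ a : Fin 3 → α, a i = x ∧ a (i + 1) = y ∧ a (i + 2) = z := by
  fin_cases i
  · exact ⟨![x, y, z], rfl, rfl, rfl⟩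
  · exact ⟨![z, x, y], rfl, rfl, rfl⟩
  · exact ⟨![y, z, x], rfl, rfl, rfl⟩

theorem Fin.add_one_add_two (i : Fin 3) : i + 1 + 2 = i := by revert i; decide
theorem Fin.add_two_add_one (i : Fin 3) : i + 2 + 1 = i := by revert i; decide
theorem Fin.add_two_add_two (i : Fin 3) : i + 2 + 2 = i + 1 := by revert i; decide
theorem Fin.add_one_add_one (i : Fin 3) : i + 1 + 1 = i + 2 := by revert i; decide

end Discr

section Model

variable {k : Type u} [Field k] {τ : Type*}

/-- Coordinates on ternary quadratic forms, together with further free coordinates. -/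
abbrev FormIdx (τ : Type*) := (Fin 3 ⊕ Fin 3) ⊕ τ

/-- The coefficients of the squares. -/
def lam {R : Type*} (z : FormIdx τ → R) (i : Fin 3) : R := z (Sum.inl (Sum.inl i))

/-- The coefficients of the mixed terms. -/
def mu {R : Type*} (z : FormIdx τ → R) (i : Fin 3) : R := z (Sum.inl (Sum.inr i))

/-- A point of the coordinate space from its components. -/
def pt {R : Type*} (l m : Fin 3 → R) (t : τ → R) : FormIdx τ → R := Sum.elim (Sum.elim l m) t

@[simp] theorem lam_pt {R : Type*} (l m : Fin 3 → R) (t : τ → R) (i) : lam (pt l m t) i = l i := rfl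
@[simp] theorem mu_pt {R : Type*} (l m : Fin 3 → R) (t : τ → R) (i) : mu (pt l m t) i = m i := rfl

/-- The product of the linear forms with coefficients `a` and `b`. -/
def prodPt {R : Type*} [CommRing R] (a b : Fin 3 → R) (t : τ → R) : FormIdx τ → R :=
  pt (fun i => a i * b i) (fun i => a (i + 1) * b (i + 2) + a (i + 2) * b (i + 1)) t

theorem lam_prodPt {R : Type*} [CommRing R] (a b : Fin 3 → R) (t : τ → R) (i) :
    lam (prodPt a b t) i = a i * b i := rfl

theorem mu_prodPt {R : Type*} [CommRing R] (a b : Fin 3 → R) (t : τ → R) (i) :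
    mu (prodPt a b t) i = a (i + 1) * b (i + 2) + a (i + 2) * b (i + 1) := rfl

theorem discr_prodPt {R : Type*} [CommRing R] (a b : Fin 3 → R) (t : τ → R) :
    discr (lam (prodPt a b t)) (mu (prodPt a b t)) = 0 := by
  simp only [discr, lam_prodPt, mu_prodPt, Fin.reduceAdd]
  ring

/-- The half-discriminant as a polynomial. -/
noncomputable def discrPoly (k : Type u) [Field k] (τ : Type*) : MvPolynomial (FormIdx τ) k :=
  discr (lam X) (mu X)

theorem aeval_discrPoly {B : Type*} [CommRing B] [Algebra k B] (γ : FormIdx τ → B) :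
    aeval γ (discrPoly k τ) = discr (lam γ) (mu γ) := by
  have := map_discr (aeval γ : MvPolynomial (FormIdx τ) k →ₐ[k] B).toRingHom (lam X) (mu X)
  refine this.trans ?_
  simp [lam, mu]
  rfl

theorem eval_discrPoly (z : FormIdx τ → k) :
    eval z (discrPoly k τ) = discr (lam z) (mu z) := by
  rw [← aeval_discrPoly (k := k), aeval_eq_eval]

/-- The coordinates are those of the square of a linear form. -/
def IsSq (z : FormIdx τ → k) : Prop :=
  ∃ a : Fin 3 → k, ∀ i, lam z i = a i ^ 2 ∧ mu z i = 2 * a (i + 1) * a (i + 2)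

/-- The coordinates are those of the zero form. -/
def IsZeroPt (z : FormIdx τ → k) : Prop := ∀ i, lam z i = 0 ∧ mu z i = 0

/-- The four strata. -/
def stratum (k : Type u) [Field k] (τ : Type*) : Fin 4 → Set (FormIdx τ → k) :=
  ![{z | discr (lam z) (mu z) ≠ 0}, {z | discr (lam z) (mu z) = 0 ∧ ¬ IsSq z},
    {z | IsSq z ∧ ¬ IsZeroPt z}, {z | IsZeroPt z}]

/-- The closures of the four strata. -/
def closedStratum (k : Type u) [Field k] (τ : Type*) : Fin 4 → Set (FormIdx τ → k) :=
  ![Set.univ, {z | discr (lam z) (mu z) = 0}, {z | IsSq z}, {z | IsZeroPt z}]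

theorem IsSq.eq_prodPt {z : FormIdx τ → k} (hz : IsSq z) :
    ∃ a : Fin 3 → k, z = prodPt a a fun t => z (Sum.inr t) := by
  obtain ⟨a, ha⟩ := hz
  refine ⟨a, funext ?_⟩
  rintro ((i | i) | t)
  · exact (ha i).1.trans (by simp only [prodPt, pt, Sum.elim_inl]; ring)
  · exact (ha i).2.trans (by simp only [prodPt, pt, Sum.elim_inl, Sum.elim_inr]; ring)
  · rfl

theorem isSq_prodPt (a : Fin 3 → k) (t : τ → k) : IsSq (prodPt a a t) :=
  ⟨a, fun i => ⟨by rw [lam_prodPt]; ring, by rw [mu_prodPt]; ring⟩⟩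

theorem IsSq.discr_eq_zero {z : FormIdx τ → k} (hz : IsSq z) : discr (lam z) (mu z) = 0 := by
  obtain ⟨a, ha⟩ := hz.eq_prodPt
  rw [ha, discr_prodPt]

theorem IsZeroPt.isSq {z : FormIdx τ → k} (hz : IsZeroPt z) : IsSq z :=
  ⟨0, fun i => ⟨by simp [hz i], by simp [hz i]⟩⟩

theorem IsSq.minors {z : FormIdx τ → k} (hz : IsSq z) (i : Fin 3) :
    mu z i ^ 2 = 4 * lam z (i + 1) * lam z (i + 2) ∧
      mu z (i + 1) * mu z (i + 2) = 2 * lam z i * mu z i := by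
  obtain ⟨a, ha⟩ := hz
  simp only [(ha _).1, (ha _).2, Fin.add_one_add_one, Fin.add_one_add_two, Fin.add_two_add_one,
    Fin.add_two_add_two]
  constructor <;> ring

/-- In characteristic 2 the minors force `mu = 0`, and then square roots of the `lam i` suffice.
Otherwise, if `lam i = r² ≠ 0`, the coefficients of the linear form are `r` and the adjacent `mu`
divided by `2r`; if all `lam i` vanish, so do the `mu i`. -/
theorem isSq_of_minors [IsAlgClosed k] {z : FormIdx τ → k}
    (hz : ∀ i, mu z i ^ 2 = 4 * lam z (i + 1) * lam z (i + 2) ∧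
      mu z (i + 1) * mu z (i + 2) = 2 * lam z i * mu z i) : IsSq z := by
  by_cases h2 : (2 : k) = 0
  · have h4 : (4 : k) = 0 := by linear_combination 2 * h2
    choose a ha using fun i => IsAlgClosed.exists_pow_nat_eq (lam z i) two_pos
    refine ⟨a, fun i => ⟨(ha i).symm, ?_⟩⟩
    have := (hz i).1
    rw [h4, zero_mul, zero_mul] at this
    rw [pow_eq_zero_iff two_ne_zero |>.mp this, h2, zero_mul, zero_mul]
  · by_cases h0 : ∃ i, lam z i ≠ 0
    · obtain ⟨i, hi⟩ := h0
      obtain ⟨r, hr⟩ := IsAlgClosed.exists_pow_nat_eq (lam z i) two_pos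
      have hr0 : r ≠ 0 := by rintro rfl; exact hi (by rw [← hr]; simp)
      obtain ⟨a, ha, ha1, ha2⟩ :=
        Fin.exists_three i r (mu z (i + 2) / (2 * r)) (mu z (i + 1) / (2 * r))
      have e0 := hz i
      have e1 := hz (i + 1)
      have e2 := hz (i + 2)
      simp only [Fin.add_one_add_one, Fin.add_one_add_two, Fin.add_two_add_one,
        Fin.add_two_add_two] at e1 e2
      rw [← hr] at e0 e1 e2
      refine ⟨a, fun j => ?_⟩
      rcases Fin.three_cases i j with rfl | rfl | rfl
      · refine ⟨by rw [ha, hr], ?_⟩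
        rw [ha1, ha2]
        field_simp
        linear_combination -e0.2
      · refine ⟨?_, ?_⟩
        · rw [ha1]
          field_simp
          linear_combination -e2.1
        · rw [Fin.add_one_add_one, Fin.add_one_add_two, ha, ha2]
          field_simp
      · refine ⟨?_, ?_⟩
        · rw [ha2]
          field_simp
          linear_combination -e1.1
        · rw [Fin.add_two_add_one, Fin.add_two_add_two, ha, ha1]
          field_simp
    · push Not at h0
      refine ⟨0, fun i => ⟨by simp [h0], ?_⟩⟩
      have := (hz i).1
      rw [h0, mul_zero, zero_mul] at this
      simpa using this

/-- If all principal minors vanish, so do the mixed ones: by Jacobi's identity for the adjugate, the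
square of a mixed minor is a product of two principal minors minus `4 * lam i` times the
half-discriminant. -/
theorem exists_minor_ne_zero [IsAlgClosed k] {z : FormIdx τ → k}
    (hz : discr (lam z) (mu z) = 0) (hsq : ¬ IsSq z) :
    ∃ i, 4 * lam z (i + 1) * lam z (i + 2) - mu z i ^ 2 ≠ 0 := by
  by_contra! h
  refine hsq (isSq_of_minors fun i => ⟨by linear_combination -h i, ?_⟩)
  have h0 := h i
  have h1 := h (i + 1)
  have h2 := h (i + 2)
  simp only [Fin.add_one_add_one, Fin.add_one_add_two, Fin.add_two_add_one,
    Fin.add_two_add_two] at h1 h2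
  rw [discr_cyclic _ _ i] at hz
  have : (mu z (i + 1) * mu z (i + 2) - 2 * lam z i * mu z i) ^ 2 = 0 := by
    linear_combination (4 * lam z (i + 2) * lam z i - mu z (i + 1) ^ 2) * h2 - 4 * lam z i * hz
  exact sub_eq_zero.mp (pow_eq_zero_iff two_ne_zero |>.mp this)

theorem minor_prodPt (a b : Fin 3 → k) (t : τ → k) (i : Fin 3) :
    4 * lam (prodPt a b t) (i + 1) * lam (prodPt a b t) (i + 2) - mu (prodPt a b t) i ^ 2 =
      - (a (i + 1) * b (i + 2) - a (i + 2) * b (i + 1)) ^ 2 := by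
  simp only [lam_prodPt, mu_prodPt]; ring

/-- The principal minor of a product is minus the square of a 2×2 determinant of its two factors,
and it vanishes for a square. -/
theorem not_isSq_prodPt {a b : Fin 3 → k} (t : τ → k) (i : Fin 3)
    (h : a (i + 1) * b (i + 2) - a (i + 2) * b (i + 1) ≠ 0) : ¬ IsSq (prodPt a b t) := fun hs => by
  have h1 := (hs.minors i).1
  have h2 := minor_prodPt a b t i
  rw [h1, sub_self, eq_comm, neg_eq_zero, pow_eq_zero_iff two_ne_zero] at h2
  exact h h2

theorem discrPoly_ne_zero : discrPoly k τ ≠ 0 := by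
  intro h
  have := eval_discrPoly (pt ![0, 0, 1] ![0, 0, 1] 0 : FormIdx τ → k)
  rw [h, map_zero] at this
  simp [discr] at this

theorem subset_polyClosure (S : Set (FormIdx τ → k)) : S ⊆ polyClosure S :=
  fun z hz _ hf => hf z hz

theorem prodPt_mem_polyClosure [Infinite k] {S : Set (FormIdx τ → k)} (a b p q : Fin 3 → k)
    (t : τ → k) (h : ∀ s : k, s ≠ 0 → prodPt (a + s • p) (b + s • q) t ∈ S) :
    prodPt a b t ∈ polyClosure S := by
  convert mem_polyClosure_of_curve (S := S)
    (prodPt (fun i => Polynomial.C (a i) + Polynomial.X * Polynomial.C (p i))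
      (fun i => Polynomial.C (b i) + Polynomial.X * Polynomial.C (q i))
      fun j => Polynomial.C (t j)) fun s hs => ?_ using 1
  · funext s
    rcases s with (i | i) | j <;> simp [prodPt, pt]
  · convert h s hs using 1
    funext s
    rcases s with (i | i) | j <;> simp [prodPt, pt] <;> ring

theorem polyClosure_stratum [IsAlgClosed k] (i : Fin 4) :
    polyClosure (stratum k τ i) = closedStratum k τ i := by
  have : Infinite k := IsAlgClosed.instInfinite
  match i with
  | 0 =>
    refine Set.eq_univ_of_forall fun z f hf => ?_
    have : f * discrPoly k τ = 0 := by
      refine MvPolynomial.funext_set (fun _ => Set.univ) (fun _ => Set.infinite_univ) ?_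
      intro y _
      rw [map_mul, map_zero]
      by_cases hy : discr (lam y) (mu y) = 0
      · rw [eval_discrPoly, hy, mul_zero]
      · rw [hf y hy, zero_mul]
    rw [(mul_eq_zero.mp this).resolve_right discrPoly_ne_zero, map_zero]
  | 1 =>
    refine Set.Subset.antisymm (fun z hz => ?_) fun z hz => ?_
    · change discr (lam z) (mu z) = 0
      rw [← eval_discrPoly]
      exact hz _ fun y hy => by rw [eval_discrPoly]; exact hy.1
    · by_cases hsq : IsSq z
      swap
      · exact subset_polyClosure _ ⟨hz, hsq⟩
      obtain ⟨a, ha⟩ := hsq.eq_prodPt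
      rw [ha]
      by_cases ha0 : a = 0
      · subst ha0
        -- The zero form is the limit of `(s x₀)(s x₁)`.
        refine prodPt_mem_polyClosure _ _ (Pi.single 0 1) (Pi.single 1 1) _
          fun s hs => ⟨discr_prodPt _ _ _, not_isSq_prodPt _ 2 ?_⟩
        simpa using hs
      · obtain ⟨i, hi⟩ := Function.ne_iff.mp ha0
        -- With `aᵢ ≠ 0`, the square `a²` is the limit of `a (a + s xᵢ₊₁)`, whose factors are
        -- independent for `s ≠ 0`.
        refine prodPt_mem_polyClosure _ _ 0 (Pi.single (i + 1) 1) _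
          fun s hs => ⟨discr_prodPt _ _ _, not_isSq_prodPt _ (i + 2) ?_⟩
        rw [Fin.add_two_add_one, Fin.add_two_add_two]
        have h1 : i ≠ i + 1 := (by decide : ∀ i : Fin 3, i ≠ i + 1) i
        simp only [smul_zero, add_zero, Pi.add_apply, Pi.zero_apply, Pi.smul_apply, Pi.single_eq_same,
          Pi.single_eq_of_ne h1, smul_eq_mul, mul_one, mul_zero]
        rw [mul_add, mul_comm (a (i + 1)) (a i), add_sub_cancel_left]
        exact mul_ne_zero hi hs
  | 2 =>
    refine Set.Subset.antisymm (fun z hz => isSq_of_minors fun i => ⟨?_, ?_⟩) fun z hz => ?_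
    · have := hz (mu X i ^ 2 - C 4 * lam X (i + 1) * lam X (i + 2)) fun y hy => by
        have := (hy.1.minors i).1
        simp only [lam, mu] at this
        simp only [lam, mu, map_sub, map_mul, map_pow, eval_X, eval_C, this, sub_self]
      simp only [lam, mu, map_sub, map_mul, map_pow, eval_X, eval_C] at this
      exact sub_eq_zero.mp this
    · have := hz (mu X (i + 1) * mu X (i + 2) - C 2 * lam X i * mu X i) fun y hy => by
        have := (hy.1.minors i).2
        simp only [lam, mu] at this
        simp only [lam, mu, map_sub, map_mul, eval_X, eval_C, this, sub_self]
      simp only [lam, mu, map_sub, map_mul, eval_X, eval_C] at this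
      exact sub_eq_zero.mp this
    · by_cases h0 : IsZeroPt z
      swap
      · exact subset_polyClosure _ ⟨hz, h0⟩
      have hz0 : z = prodPt 0 0 fun t => z (Sum.inr t) := by
        funext s
        rcases s with (i | i) | j
        · simpa [prodPt, pt, lam] using (h0 i).1
        · simpa [prodPt, pt, mu] using (h0 i).2
        · rfl
      rw [hz0]
      refine prodPt_mem_polyClosure _ _ (Pi.single 0 1) (Pi.single 0 1) _
          fun s hs => ⟨by rw [zero_add]; exact isSq_prodPt _ _, fun h => ?_⟩
      have := (h 0).1
      rw [lam_prodPt] at this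
      simp [hs] at this
  | 3 =>
    refine Set.Subset.antisymm (fun z hz i => ⟨?_, ?_⟩) (subset_polyClosure _)
    · have := hz (lam X i) fun y hy => by
        have := (hy i).1
        simpa [lam] using this
      simpa [lam] using this
    · have := hz (mu X i) fun y hy => by
        have := (hy i).2
        simpa [mu] using this
      simpa [mu] using this

theorem iUnion_stratum : ⋃ i, stratum k τ i = Set.univ := by
  refine Set.eq_univ_of_forall fun z => Set.mem_iUnion.mpr ?_
  by_cases h0 : discr (lam z) (mu z) = 0
  · by_cases h1 : IsSq z
    · by_cases h2 : IsZeroPt z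
      · exact ⟨3, h2⟩
      · exact ⟨2, h1, h2⟩
    · exact ⟨1, h0, h1⟩
  · exact ⟨0, h0⟩

theorem closedStratum_succ (i : Fin 3) :
    closedStratum k τ i.succ = closedStratum k τ i.castSucc \ stratum k τ i.castSucc := by
  ext z
  have h1 : IsZeroPt z → IsSq z := IsZeroPt.isSq
  have h2 : IsSq z → discr (lam z) (mu z) = 0 := IsSq.discr_eq_zero
  match i with
  | 0 => change discr (lam z) (mu z) = 0 ↔ True ∧ ¬ (discr (lam z) (mu z) ≠ 0); tauto
  | 1 =>
    change IsSq z ↔ discr (lam z) (mu z) = 0 ∧ ¬ (discr (lam z) (mu z) = 0 ∧ ¬ IsSq z); tauto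
  | 2 =>
    exact ⟨fun h => ⟨h1 h, fun h' => h'.2 h⟩, fun h => by_contra fun h' => h.2 ⟨h.1, h'⟩⟩

theorem pairwise_disjoint_stratum : Pairwise fun i j => Disjoint (stratum k τ i) (stratum k τ j) := by
  have h1 : ∀ z : FormIdx τ → k, IsZeroPt z → IsSq z := fun _ => IsZeroPt.isSq
  have h2 : ∀ z : FormIdx τ → k, IsSq z → discr (lam z) (mu z) = 0 := fun _ => IsSq.discr_eq_zero
  intro i j hij
  rw [Set.disjoint_left]
  intro z hi hj
  have h1 := h1 z
  have h2 := h2 z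
  fin_cases i <;> fin_cases j <;> simp [stratum] at hi hj hij <;> tauto

variable {M : Type v} [AddCommGroup M] [Module k M] {ψ : M →ₗ[k] (FormIdx τ → k)}
  {Φ : (FormIdx τ → k) → M}

theorem IsPolySection.zariskiClosure_stratum [IsAlgClosed k] (h : IsPolySection ψ Φ) (i : Fin 4) :
    zariskiClosure k (Φ '' stratum k τ i) = Φ '' closedStratum k τ i := by
  rw [h.zariskiClosure_image, polyClosure_stratum]

theorem IsPolySection.isStratification [IsAlgClosed k] (h : IsPolySection ψ Φ) :
    IsStratification k (Set.range Φ) fun i => Φ '' stratum k τ i := by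
  refine ⟨?_, ?_, ?_, ?_⟩
  · rw [← Set.image_iUnion, iUnion_stratum, Set.image_univ]
  · intro i j hij
    exact (Set.disjoint_image_iff h.injective).mpr (pairwise_disjoint_stratum hij)
  · rw [h.zariskiClosure_stratum, ← Set.image_univ]
    rfl
  · intro i
    simp only
    rw [h.zariskiClosure_stratum, h.zariskiClosure_stratum, closedStratum_succ,
      Set.image_sdiff h.injective]

end Model

end TernaryForms

namespace TernaryForms

open MvPolynomial

/-! ### Singular loci of the strata -/

section Sing

variable {k : Type u} [Field k] {τ : Type*}

variable {M : Type v} [AddCommGroup M] [Module k M] {ψ : M →ₗ[k] (FormIdx τ → k)}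
  {Φ : (FormIdx τ → k) → M}

theorem singularLocus_image_eq (Z Z' : Set (FormIdx τ → k))
    (hZ : Z' ⊆ Z)
    (hns : ∀ z (hz : Φ z ∈ Φ '' Z), z ∈ Z' →
      ¬ Algebra.IsSmoothAt k (pointIdeal k (⟨Φ z, hz⟩ : Φ '' Z)))
    (hs : ∀ z (hz : Φ z ∈ Φ '' Z), z ∈ Z → z ∉ Z' →
      Algebra.IsSmoothAt k (pointIdeal k (⟨Φ z, hz⟩ : Φ '' Z))) :
    singularLocus k (Φ '' Z) = Φ '' Z' := by
  ext x
  constructor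
  · rintro ⟨⟨z, hz, rfl⟩, hx⟩
    exact ⟨z, by_contra fun hz' => hx (hs z _ hz hz'), rfl⟩
  · rintro ⟨z, hz, rfl⟩
    exact ⟨⟨z, hZ hz, rfl⟩, hns z _ hz⟩

/-- The polynomial cutting out the chart of the discriminant hypersurface in which the `i`-th
diagonal coefficient is eliminated. -/
theorem isChart_discr (i : Fin 3) : IsChart {z : FormIdx τ → k | discr (lam z) (mu z) = 0}
    {s | s ≠ Sum.inl (Sum.inl i)}
    (C 4 * X ⟨Sum.inl (Sum.inl (i + 1)), by revert i; simp⟩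
      * X ⟨Sum.inl (Sum.inl (i + 2)), by revert i; simp⟩
      - X ⟨Sum.inl (Sum.inr i), by simp⟩ ^ 2) := by
  classical
  refine ⟨fun h => ?_, fun y hy => ?_, fun s => ?_⟩
  · have := congrArg (eval fun s => (pt 0 1 0 : FormIdx τ → k) s.1) h
    simp [pt] at this
  · obtain ⟨w, rfl⟩ : ∃ w : FormIdx τ → k, y = fun s => w s.1 :=
      ⟨fun s => if hs : s = Sum.inl (Sum.inl i) then 0 else y ⟨s, hs⟩,
        funext fun s => by simp only; rw [dif_neg s.2]⟩
    simp only [map_sub, map_mul, map_pow, eval_X, eval_C] at hy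
    -- The half-discriminant is affine in `lam i`, namely `lam i * d - n`, so `n / d` is the unique
    -- solution.
    let n : k := w (Sum.inl (Sum.inl (i + 1))) * w (Sum.inl (Sum.inr (i + 1))) ^ 2
      + w (Sum.inl (Sum.inl (i + 2))) * w (Sum.inl (Sum.inr (i + 2))) ^ 2
      - w (Sum.inl (Sum.inr i)) * w (Sum.inl (Sum.inr (i + 1))) * w (Sum.inl (Sum.inr (i + 2)))
    let d : k := 4 * w (Sum.inl (Sum.inl (i + 1))) * w (Sum.inl (Sum.inl (i + 2)))
      - w (Sum.inl (Sum.inr i)) ^ 2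
    have e : n / d * d = n := div_mul_cancel₀ n hy
    refine ⟨Function.update w (Sum.inl (Sum.inl i)) (n / d), ?_,
      fun s => Function.update_of_ne s.2 _ _⟩
    change discr (lam _) (mu _) = 0
    have d1 : i + 1 ≠ i := (by decide : ∀ i : Fin 3, i + 1 ≠ i) i
    have d2 : i + 2 ≠ i := (by decide : ∀ i : Fin 3, i + 2 ≠ i) i
    rw [discr_cyclic _ _ i]
    simp only [lam, mu, Function.update_self, ne_eq, Sum.inl.injEq, d1, d2, not_false_eq_true,
      reduceCtorEq, Function.update_of_ne]
    generalize n / d = r at e ⊢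
    simp only [n, d] at e
    linear_combination e
  · by_cases hs : s = Sum.inl (Sum.inl i)
    · refine ⟨1, X ⟨Sum.inl (Sum.inl (i + 1)), by revert i; simp⟩
        * X ⟨Sum.inl (Sum.inr (i + 1)), by simp⟩ ^ 2
      + X ⟨Sum.inl (Sum.inl (i + 2)), by revert i; simp⟩
        * X ⟨Sum.inl (Sum.inr (i + 2)), by simp⟩ ^ 2
      - X ⟨Sum.inl (Sum.inr i), by simp⟩ * X ⟨Sum.inl (Sum.inr (i + 1)), by simp⟩
        * X ⟨Sum.inl (Sum.inr (i + 2)), by simp⟩, fun z hz => ?_⟩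
      change discr (lam z) (mu z) = 0 at hz
      rw [discr_cyclic _ _ i] at hz
      simp only [lam, mu] at hz
      simp only [map_sub, map_add, map_mul, map_pow, eval_X, eval_C, hs]
      linear_combination hz
    · exact ⟨0, X ⟨s, hs⟩, fun z _ => by simp⟩

/-- The coordinates which remain in the chart of the cone of squares in which the `i`-th diagonal
coefficient is invertible. -/
def squareChart (τ : Type*) (i : Fin 3) : Set (FormIdx τ) :=
  {s | s = Sum.inl (Sum.inl i) ∨ s = Sum.inl (Sum.inr (i + 1)) ∨ s = Sum.inl (Sum.inr (i + 2)) ∨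
    ∃ t, s = Sum.inr t}

/-- The minors express `lam i` times each omitted coordinate through `mu (i + 1)` and `mu (i + 2)`;
conversely, a square root of `lam i` determines the linear form from these coordinates. -/
theorem isChart_square [IsAlgClosed k] (h2 : (2 : k) ≠ 0) (i : Fin 3) :
    IsChart {z : FormIdx τ → k | IsSq z} (squareChart τ i)
      (X ⟨Sum.inl (Sum.inl i), Or.inl rfl⟩) := by
  refine ⟨X_ne_zero _, fun y hy => ?_, fun s => ?_⟩
  · rw [eval_X] at hy
    obtain ⟨r, hr⟩ := IsAlgClosed.exists_pow_nat_eq (y ⟨Sum.inl (Sum.inl i), Or.inl rfl⟩) two_pos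
    have hr0 : r ≠ 0 := by rintro rfl; exact hy (by rw [← hr]; simp)
    obtain ⟨a, ha, ha1, ha2⟩ := Fin.exists_three i r
      (y ⟨Sum.inl (Sum.inr (i + 2)), Or.inr (Or.inr (Or.inl rfl))⟩ / (2 * r))
      (y ⟨Sum.inl (Sum.inr (i + 1)), Or.inr (Or.inl rfl)⟩ / (2 * r))
    refine ⟨prodPt a a fun t => y ⟨Sum.inr t, Or.inr (Or.inr (Or.inr ⟨t, rfl⟩))⟩,
      isSq_prodPt _ _, ?_⟩
    rintro ⟨s, rfl | rfl | rfl | ⟨t, rfl⟩⟩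
    · rw [← hr]
      change a i * a i = _
      rw [ha, sq]
    · change a (i + 1 + 1) * a (i + 1 + 2) + a (i + 1 + 2) * a (i + 1 + 1) = _
      rw [Fin.add_one_add_one, Fin.add_one_add_two, ha, ha2]
      field_simp
      ring
    · change a (i + 2 + 1) * a (i + 2 + 2) + a (i + 2 + 2) * a (i + 2 + 1) = _
      rw [Fin.add_two_add_one, Fin.add_two_add_two, ha, ha1]
      field_simp
      ring
    · rfl
  · have key : ∀ z : FormIdx τ → k, IsSq z →
        lam z i * lam z (i + 1) = (1 / 2) ^ 2 * mu z (i + 2) ^ 2 ∧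
        lam z i * lam z (i + 2) = (1 / 2) ^ 2 * mu z (i + 1) ^ 2 ∧
        lam z i * mu z i = 1 / 2 * (mu z (i + 1) * mu z (i + 2)) := fun z hz => by
      have e0 := (hz.minors i).2
      have e1 := (hz.minors (i + 1)).1
      have e2 := (hz.minors (i + 2)).1
      simp only [Fin.add_one_add_one, Fin.add_one_add_two, Fin.add_two_add_one,
        Fin.add_two_add_two] at e1 e2
      refine ⟨?_, ?_, ?_⟩ <;> field_simp
      · linear_combination -e2
      · linear_combination -e1
      · linear_combination -e0
    rcases s with (j | j) | t
    · rcases Fin.three_cases i j with rfl | rfl | rfl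
      · exact ⟨0, X ⟨Sum.inl (Sum.inl j), Or.inl rfl⟩, fun z _ => by simp⟩
      · refine ⟨1, C ((1 / 2) ^ 2) *
          X ⟨Sum.inl (Sum.inr (i + 2)), Or.inr (Or.inr (Or.inl rfl))⟩ ^ 2, fun z hz => ?_⟩
        simp only [pow_one, map_mul, map_pow (eval _) (X _), eval_X, eval_C]
        exact (key z hz).1
      · refine ⟨1, C ((1 / 2) ^ 2) *
          X ⟨Sum.inl (Sum.inr (i + 1)), Or.inr (Or.inl rfl)⟩ ^ 2, fun z hz => ?_⟩
        simp only [pow_one, map_mul, map_pow (eval _) (X _), eval_X, eval_C]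
        exact (key z hz).2.1
    · rcases Fin.three_cases i j with rfl | rfl | rfl
      · refine ⟨1, C (1 / 2) * (X ⟨Sum.inl (Sum.inr (j + 1)), Or.inr (Or.inl rfl)⟩ *
          X ⟨Sum.inl (Sum.inr (j + 2)), Or.inr (Or.inr (Or.inl rfl))⟩), fun z hz => ?_⟩
        simp only [pow_one, map_mul, eval_X, eval_C]
        exact (key z hz).2.2
      · exact ⟨0, X ⟨_, Or.inr (Or.inl rfl)⟩, fun z _ => by simp⟩
      · exact ⟨0, X ⟨_, Or.inr (Or.inr (Or.inl rfl))⟩, fun z _ => by simp⟩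
    · exact ⟨0, X ⟨_, Or.inr (Or.inr (Or.inr ⟨t, rfl⟩))⟩, fun z _ => by simp⟩

/-- In characteristic 2 the mixed coefficients of a square vanish, while the diagonal ones are
arbitrary because every element is a square. No denominator is needed. -/
theorem isChart_square_of_two_eq_zero [IsAlgClosed k] (h2 : (2 : k) = 0) :
    IsChart {z : FormIdx τ → k | IsSq z} {s | ∀ i, s ≠ Sum.inl (Sum.inr i)}
      (1 : MvPolynomial _ k) := by
  refine ⟨one_ne_zero, fun y _ => ?_, fun s => ?_⟩
  · choose a ha using fun i => IsAlgClosed.exists_pow_nat_eq (y ⟨Sum.inl (Sum.inl i), by simp⟩)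
      two_pos
    refine ⟨prodPt a a fun t => y ⟨Sum.inr t, by simp⟩, isSq_prodPt _ _, ?_⟩
    rintro ⟨(i | i) | t, hs⟩
    · rw [← ha, sq]; rfl
    · exact absurd rfl (hs i)
    · rfl
  · rcases s with (i | i) | t
    · exact ⟨0, X ⟨Sum.inl (Sum.inl i), by simp⟩, fun z _ => by simp⟩
    · refine ⟨0, 0, fun z hz => ?_⟩
      have := (hz.minors i).1
      rw [show (4 : k) = 2 * 2 by norm_num, h2] at this
      simp only [zero_mul] at this
      simpa [mu] using pow_eq_zero_iff two_ne_zero |>.mp this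
    · exact ⟨0, X ⟨Sum.inr t, by simp⟩, fun z _ => by simp⟩

theorem prodPt_add_right (a b c : Fin 3 → k) (t : τ → k) :
    prodPt a (b + c) t = prodPt a b t + prodPt a c 0 := by
  funext s
  rcases s with (i | i) | j <;> simp [prodPt, pt] <;> ring

variable [Fintype τ]

/-- The forms `a² + s m²` are degenerate, which gives the direction `m²`. The line `a (a + s n)` and
the curve `(a + s m)(a + s (n - m))` have the same velocity `a n`, and the acceleration of the
latter yields the direction `m (n - m)`. Adding `m²` gives `m n`. -/
theorem gradAt_eq_zero_of_discr [Infinite k] {f : MvPolynomial (FormIdx τ) k}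
    (hf : ∀ z : FormIdx τ → k, discr (lam z) (mu z) = 0 → eval z f = 0) (a : Fin 3 → k)
    (t : τ → k) (m n : Fin 3 → k) : gradAt f (prodPt a a t) (prodPt m n 0) = 0 := by
  have hm : ∀ m, gradAt f (prodPt a a t) (prodPt m m 0) = 0 := fun m =>
    (gradAt_eq_zero_of_curve hf fun s => by
      change discr (lam _) (mu _) = 0
      simp only [discr, lam, mu, prodPt, pt, Pi.add_apply, Pi.smul_apply, Sum.elim_inl,
        Sum.elim_inr, smul_eq_mul, Fin.reduceAdd]
      ring).1
  have hmn : gradAt f (prodPt a a t) (prodPt m (n - m) 0) = 0 := by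
    refine (gradAt_eq_zero_of_curve hf (v := prodPt a n 0) fun s => ?_).2 _ fun s => ?_
    · refine Eq.trans ?_ (discr_prodPt a (a + s • n) t)
      congr 2 <;> funext s <;> rcases s with (i | i) | j <;> simp [prodPt, pt] <;> ring
    · refine Eq.trans ?_ (discr_prodPt (a + s • m) (a + s • (n - m)) t)
      congr 2 <;> funext s <;> rcases s with (i | i) | j <;> simp [prodPt, pt] <;> ring
  rw [show n = (n - m) + m by rw [sub_add_cancel], prodPt_add_right, map_add, hm, hmn, add_zero]

-- At a square all differentials kill products of linear forms, but the half-discriminant obstructs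
-- some jet: for `a = 0` the direction `x₂² + x₀x₁`, through its cubic term; for `aᵢ ≠ 0` the
-- direction `xᵢ₊₁ xᵢ₊₂`, through the quadratic term `-aᵢ²`.
open PowerSeries in
theorem not_isSmoothAt_discr [IsAlgClosed k] (h : IsPolySection ψ Φ) {z : FormIdx τ → k}
    (hz : Φ z ∈ Φ '' {z | discr (lam z) (mu z) = 0}) (hsq : IsSq z) :
    ¬ Algebra.IsSmoothAt k
      (pointIdeal k (⟨Φ z, hz⟩ : Φ '' {z : FormIdx τ → k | discr (lam z) (mu z) = 0})) := by
  have : Infinite k := IsAlgClosed.instInfinite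
  obtain ⟨a, ha⟩ := hsq.eq_prodPt
  by_cases ha0 : a = 0
  · refine not_isSmoothAt_of_gradAt h hz (pt ![0, 0, 1] ![0, 0, 1] 0) (fun f hf => ?_)
      (discrPoly k τ) (fun y hy => by rwa [eval_discrPoly]) (N := 4) (by norm_num) fun u hu => ?_
    · rw [show pt ![0, 0, 1] ![0, 0, 1] 0 = prodPt (Pi.single 2 1) (Pi.single 2 1) 0
        + (prodPt (Pi.single 0 1) (Pi.single 1 1) 0 : FormIdx τ → k) from ?_, ha, map_add,
        gradAt_eq_zero_of_discr hf, gradAt_eq_zero_of_discr hf, add_zero]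
      funext s
      rcases s with (i | i) | j
      · fin_cases i <;> simp [prodPt, pt]
      · fin_cases i <;> simp [prodPt, pt]
      · simp [prodPt, pt]
    · rw [aeval_discrPoly] at hu
      have hz0 : ∀ s : Fin 3 ⊕ Fin 3, z (Sum.inl s) = 0 := by
        rw [ha, ha0]
        rintro (i | i) <;> simp [prodPt, pt]
      -- Homogeneity of degree 3 extracts `X ^ 3`; the remaining factor has constant term `-1`.
      have key : ∀ l m l' m' : Fin 3 → k⟦X⟧, discr (fun i => (0 : k⟦X⟧) + PowerSeries.X * l i
          + PowerSeries.X ^ 2 * l' i) (fun i => 0 + PowerSeries.X * m i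
          + PowerSeries.X ^ 2 * m' i) = PowerSeries.X ^ 3 *
            discr (fun i => l i + PowerSeries.X * l' i) (fun i => m i + PowerSeries.X * m' i) := by
        intro l m l' m'
        simp only [discr]
        ring
      unfold lam mu at hu
      simp only [hz0, map_zero] at hu
      rw [key, pow_succ PowerSeries.X 3] at hu
      have h1 := (mul_dvd_mul_iff_left (pow_ne_zero 3 PowerSeries.X_ne_zero)).mp hu
      rw [PowerSeries.X_dvd_iff, map_discr] at h1
      simp [pt, discr] at h1
  · obtain ⟨i, hi⟩ := Function.ne_iff.mp ha0
    refine not_isSmoothAt_of_gradAt h hz (prodPt (Pi.single (i + 1) 1) (Pi.single (i + 2) 1) 0)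
      (fun f hf => by rw [ha, gradAt_eq_zero_of_discr hf])
      (discrPoly k τ) (fun y hy => by rwa [eval_discrPoly]) (N := 3) (by norm_num) fun u hu => ?_
    rw [aeval_discrPoly, discr_cyclic _ _ i] at hu
    have d1 : i + 1 ≠ i := (by decide : ∀ i : Fin 3, i + 1 ≠ i) i
    have d2 : i + 2 ≠ i := (by decide : ∀ i : Fin 3, i + 2 ≠ i) i
    have d3 : i + 1 ≠ i + 2 := (by decide : ∀ i : Fin 3, i + 1 ≠ i + 2) i
    rw [ha] at hu
    simp only [lam, mu, prodPt, pt, Sum.elim_inl, Sum.elim_inr, Fin.add_one_add_one,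
      Fin.add_one_add_two, Fin.add_two_add_one, Fin.add_two_add_two, Pi.single_eq_same,
      Pi.single_eq_of_ne d3,
      Pi.single_eq_of_ne d1.symm, Pi.single_eq_of_ne d2.symm, Pi.single_eq_of_ne d3.symm,
      mul_zero, mul_one, map_one, map_zero, add_zero, map_mul, map_add] at hu
    -- Here `A`, `B`, `C` are `aᵢ`, `aᵢ₊₁`, `aᵢ₊₂`: modulo `X ^ 3` only `-aᵢ² X ^ 2` survives,
    -- whatever the higher terms of the jet.
    have key : ∀ A B C X u v t w x y : k⟦X⟧,
        4 * (A * A + X ^ 2 * u) * (B * B + X ^ 2 * v) * (C * C + X ^ 2 * t)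
        + (B * C + C * B + X + X ^ 2 * w) * (C * A + A * C + X ^ 2 * x)
          * (A * B + B * A + X ^ 2 * y)
        - ((A * A + X ^ 2 * u) * (B * C + C * B + X + X ^ 2 * w) ^ 2
          + (B * B + X ^ 2 * v) * (C * A + A * C + X ^ 2 * x) ^ 2
          + (C * C + X ^ 2 * t) * (A * B + B * A + X ^ 2 * y) ^ 2) =
        X ^ 2 * -(A * A) + X ^ 3 * (4 * A^2 * X * v * t + 4 * B^2 * X * u * t + 4 * C^2 * X * u * v
          + 4 * X^3 * u * v * t + 2 * B * C * X * x * y + 2 * A * C * y + 2 * A * B * x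
          + 1 * X^2 * x * y + 2 * A * C * X * w * y + 2 * A * B * X * w * x + 1 * X^3 * w * x * y
          - 2 * A^2 * w - 1 * A^2 * X * w^2 - 4 * B * C * u - 4 * B * C * X * u * w - 1 * X * u
          - 2 * X^2 * u * w - 1 * X^3 * u * w^2 - 1 * B^2 * X * x^2 - 4 * A * C * X * v * x
          - 1 * X^3 * v * x^2 - 1 * C^2 * X * y^2 - 4 * A * B * X * t * y - 1 * X^3 * t * y^2) := by
      intros; ring
    rw [key, dvd_add_left (dvd_mul_right _ _), pow_succ PowerSeries.X 2] at hu
    have h1 := (mul_dvd_mul_iff_left (pow_ne_zero 2 PowerSeries.X_ne_zero)).mp hu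
    rw [PowerSeries.X_dvd_iff] at h1
    simp at h1
    exact hi h1

-- Differentials at the vertex kill every `m²`, since the line `s m² = (√s m)²` consists of squares.
-- By polarisation and `2 ≠ 0` they kill `x₀x₁`, which is the direction of a jet on which the minor
-- `mu₂² - 4 lam₀ lam₁` has leading term `X ^ 2`.
open PowerSeries in
theorem not_isSmoothAt_square [IsAlgClosed k] (h2 : (2 : k) ≠ 0) (h : IsPolySection ψ Φ)
    {z : FormIdx τ → k} (hz : Φ z ∈ Φ '' {z | IsSq z}) (h0 : IsZeroPt z) :
    ¬ Algebra.IsSmoothAt k (pointIdeal k (⟨Φ z, hz⟩ : Φ '' {z : FormIdx τ → k | IsSq z})) := by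
  have : Infinite k := IsAlgClosed.instInfinite
  obtain ⟨a, ha⟩ := h0.isSq.eq_prodPt
  have hz0 : ∀ s : Fin 3 ⊕ Fin 3, z (Sum.inl s) = 0 := by
    rintro (i | i)
    · exact (h0 i).1
    · exact (h0 i).2
  have hsq : ∀ f : MvPolynomial (FormIdx τ) k, (∀ y : FormIdx τ → k, IsSq y → eval y f = 0) →
      ∀ m : Fin 3 → k, gradAt f z (prodPt m m 0) = 0 := fun f hf m =>
    (gradAt_eq_zero_of_curve (Z := {y | IsSq y}) hf fun s => by
      obtain ⟨r, hr⟩ := IsAlgClosed.exists_pow_nat_eq s two_pos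
      have : z + s • prodPt m m 0 = prodPt (r • m) (r • m) fun t => z (Sum.inr t) := by
        funext j
        rcases j with (i | i) | j
        · simp [prodPt, pt, hz0, ← hr]; ring
        · simp [prodPt, pt, hz0, ← hr]; ring
        · simp [prodPt, pt]
      rw [this]
      exact isSq_prodPt _ _).1
  refine not_isSmoothAt_of_gradAt h hz (prodPt (Pi.single 0 1) (Pi.single 1 1) 0) (fun f hf => ?_)
    (mu X 2 ^ 2 - MvPolynomial.C 4 * lam X 0 * lam X 1) (fun y hy => ?_) (N := 3) (by norm_num) fun u hu => ?_
  · have e : (2 : k) • (prodPt (Pi.single 0 1) (Pi.single 1 1) 0 : FormIdx τ → k) =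
        prodPt (Pi.single 0 1 + Pi.single 1 1) (Pi.single 0 1 + Pi.single 1 1) 0
        - prodPt (Pi.single 0 1) (Pi.single 0 1) 0 - prodPt (Pi.single 1 1) (Pi.single 1 1) 0 := by
      funext s
      rcases s with (i | i) | j
      · fin_cases i <;> simp [prodPt, pt]
      · fin_cases i <;> simp [prodPt, pt] <;> norm_num
      · simp [prodPt, pt]
    have := congrArg (gradAt f z) e
    rw [map_sub, map_sub, hsq f hf, hsq f hf, hsq f hf, map_smul, sub_zero, sub_zero,
      smul_eq_zero] at this
    exact this.resolve_left h2
  · have := (IsSq.minors hy 2).1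
    simp only [lam, mu, Fin.reduceAdd] at this
    simp [lam, mu, this]
  · have key : ∀ w l l' : k⟦X⟧, (PowerSeries.X + PowerSeries.X ^ 2 * w) ^ 2
        - PowerSeries.C 4 * (PowerSeries.X ^ 2 * l) * (PowerSeries.X ^ 2 * l') =
        PowerSeries.X ^ 2 + PowerSeries.X ^ 3 * (2 * w + PowerSeries.X * w ^ 2
          - PowerSeries.C 4 * PowerSeries.X * l * l') := by
      intros; ring
    have hC : algebraMap k k⟦X⟧ 4 = PowerSeries.C 4 := rfl
    simp only [map_sub, map_mul, map_pow, aeval_X, algHom_C, lam, mu, hz0, prodPt, pt,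
      Sum.elim_inl, Sum.elim_inr, hC] at hu
    simp at hu
    rw [key, dvd_add_left (dvd_mul_right _ _), pow_succ PowerSeries.X 2] at hu
    have h1 := (mul_dvd_mul_iff_left (b := PowerSeries.X) (c := (1 : k⟦X⟧))
      (pow_ne_zero 2 PowerSeries.X_ne_zero)).mp (by rwa [mul_one])
    rw [PowerSeries.X_dvd_iff] at h1
    simp at h1

theorem IsPolySection.hasStatedSingularLoci [IsAlgClosed k] (h : IsPolySection ψ Φ) :
    HasStatedSingularLoci k fun i => Φ '' stratum k τ i := by
  have : Infinite k := IsAlgClosed.instInfinite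
  have e1 := closedStratum_succ (k := k) (τ := τ) 1
  have e2 := closedStratum_succ (k := k) (τ := τ) 2
  refine ⟨?_, fun h2 => ?_, fun h2 => ?_⟩
  · simp only [h.zariskiClosure_stratum]
    rw [← Set.image_sdiff h.injective]
    refine (singularLocus_image_eq (closedStratum k τ 1) _ Set.sdiff_subset ?_ ?_)
    · intro z hz hz'
      refine not_isSmoothAt_discr h hz ?_
      have : z ∈ closedStratum k τ 2 := by rw [← Fin.succ_one_eq_two, e1]; exact hz'
      exact this
    · intro z hz hz1 hz2
      have hz2 : z ∈ stratum k τ 1 := by_contra fun h' => hz2 ⟨hz1, h'⟩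
      obtain ⟨i, hi⟩ := exists_minor_ne_zero hz2.1 hz2.2
      refine (isChart_discr i).isSmoothAt h z hz ?_
      simpa using! hi
  · have h2 : (2 : k) ≠ 0 := fun h0 => h2 (CharTwo.of_one_ne_zero_of_two_eq_zero one_ne_zero h0)
    simp only [h.zariskiClosure_stratum]
    rw [← Set.image_sdiff h.injective]
    refine (singularLocus_image_eq (closedStratum k τ 2) _ Set.sdiff_subset ?_ ?_)
    · intro z hz hz'
      refine not_isSmoothAt_square h2 h hz ?_
      have : z ∈ closedStratum k τ 3 := by rw [← show Fin.succ 2 = (3 : Fin 4) from rfl, e2]; exact hz'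
      exact this
    · intro z hz hz1 hz2
      have hz2 : z ∈ stratum k τ 2 := by_contra fun h' => hz2 ⟨hz1, h'⟩
      obtain ⟨⟨a, ha⟩, hz0⟩ := hz2
      obtain ⟨i, hi⟩ : ∃ i, a i ≠ 0 := by
        by_contra! h0
        exact hz0 fun i => ⟨by simp [ha, h0], by simp [ha, h0]⟩
      refine (isChart_square h2 i).isSmoothAt h z hz ?_
      rw [eval_X]
      have := (ha i).1
      rw [lam] at this
      rw [this]
      exact pow_ne_zero 2 hi
  · simp only
    rw [h.zariskiClosure_stratum]
    exact (isChart_square_of_two_eq_zero CharTwo.two_eq_zero).smooth h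

end Sing

end TernaryForms

namespace TernaryForms

open Module

/-! ### Classification of ternary quadratic forms over quadratically closed fields -/

section Classification

variable {k : Type u} [Field k] {V : Type v} [AddCommGroup V] [Module k V]

theorem polar_stdSum (q : QuadraticForm k V) (x y : V) (a b : k) :
    q (a • x + b • y) = a ^ 2 * q x + b ^ 2 * q y + a * b * QuadraticMap.polar q x y := by
  rw [QuadraticMap.map_add q, q.map_smul, q.map_smul, QuadraticMap.polar_smul_left,
    QuadraticMap.polar_smul_right]
  simp only [smul_eq_mul]
  ring

theorem quadraticForm_ext_basis (e : Basis (Fin 3) k V) {q q' : QuadraticForm k V}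
    (h0 : q (e 0) = q' (e 0)) (h1 : q (e 1) = q' (e 1)) (h2 : q (e 2) = q' (e 2))
    (h01 : QuadraticMap.polar q (e 0) (e 1) = QuadraticMap.polar q' (e 0) (e 1))
    (h02 : QuadraticMap.polar q (e 0) (e 2) = QuadraticMap.polar q' (e 0) (e 2))
    (h12 : QuadraticMap.polar q (e 1) (e 2) = QuadraticMap.polar q' (e 1) (e 2)) : q = q' := by
  rw [← bilOf_toQuadraticMap e q, ← bilOf_toQuadraticMap e q', bilOf, bilOf, h0, h1, h2, h01, h02,
    h12]

theorem stdForm_zero_apply (b : Basis (Fin 3) k V) (x : V) :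
    stdForm b 0 x = b.repr x 0 * b.repr x 1 + b.repr x 2 ^ 2 := by
  simp [stdForm, sq]

theorem stdForm_one_apply (b : Basis (Fin 3) k V) (x : V) :
    stdForm b 1 x = b.repr x 0 * b.repr x 1 := by
  simp [stdForm]

theorem stdForm_two_apply (b : Basis (Fin 3) k V) (x : V) :
    stdForm b 2 x = b.repr x 2 ^ 2 := by
  simp [stdForm, sq]

theorem stdForm_three (b : Basis (Fin 3) k V) : stdForm b 3 = 0 := rfl

theorem exists_basis_coe_eq (hV : finrank k V = 3) {x y z : V}
    (h : ∀ a b c : k, a • x + b • y + c • z = 0 → a = 0 ∧ b = 0 ∧ c = 0) :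
    ∃ b : Basis (Fin 3) k V, b 0 = x ∧ b 1 = y ∧ b 2 = z := by
  have hli : LinearIndependent k ![x, y, z] := by
    rw [Fintype.linearIndependent_iff]
    intro g hg
    rw [Fin.sum_univ_three] at hg
    obtain ⟨h0, h1, h2⟩ := h _ _ _ hg
    intro i
    fin_cases i
    exacts [h0, h1, h2]
  refine ⟨basisOfLinearIndependentOfCardEqFinrank hli (by simp [hV]), ?_⟩
  simp

theorem exists_basis_of_hyperbolic_pair (hV : finrank k V = 3) (q : QuadraticForm k V) {x y z : V}
    (hx : q x = 0) (hy : q y = 0) (hxy : QuadraticMap.polar q x y = 1)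
    (hzx : QuadraticMap.polar q z x = 0) (hzy : QuadraticMap.polar q z y = 0) (hz : z ≠ 0) :
    ∃ b : Basis (Fin 3) k V, b 0 = x ∧ b 1 = y ∧ b 2 = z := by
  refine exists_basis_coe_eq hV fun a b c habc => ?_
  have hxx : QuadraticMap.polar q x x = 0 := by rw [QuadraticMap.polar_self, hx, smul_zero]
  have hyy : QuadraticMap.polar q y y = 0 := by rw [QuadraticMap.polar_self, hy, smul_zero]
  have h1 := congrArg (fun w => QuadraticMap.polar q w x) habc
  have h2 := congrArg (fun w => QuadraticMap.polar q w y) habc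
  simp only [QuadraticMap.polar_add_left, QuadraticMap.polar_smul_left, hxx, hyy, hxy, hzx, hzy,
    QuadraticMap.polar_comm q y x, QuadraticMap.polar_zero_left, smul_eq_mul, mul_zero, mul_one,
    zero_add, add_zero] at h1 h2
  subst h1 h2
  simp only [zero_smul, zero_add, smul_eq_zero, hz, or_false] at habc
  exact ⟨rfl, rfl, habc⟩

theorem IsQuadraticallyClosed.exists_sq (hk : IsQuadraticallyClosed k) (c : k) :
    ∃ r, r ^ 2 = c := by
  obtain ⟨r, hr⟩ := hk 0 (-c)
  exact ⟨r, by linear_combination hr⟩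

/-- If `q x ≠ 0`, a root `r` of `q (r x + y)` gives an isotropic vector, and the square of its polar
value with `x` is the discriminant of the binary form. -/
theorem exists_isotropic_polar_ne_zero (hk : IsQuadraticallyClosed k) (q : QuadraticForm k V)
    {x y : V} (h : QuadraticMap.polar q x y ^ 2 - 4 * q x * q y ≠ 0) :
    ∃ x' y', q x' = 0 ∧ QuadraticMap.polar q x' y' ≠ 0 := by
  by_cases hx : q x = 0
  · refine ⟨x, y, hx, fun h0 => h ?_⟩
    rw [h0, hx]; ring
  · obtain ⟨r, hr⟩ := hk (QuadraticMap.polar q x y / q x) (q y / q x)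
    field_simp at hr
    refine ⟨r • x + (1 : k) • y, x, ?_, fun h0 => h ?_⟩
    · rw [polar_stdSum]
      linear_combination hr
    · rw [QuadraticMap.polar_add_left, QuadraticMap.polar_smul_left, QuadraticMap.polar_self,
        one_smul, QuadraticMap.polar_comm q y x, smul_eq_mul, two_nsmul] at h0
      linear_combination (2 * r * q x + QuadraticMap.polar q x y) * h0 - 4 * q x * hr

theorem exists_hyperbolic_pair (q : QuadraticForm k V) {x y : V} (hx : q x = 0)
    (hxy : QuadraticMap.polar q x y ≠ 0) :
    ∃ y', q y' = 0 ∧ QuadraticMap.polar q x y' = 1 := by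
  set c := QuadraticMap.polar q x y
  refine ⟨c⁻¹ • y + (-(c⁻¹ ^ 2 * q y)) • x, ?_, ?_⟩
  · rw [polar_stdSum, hx, QuadraticMap.polar_comm q y x]
    change _ + _ + _ * c = 0
    field_simp
    ring
  · rw [QuadraticMap.polar_add_right, QuadraticMap.polar_smul_right, QuadraticMap.polar_smul_right,
      QuadraticMap.polar_self, hx, smul_zero, smul_zero, add_zero, smul_eq_mul]
    exact inv_mul_cancel₀ hxy

theorem exists_orthogonal_ne_zero (hV : finrank k V = 3) (q : QuadraticForm k V) {x y : V}
    (hx : q x = 0) (hy : q y = 0) (hxy : QuadraticMap.polar q x y = 1) :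
    ∃ z, z ≠ 0 ∧ QuadraticMap.polar q z x = 0 ∧ QuadraticMap.polar q z y = 0 := by
  have : ∃ v, v ∉ Submodule.span k (Set.range ![x, y]) := by
    by_contra! h
    have h1 : Submodule.span k (Set.range ![x, y]) = ⊤ := eq_top_iff.mpr fun v _ => h v
    have h2 := finrank_range_le_card (R := k) ![x, y]
    rw [Set.finrank, h1, finrank_top, hV] at h2
    simp at h2
  obtain ⟨v, hv⟩ := this
  have hxx : QuadraticMap.polar q x x = 0 := by rw [QuadraticMap.polar_self, hx, smul_zero]
  have hyy : QuadraticMap.polar q y y = 0 := by rw [QuadraticMap.polar_self, hy, smul_zero]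
  -- The projection of `v` away from the hyperbolic plane; it is nonzero because `v` lies outside
  -- that plane.
  refine ⟨v - QuadraticMap.polar q v y • x - QuadraticMap.polar q v x • y, fun h0 => hv ?_, ?_, ?_⟩
  · rw [sub_sub, sub_eq_zero] at h0
    rw [h0]
    exact add_mem (Submodule.smul_mem _ _ (Submodule.subset_span ⟨0, rfl⟩))
      (Submodule.smul_mem _ _ (Submodule.subset_span ⟨1, rfl⟩))
  · simp only [QuadraticMap.polar_sub_left, QuadraticMap.polar_smul_left, hxx,
      QuadraticMap.polar_comm q y x, hxy, smul_eq_mul]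
    ring
  · simp only [QuadraticMap.polar_sub_left, QuadraticMap.polar_smul_left, hyy, hxy, smul_eq_mul]
    ring

theorem polar_stdForm (b : Basis (Fin 3) k V) (i : Fin 4) (s t : Fin 3) :
    QuadraticMap.polar (stdForm b i) (b s) (b t) =
      stdForm b i (b s + b t) - stdForm b i (b s) - stdForm b i (b t) := rfl

theorem eq_stdForm_zero {b : Basis (Fin 3) k V} {q : QuadraticForm k V} (h0 : q (b 0) = 0)
    (h1 : q (b 1) = 0) (h2 : q (b 2) = 1) (h01 : QuadraticMap.polar q (b 0) (b 1) = 1)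
    (h20 : QuadraticMap.polar q (b 2) (b 0) = 0) (h21 : QuadraticMap.polar q (b 2) (b 1) = 0) :
    q = stdForm b 0 := by
  rw [QuadraticMap.polar_comm] at h20 h21
  refine quadraticForm_ext_basis b ?_ ?_ ?_ ?_ ?_ ?_ <;>
    simp [polar_stdForm, stdForm_zero_apply, *]

theorem eq_stdForm_one {b : Basis (Fin 3) k V} {q : QuadraticForm k V} (h0 : q (b 0) = 0)
    (h1 : q (b 1) = 0) (h2 : q (b 2) = 0) (h01 : QuadraticMap.polar q (b 0) (b 1) = 1)
    (h20 : QuadraticMap.polar q (b 2) (b 0) = 0) (h21 : QuadraticMap.polar q (b 2) (b 1) = 0) :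
    q = stdForm b 1 := by
  rw [QuadraticMap.polar_comm] at h20 h21
  refine quadraticForm_ext_basis b ?_ ?_ ?_ ?_ ?_ ?_ <;>
    simp [polar_stdForm, stdForm_one_apply, *]

theorem exists_eq_stdForm_of_sq (hV : finrank k V = 3) (q : QuadraticForm k V) (f : Dual k V)
    (hf : ∀ x, q x = f x ^ 2) : ∃ (b : Basis (Fin 3) k V) (i : Fin 4), q = stdForm b i := by
  have hfin : Module.Finite k V := Module.finite_of_finrank_pos (by omega)
  by_cases hf0 : f = 0
  · refine ⟨finBasisOfFinrankEq k V hV, 3, ?_⟩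
    rw [stdForm_three]
    ext x
    simp [hf, hf0]
  · obtain ⟨z', hz'⟩ : ∃ z, f z ≠ 0 := by
      by_contra! h
      exact hf0 (LinearMap.ext h)
    obtain ⟨z, hz⟩ : ∃ z, f z = 1 := ⟨(f z')⁻¹ • z', by simp [hz']⟩
    have hker : finrank k (LinearMap.ker f) = 2 := by
      have h1 := LinearMap.finrank_range_add_finrank_ker f
      have h2 : LinearMap.range f = ⊤ := LinearMap.range_eq_top.mpr
        fun c => ⟨c • z, by simp [hz]⟩
      rw [h2, finrank_top, finrank_self, hV] at h1
      omega
    let κ := finBasisOfFinrankEq k (LinearMap.ker f) hker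
    have hκ : ∀ i, f (κ i : V) = 0 := fun i => (κ i).2
    obtain ⟨b, h0, h1, h2⟩ := exists_basis_coe_eq hV (x := (κ 0 : V)) (y := κ 1) (z := z)
      fun a b c habc => by
        have hc : c = 0 := by simpa [hκ, hz] using congrArg f habc
        subst hc
        have h1 : a • κ 0 + b • κ 1 = 0 := Subtype.ext (by simpa using habc)
        have h2 := Fintype.linearIndependent_iff.mp κ.linearIndependent ![a, b]
          (by simpa [Fin.sum_univ_two] using h1)
        exact ⟨h2 0, h2 1, rfl⟩
    refine ⟨b, 2, ?_⟩
    have hb : f = b.coord 2 := b.ext fun i => by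
      fin_cases i
      · simp
        rw [h0, hκ]
      · simp
        rw [h1, hκ]
      · simp
        rw [h2, hz]
    ext x
    rw [hf, hb, stdForm_two_apply]
    rfl

/-- In characteristic 2 the polar form vanishes, so `q` is additive and square roots of its diagonal
coefficients give the linear form. Otherwise pick `q x = r² ≠ 0`: the linear form is `polar q x`
divided by `2r`. -/
theorem exists_sq_of_polar_sq (hk : IsQuadraticallyClosed k) (e : Basis (Fin 3) k V)
    (q : QuadraticForm k V) (h : ∀ x y, QuadraticMap.polar q x y ^ 2 = 4 * q x * q y) :
    ∃ f : Dual k V, ∀ x, q x = f x ^ 2 := by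
  by_cases h2 : (2 : k) = 0
  · have hp : ∀ x y, QuadraticMap.polar q x y = 0 := fun x y => by
      have := h x y
      rw [show (4 : k) = 2 * 2 by norm_num, h2, zero_mul, zero_mul, zero_mul] at this
      exact pow_eq_zero_iff two_ne_zero |>.mp this
    have hadd : ∀ x y, q (x + y) = q x + q y := fun x y => by
      rw [QuadraticMap.map_add q, hp, add_zero]
    choose r hr using fun i => hk.exists_sq (q (e i))
    refine ⟨∑ i, r i • e.coord i, fun x => ?_⟩
    conv_lhs => rw [← e.sum_repr x, Fin.sum_univ_three, hadd, hadd, q.map_smul, q.map_smul,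
      q.map_smul, ← hr, ← hr, ← hr]
    simp only [Fin.sum_univ_three, LinearMap.add_apply, LinearMap.smul_apply, Basis.coord_apply,
      smul_eq_mul]
    linear_combination (-(r 0 * e.repr x 0 * (r 1 * e.repr x 1)) - r 0 * e.repr x 0 *
      (r 2 * e.repr x 2) - r 1 * e.repr x 1 * (r 2 * e.repr x 2)) * h2
  · by_cases hq : ∃ x, q x ≠ 0
    · obtain ⟨x, hx⟩ := hq
      obtain ⟨r, hr⟩ := hk.exists_sq (q x)
      have hr0 : r ≠ 0 := by rintro rfl; exact hx (by rw [← hr]; simp)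
      refine ⟨(2 * r)⁻¹ • QuadraticMap.polarBilin q x, fun y => ?_⟩
      have := h x y
      rw [← hr] at this
      simp only [LinearMap.smul_apply, QuadraticMap.polarBilin_apply_apply, smul_eq_mul]
      field_simp
      linear_combination -this
    · push Not at hq
      exact ⟨0, fun x => by simp [hq]⟩

/-- Over a quadratically closed field every ternary form is one of the four standard forms in
suitable coordinates. -/
theorem exists_eq_stdForm (hk : IsQuadraticallyClosed k) (e : Basis (Fin 3) k V)
    (q : QuadraticForm k V) : ∃ (b : Basis (Fin 3) k V) (i : Fin 4), q = stdForm b i := by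
  have hV : finrank k V = 3 := by simp [finrank_eq_card_basis e]
  by_cases h : ∃ x y, QuadraticMap.polar q x y ^ 2 - 4 * q x * q y ≠ 0
  · obtain ⟨x₀, y₀, h⟩ := h
    obtain ⟨x, y₁, hx, hxy₁⟩ := exists_isotropic_polar_ne_zero hk q h
    obtain ⟨y, hy, hxy⟩ := exists_hyperbolic_pair q hx hxy₁
    obtain ⟨z, hz, hzx, hzy⟩ := exists_orthogonal_ne_zero hV q hx hy hxy
    by_cases hqz : q z = 0
    · obtain ⟨b, rfl, rfl, rfl⟩ := exists_basis_of_hyperbolic_pair hV q hx hy hxy hzx hzy hz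
      exact ⟨b, 1, eq_stdForm_one hx hy hqz hxy hzx hzy⟩
    · obtain ⟨r, hr⟩ := hk.exists_sq (q z)
      have hr0 : r ≠ 0 := by rintro rfl; exact hqz (by rw [← hr]; simp)
      have hzx' : QuadraticMap.polar q (r⁻¹ • z) x = 0 := by
        rw [QuadraticMap.polar_smul_left, hzx, smul_zero]
      have hzy' : QuadraticMap.polar q (r⁻¹ • z) y = 0 := by
        rw [QuadraticMap.polar_smul_left, hzy, smul_zero]
      have hqz' : q (r⁻¹ • z) = 1 := by
        rw [q.map_smul, ← hr, smul_eq_mul]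
        field_simp
      obtain ⟨b, rfl, rfl, hb⟩ := exists_basis_of_hyperbolic_pair hV q hx hy hxy hzx' hzy'
        (smul_ne_zero (inv_ne_zero hr0) hz)
      rw [← hb] at hzx' hzy' hqz'
      exact ⟨b, 0, eq_stdForm_zero hx hy hqz' hxy hzx' hzy'⟩
  · push Not at h
    obtain ⟨f, hf⟩ := exists_sq_of_polar_sq hk e q fun x y => sub_eq_zero.mp (h x y)
    exact exists_eq_stdForm_of_sq hV q f hf

theorem halfDiscriminant_linMulLin (e : Basis (Fin 3) k V) (f g : Dual k V) :
    halfDiscriminant e (QuadraticMap.linMulLin f g) = 0 := by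
  simp only [halfDiscriminant, QuadraticMap.polar, QuadraticMap.linMulLin_apply, map_add]
  ring

/-- This replaces a general transformation law under change of basis: applied to the coordinate
forms of `b`, it shows that the standard semiregular form has nonzero half-discriminant in every
basis. -/
theorem halfDiscriminant_linMulLin_add (e : Basis (Fin 3) k V) (f g h : Dual k V) :
    halfDiscriminant e (QuadraticMap.linMulLin f g + QuadraticMap.linMulLin h h) =
      - (Matrix.of fun i j => ![f, g, h] i (e j)).det ^ 2 := by
  simp only [halfDiscriminant, QuadraticMap.polar, QuadraticMap.linMulLin_apply, map_add,
    add_apply, Matrix.det_fin_three, Matrix.of_apply, Matrix.cons_val]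
  ring

theorem halfDiscriminant_stdForm_zero_ne_zero (e b : Basis (Fin 3) k V) :
    halfDiscriminant e (stdForm b 0) ≠ 0 := by
  have h1 : stdForm b 0 = QuadraticMap.linMulLin (b.coord 0) (b.coord 1)
      + QuadraticMap.linMulLin (b.coord 2) (b.coord 2) := rfl
  have h2 : (Matrix.of fun i j => ![b.coord 0, b.coord 1, b.coord 2] i (e j)) = b.toMatrix e := by
    ext i j
    fin_cases i <;> rfl
  rw [h1, halfDiscriminant_linMulLin_add, h2, ← b.det_apply]
  exact neg_ne_zero.mpr (pow_ne_zero 2 (b.isUnit_det e).ne_zero)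

theorem eq_linMulLin_of_sq {q : QuadraticForm k V} {f : Dual k V} (hf : ∀ x, q x = f x ^ 2) :
    q = QuadraticMap.linMulLin f f := by
  ext x
  rw [hf, QuadraticMap.linMulLin_apply, sq]

theorem not_isSemiregular_linMulLin (f g : Dual k V) :
    ¬ IsSemiregular (QuadraticMap.linMulLin f g) := by
  rintro ⟨e, he⟩
  rw [halfDiscriminant_linMulLin] at he
  exact not_isUnit_zero he

/-- On a plane, `f` has a nonzero kernel vector, and it lies in the radical of the polar form. -/
theorem not_isRankTwo_of_sq {q : QuadraticForm k V} {f : Dual k V} (hf : ∀ x, q x = f x ^ 2) :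
    ¬ IsRankTwo q := by
  rintro ⟨-, U, hU, hreg, -⟩
  have hfin : Module.Finite k U := Module.finite_of_finrank_pos (by omega)
  have hker : 0 < finrank k (LinearMap.ker (f.comp U.subtype)) := by
    have h1 := LinearMap.finrank_range_add_finrank_ker (f.comp U.subtype)
    have h2 := Submodule.finrank_le (LinearMap.range (f.comp U.subtype))
    rw [finrank_self] at h2
    omega
  have := finrank_pos_iff.mp hker
  obtain ⟨⟨x, hx⟩, hx0⟩ := exists_ne (0 : LinearMap.ker (f.comp U.subtype))
  refine hx0 (Subtype.ext (hreg x fun y => ?_))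
  have hfx : f x = 0 := hx
  simp [QuadraticMap.polar, hf, hfx]

theorem isRankTwo_stdForm_one (b : Basis (Fin 3) k V) : IsRankTwo (stdForm b 1) := by
  refine ⟨not_isSemiregular_linMulLin _ _, ?_⟩
  have hli : LinearIndependent k ![b 0, b 1] := by
    have := b.linearIndependent.comp ![0, 1] (by decide)
    convert this using 1
    funext i
    fin_cases i <;> rfl
  refine ⟨Submodule.span k (Set.range ![b 0, b 1]), by rw [finrank_span_eq_card hli]; rfl, ?_⟩
  have h0 : b 0 ∈ Submodule.span k (Set.range ![b 0, b 1]) := Submodule.subset_span ⟨0, rfl⟩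
  have h1 : b 1 ∈ Submodule.span k (Set.range ![b 0, b 1]) := Submodule.subset_span ⟨1, rfl⟩
  have hleft : (QuadraticMap.polarBilin ((stdForm b 1).comp
      (Submodule.span k (Set.range ![b 0, b 1])).subtype)).SeparatingLeft := by
    rintro ⟨x, hx⟩ hxy
    have e0 := hxy ⟨b 0, h0⟩
    have e1 := hxy ⟨b 1, h1⟩
    obtain ⟨c, rfl⟩ := (Submodule.mem_span_range_iff_exists_fun k).mp hx
    simp [QuadraticMap.polar, stdForm_one_apply, Fin.sum_univ_two] at e0 e1
    have e0 : c 1 = 0 := by linear_combination e0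
    have e1 : c 0 = 0 := by linear_combination e1
    apply Subtype.ext
    simp [Fin.sum_univ_two, e0, e1]
  refine ⟨hleft, fun y hy => hleft y fun x => ?_⟩
  rw [← hy x]
  exact QuadraticMap.polar_comm _ _ _

theorem hasType_stdForm (b : Basis (Fin 3) k V) (i : Fin 4) : HasType (stdForm b i) i := by
  match i with
  | 0 => exact ⟨b, isUnit_iff_ne_zero.mpr (halfDiscriminant_stdForm_zero_ne_zero b b)⟩
  | 1 => exact isRankTwo_stdForm_one b
  | 2 =>
    refine ⟨fun h => ?_, b.coord 2, fun x => stdForm_two_apply b x⟩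
    have := stdForm_two_apply b (b 2)
    rw [h] at this
    simp at this
  | 3 => exact stdForm_three b

theorem HasType.unique {q : QuadraticForm k V} {i j : Fin 4} (hi : HasType q i)
    (hj : HasType q j) : i = j := by
  have h02 : ∀ f : Dual k V, (∀ x, q x = f x ^ 2) → ¬ IsSemiregular q := fun f hf => by
    rw [eq_linMulLin_of_sq hf]; exact not_isSemiregular_linMulLin f f
  have h12 : ∀ f : Dual k V, (∀ x, q x = f x ^ 2) → ¬ IsRankTwo q := fun f hf =>
    not_isRankTwo_of_sq hf
  have h3 : q = 0 → ∀ x, q x = (0 : Dual k V) x ^ 2 := fun h x => by simp [h]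
  have h01 : IsSemiregular q → ¬ IsRankTwo q := fun h h' => h'.1 h
  have h20 : IsNonzeroSquare q → ¬ IsSemiregular q := fun ⟨_, f, hf⟩ => h02 f hf
  have h21 : IsNonzeroSquare q → ¬ IsRankTwo q := fun ⟨_, f, hf⟩ => h12 f hf
  have h30 : q = 0 → ¬ IsSemiregular q := fun h => h02 0 (h3 h)
  have h31 : q = 0 → ¬ IsRankTwo q := fun h => h12 0 (h3 h)
  have h32 : IsNonzeroSquare q → q ≠ 0 := fun h => h.1
  match i, j with
  | 0, 0 | 1, 1 | 2, 2 | 3, 3 => rfl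
  | 0, 1 => exact absurd hj (h01 hi)
  | 1, 0 => exact absurd hi (h01 hj)
  | 0, 2 => exact absurd hi (h20 hj)
  | 2, 0 => exact absurd hj (h20 hi)
  | 0, 3 => exact absurd hi (h30 hj)
  | 3, 0 => exact absurd hj (h30 hi)
  | 1, 2 => exact absurd hi (h21 hj)
  | 2, 1 => exact absurd hj (h21 hi)
  | 1, 3 => exact absurd hi (h31 hj)
  | 3, 1 => exact absurd hj (h31 hi)
  | 2, 3 => exact absurd hj (h32 hi)
  | 3, 2 => exact absurd hi (h32 hj)

theorem hasType_iff (hk : IsQuadraticallyClosed k) (e : Basis (Fin 3) k V)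
    (q : QuadraticForm k V) (i : Fin 4) :
    HasType q i ↔ ∃ b : Basis (Fin 3) k V, q = stdForm b i := by
  constructor
  · intro h
    obtain ⟨b, j, rfl⟩ := exists_eq_stdForm hk e q
    rw [h.unique (hasType_stdForm b j)]
    exact ⟨b, rfl⟩
  · rintro ⟨b, rfl⟩
    exact hasType_stdForm b i

theorem stdForm_map {V' : Type*} [AddCommGroup V'] [Module k V'] (b : Basis (Fin 3) k V)
    (g : V ≃ₗ[k] V') (i : Fin 4) (x : V') : stdForm (b.map g) i x = stdForm b i (g.symm x) := by
  fin_cases i <;> simp [stdForm]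

theorem mem_formOrbit_stdForm_iff (e : Basis (Fin 3) k V) (q : QuadraticForm k V) (i : Fin 4) :
    q ∈ formOrbit (stdForm e i) ↔ ∃ b : Basis (Fin 3) k V, q = stdForm b i := by
  constructor
  · rintro ⟨g, rfl⟩
    refine ⟨e.map g, ?_⟩
    ext x
    rw [stdForm_map]
    rfl
  · rintro ⟨b, rfl⟩
    refine ⟨e.equiv b (Equiv.refl _), ?_⟩
    have : b = e.map (e.equiv b (Equiv.refl _)) := by ext i; simp
    ext x
    conv_rhs => rw [this, stdForm_map]
    rfl

theorem setOf_hasType (hk : IsQuadraticallyClosed k) (e : Basis (Fin 3) k V) (i : Fin 4) :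
    {q : QuadraticForm k V | HasType q i} = formOrbit (stdForm e i) := by
  ext q
  rw [mem_formOrbit_stdForm_iff, ← hasType_iff hk e]
  rfl

theorem AreSimilar.hasType (hk : IsQuadraticallyClosed k) (e : Basis (Fin 3) k V)
    {V' : Type*} [AddCommGroup V'] [Module k V'] {q : QuadraticForm k V} {q' : QuadraticForm k V'}
    (h : AreSimilar q q') {i : Fin 4} (hi : HasType q i) : HasType q' i := by
  obtain ⟨g, l, hl⟩ := h
  obtain ⟨b, rfl⟩ := (hasType_iff hk e q i).mp hi
  obtain ⟨r, hr⟩ := hk.exists_sq (l : k)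
  have hr0 : r ≠ 0 := by rintro rfl; exact l.ne_zero (by rw [← hr]; simp)
  -- In the rescaled basis the coordinates are multiplied by `l`, `1` and `r`, so both `x₀x₁` and
  -- `x₂²` pick up the factor `l = r²`.
  let c : Fin 3 → kˣ := ![l⁻¹, 1, (Units.mk0 r hr0)⁻¹]
  suffices q' = stdForm ((b.map g).unitsSMul c) i by rw [this]; exact hasType_stdForm _ i
  ext x
  obtain ⟨x, rfl⟩ := g.surjective x
  rw [hl]
  have hrepr : ∀ j, ((b.map g).unitsSMul c).repr (g x) j = (c j)⁻¹ • b.repr x j := fun j => by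
    rw [Basis.repr_unitsSMul]; simp
  match i with
  | 0 =>
    rw [stdForm_zero_apply, stdForm_zero_apply, hrepr, hrepr, hrepr]
    simp [c, Units.smul_def, ← hr]
    ring
  | 1 =>
    rw [stdForm_one_apply, stdForm_one_apply, hrepr, hrepr]
    simp [c, Units.smul_def]
    ring
  | 2 =>
    rw [stdForm_two_apply, stdForm_two_apply, hrepr]
    simp [c, Units.smul_def, ← hr]
    ring
  | 3 => simp [stdForm_three]

theorem exists_similarity_classes_equiv (hk : IsQuadraticallyClosed k) (e : Basis (Fin 3) k V) :
    ∃ c : Quotient (similaritySetoid.{u, v} k) ≃ Fin 4,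
      ∀ (M : TernaryQuadraticModule.{u, v} k) (i : Fin 4),
        c (Quotient.mk _ M) = i ↔ HasType M.1.form i := by
  have hbasis : ∀ M : TernaryQuadraticModule.{u, v} k, Nonempty (Basis (Fin 3) k M.1) := fun M =>
    have : Module.Finite k M.1 := Module.finite_of_finrank_pos (by rw [M.2]; norm_num)
    ⟨finBasisOfFinrankEq k M.1 M.2⟩
  have hex : ∀ M : TernaryQuadraticModule.{u, v} k, ∃ i, HasType M.1.form i := fun M => by
    obtain ⟨b⟩ := hbasis M
    obtain ⟨b', i, h⟩ := exists_eq_stdForm hk b M.1.form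
    exact ⟨i, by rw [h]; exact hasType_stdForm b' i⟩
  choose t ht using hex
  have hresp : ∀ M N : TernaryQuadraticModule.{u, v} k, AreSimilar M.1.form N.1.form →
      t M = t N := fun M N h => by
    obtain ⟨b⟩ := hbasis M
    exact (h.hasType hk b (ht M)).unique (ht N)
  let F : Quotient (similaritySetoid.{u, v} k) → Fin 4 := Quotient.lift t hresp
  have hF : Function.Bijective F := by
    constructor
    · intro x y
      induction x using Quotient.inductionOn with | _ M
      induction y using Quotient.inductionOn with | _ N
      intro hMN
      have hMN : t M = t N := hMN
      obtain ⟨e₁⟩ := hbasis M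
      obtain ⟨e₂⟩ := hbasis N
      obtain ⟨b₁, h₁⟩ := (hasType_iff hk e₁ _ _).mp (ht M)
      obtain ⟨b₂, h₂⟩ := (hasType_iff hk e₂ _ _).mp (ht N)
      obtain ⟨g, hg⟩ : ∃ g : M.1 ≃ₗ[k] N.1, b₂ = b₁.map g :=
        ⟨b₁.equiv b₂ (Equiv.refl _), by ext i; simp⟩
      refine Quotient.sound ⟨g, 1, fun x => ?_⟩
      rw [h₁, h₂, ← hMN, Units.val_one, one_mul, hg, stdForm_map, LinearEquiv.symm_apply_apply]
    · intro i
      -- `V` itself, carrying the standard form, represents the class.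
      refine ⟨Quotient.mk _ ⟨⟨ModuleCat.of k V, stdForm e i⟩, ?_⟩, ?_⟩
      · exact (finrank_eq_card_basis e).trans (by simp)
      · exact (ht _).unique (hasType_stdForm e i)
  refine ⟨Equiv.ofBijective F hF, fun M i => ?_⟩
  change t M = i ↔ _
  exact ⟨fun h => h ▸ ht M, fun h => (ht M).unique h⟩

end Classification

end TernaryForms

namespace TernaryForms

open Module MvPolynomial

/-! ### Coordinates on the space of ternary quadratic forms -/

section Coordinates

variable {k : Type u} [Field k] {V : Type v} [AddCommGroup V] [Module k V] {τ : Type*}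

/-- The form with given coefficients relative to a basis. -/
noncomputable def formOf (e : Basis (Fin 3) k V) (z : FormIdx τ → k) : QuadraticForm k V :=
  ∑ i, (lam z i • QuadraticMap.linMulLin (e.coord i) (e.coord i)
    + mu z i • QuadraticMap.linMulLin (e.coord (i + 1)) (e.coord (i + 2)))

theorem formOf_apply (e : Basis (Fin 3) k V) (z : FormIdx τ → k) (x : V) :
    formOf e z x = lam z 0 * e.repr x 0 ^ 2 + lam z 1 * e.repr x 1 ^ 2 + lam z 2 * e.repr x 2 ^ 2
      + mu z 0 * (e.repr x 1 * e.repr x 2) + mu z 1 * (e.repr x 2 * e.repr x 0)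
      + mu z 2 * (e.repr x 0 * e.repr x 1) := by
  simp [formOf, Fin.sum_univ_three]
  ring

theorem formOf_basis (e : Basis (Fin 3) k V) (z : FormIdx τ → k) (i : Fin 3) :
    formOf e z (e i) = lam z i := by
  rw [formOf_apply]
  fin_cases i <;> simp

theorem polar_formOf (e : Basis (Fin 3) k V) (z : FormIdx τ → k) (i : Fin 3) :
    QuadraticMap.polar (formOf e z) (e (i + 1)) (e (i + 2)) = mu z i := by
  rw [QuadraticMap.polar, formOf_apply, formOf_apply, formOf_apply]
  fin_cases i <;> simp <;> ring

/-- The coordinates of a form, completed by further free coordinates. -/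
noncomputable def coordsOf (e : Basis (Fin 3) k V) (q : QuadraticForm k V) (t : τ → k) : FormIdx τ → k :=
  pt (fun i => q (e i)) (fun i => QuadraticMap.polar q (e (i + 1)) (e (i + 2))) t

theorem formOf_coordsOf (e : Basis (Fin 3) k V) (q : QuadraticForm k V) (t : τ → k) :
    formOf e (coordsOf e q t) = q := by
  have h := polar_formOf e (coordsOf e q t)
  refine quadraticForm_ext_basis e (formOf_basis _ _ _) (formOf_basis _ _ _) (formOf_basis _ _ _)
    (h 2) ?_ (h 0)
  rw [QuadraticMap.polar_comm]
  exact (h 1).trans (QuadraticMap.polar_comm _ _ _)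

theorem coordsOf_formOf (e : Basis (Fin 3) k V) (z : FormIdx τ → k) :
    coordsOf e (formOf e z) (fun t => z (Sum.inr t)) = z := by
  funext s
  rcases s with (i | i) | t
  · exact formOf_basis e z i
  · exact polar_formOf e z i
  · rfl

theorem halfDiscriminant_formOf (e : Basis (Fin 3) k V) (z : FormIdx τ → k) :
    halfDiscriminant e (formOf e z) = discr (lam z) (mu z) := by
  have h0 := polar_formOf e z 0
  have h1 := polar_formOf e z 1
  have h2 := polar_formOf e z 2
  simp only [Fin.reduceAdd, zero_add] at h0 h1 h2
  rw [QuadraticMap.polar_comm] at h1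
  rw [halfDiscriminant, formOf_basis, formOf_basis, formOf_basis]
  rw [h0, h1, h2, discr]
  ring

theorem isSquare_formOf_iff (e : Basis (Fin 3) k V) (z : FormIdx τ → k) :
    (∃ f : Dual k V, ∀ x, formOf e z x = f x ^ 2) ↔ IsSq z := by
  constructor
  · rintro ⟨f, hf⟩
    refine ⟨fun i => f (e i), fun i => ⟨by rw [← formOf_basis e, hf], ?_⟩⟩
    rw [← polar_formOf e, QuadraticMap.polar, hf, hf, hf, map_add]
    ring
  · rintro ⟨a, ha⟩
    refine ⟨∑ i, a i • e.coord i, fun x => ?_⟩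
    rw [formOf_apply]
    simp only [(ha _).1, (ha _).2, Fin.sum_univ_three, LinearMap.add_apply, LinearMap.smul_apply,
      Basis.coord_apply, smul_eq_mul, Fin.reduceAdd]
    ring

theorem formOf_eq_zero_iff (e : Basis (Fin 3) k V) (z : FormIdx τ → k) :
    formOf e z = 0 ↔ IsZeroPt z := by
  constructor
  · intro h i
    rw [← formOf_basis e, ← polar_formOf e, h]
    simp [QuadraticMap.polar]
  · intro h
    ext x
    rw [formOf_apply]
    simp [(h _).1, (h _).2]

theorem hasType_formOf_of_mem_stratum (hk : IsQuadraticallyClosed k) (e : Basis (Fin 3) k V)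
    {z : FormIdx τ → k} {i : Fin 4} (hz : z ∈ stratum k τ i) : HasType (formOf e z) i := by
  match i with
  | 0 =>
    refine ⟨e, isUnit_iff_ne_zero.mpr ?_⟩
    rw [halfDiscriminant_formOf]
    exact hz
  | 1 =>
    obtain ⟨b, j, hj⟩ := exists_eq_stdForm hk e (formOf e z)
    match j with
    | 0 =>
      refine absurd hz.1 ?_
      rw [← halfDiscriminant_formOf e, hj]
      exact halfDiscriminant_stdForm_zero_ne_zero e b
    | 1 => rw [hj]; exact hasType_stdForm b 1
    | 2 =>
      refine absurd ((isSquare_formOf_iff e z).mp ⟨b.coord 2, fun x => ?_⟩) hz.2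
      rw [hj]
      exact stdForm_two_apply b x
    | 3 => exact absurd ((formOf_eq_zero_iff e z).mp hj).isSq hz.2
  | 2 => exact ⟨fun h => hz.2 ((formOf_eq_zero_iff e z).mp h), (isSquare_formOf_iff e z).mpr hz.1⟩
  | 3 => exact (formOf_eq_zero_iff e z).mpr hz

/-- The converse is formal: the strata cover the space and a form has only one type. -/
theorem hasType_formOf_iff (hk : IsQuadraticallyClosed k) (e : Basis (Fin 3) k V)
    (z : FormIdx τ → k) (i : Fin 4) : HasType (formOf e z) i ↔ z ∈ stratum k τ i := by
  refine ⟨fun h => ?_, hasType_formOf_of_mem_stratum hk e⟩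
  have hz : z ∈ ⋃ j, stratum k τ j := by rw [iUnion_stratum]; trivial
  obtain ⟨j, hj⟩ := Set.mem_iUnion.mp hz
  rwa [h.unique (hasType_formOf_of_mem_stratum hk e hj)]

theorem formOf_mem_formOrbit_iff (hk : IsQuadraticallyClosed k) (e : Basis (Fin 3) k V)
    (z : FormIdx τ → k) (i : Fin 4) :
    formOf e z ∈ formOrbit (stdForm e i) ↔ z ∈ stratum k τ i := by
  rw [← hasType_formOf_iff hk e, ← setOf_hasType hk e]
  rfl

/-- The coefficients of a form as a linear map. -/
noncomputable def coordsLin (e : Basis (Fin 3) k V) : QuadraticForm k V →ₗ[k] (FormIdx Empty → k) where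
  toFun q := coordsOf e q Empty.elim
  map_add' q q' := by
    funext s
    rcases s with (i | i) | t
    · rfl
    · exact QuadraticMap.polar_add _ _ _ _
    · exact t.elim
  map_smul' c q := by
    funext s
    rcases s with (i | i) | t
    · rfl
    · exact QuadraticMap.polar_smul _ _ _ _
    · exact t.elim

theorem isPolySection_formOf (e : Basis (Fin 3) k V) :
    IsPolySection (coordsLin e) (formOf (τ := Empty) e) where
  left_inv z := by
    conv_rhs => rw [← coordsOf_formOf e z]
    exact congrArg (coordsOf e (formOf e z)) (Subsingleton.elim _ _)
  poly l := by
    refine ⟨∑ i, (lam X i * C (l (QuadraticMap.linMulLin (e.coord i) (e.coord i))) +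
      mu X i * C (l (QuadraticMap.linMulLin (e.coord (i + 1)) (e.coord (i + 2))))), fun z => ?_⟩
    simp [formOf, lam, mu]

theorem image_formOf_stratum (hk : IsQuadraticallyClosed k) (e : Basis (Fin 3) k V) (i : Fin 4) :
    formOf e '' stratum k Empty i = formOrbit (stdForm e i) := by
  ext q
  constructor
  · rintro ⟨z, hz, rfl⟩
    exact (formOf_mem_formOrbit_iff hk e z i).mpr hz
  · intro hq
    rw [← formOf_coordsOf e q (Empty.elim : Empty → k)] at hq ⊢
    exact ⟨_, (formOf_mem_formOrbit_iff hk e _ i).mp hq, rfl⟩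

theorem isQuadraticallyClosed_of_isAlgClosed [IsAlgClosed k] : IsQuadraticallyClosed k := by
  intro a b
  obtain ⟨x, hx⟩ := IsAlgClosed.exists_root
    (Polynomial.X ^ 2 + Polynomial.C a * Polynomial.X + Polynomial.C b : Polynomial k) (by
      have : (Polynomial.X ^ 2 + Polynomial.C a * Polynomial.X + Polynomial.C b :
          Polynomial k).degree = 2 := by compute_degree!
      rw [this]
      norm_num)
  exact ⟨x, by simpa using hx⟩

theorem isStratification_formOrbit [IsAlgClosed k] (e : Basis (Fin 3) k V) :
    IsStratification k (Set.univ : Set (QuadraticForm k V))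
      (fun i => formOrbit (stdForm e i)) := by
  have h := (isPolySection_formOf e).isStratification
  simp only [image_formOf_stratum isQuadraticallyClosed_of_isAlgClosed] at h
  rwa [Set.range_eq_univ.mpr fun q => ⟨_, formOf_coordsOf e q Empty.elim⟩] at h

theorem hasStatedSingularLoci_formOrbit [IsAlgClosed k] (e : Basis (Fin 3) k V) :
    HasStatedSingularLoci k (fun i => formOrbit (stdForm e i)) := by
  have h := (isPolySection_formOf e).hasStatedSingularLoci
  simpa only [image_formOf_stratum isQuadraticallyClosed_of_isAlgClosed] using h

end Coordinates

end TernaryForms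

namespace TernaryForms

open Module CliffordAlgebra

/-! ### Even Clifford algebras of ternary forms -/

section EvenClifford

variable {k : Type u} [Field k] {V : Type v} [AddCommGroup V] [Module k V]

/-- The product of two vectors in the even Clifford algebra. -/
noncomputable def evenMul (q : QuadraticForm k V) (x y : V) : even q :=
  ⟨ι q x * ι q y, ι_mul_ι_mem_evenOdd_zero q x y⟩

/-- `evenMul` as a bilinear map. -/
noncomputable def evenMulBilin (q : QuadraticForm k V) : V →ₗ[k] V →ₗ[k] even q :=
  LinearMap.mk₂ k (evenMul q) (fun x x' y => Subtype.ext (by simp [evenMul, add_mul]))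
    (fun c x y => Subtype.ext (by simp [evenMul]))
    (fun x y y' => Subtype.ext (by simp [evenMul, mul_add]))
    (fun c x y => Subtype.ext (by simp [evenMul]))

theorem evenMul_self (q : QuadraticForm k V) (x : V) : evenMul q x x = q x • 1 :=
  Subtype.ext (by simp [evenMul, Algebra.algebraMap_eq_smul_one])

theorem ι_mul_ι_swap (q : QuadraticForm k V) (x y : V) :
    ι q y * ι q x = QuadraticMap.polar q x y • 1 - ι q x * ι q y := by
  rw [← Algebra.algebraMap_eq_smul_one, ← ι_mul_ι_add_swap]
  abel

theorem evenMul_swap (q : QuadraticForm k V) (x y : V) :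
    evenMul q y x = QuadraticMap.polar q x y • 1 - evenMul q x y :=
  Subtype.ext (ι_mul_ι_swap q x y)

theorem ι_mul_self (q : QuadraticForm k V) (x : V) : ι q x * ι q x = q x • 1 := by
  rw [ι_sq_scalar, Algebra.algebraMap_eq_smul_one]

theorem evenMul_mul_self (q : QuadraticForm k V) (y z : V) :
    evenMul q y z * evenMul q y z =
      QuadraticMap.polar q y z • evenMul q y z - (q y * q z) • 1 := by
  refine Subtype.ext ?_
  change ι q y * ι q z * (ι q y * ι q z) = QuadraticMap.polar q y z • (ι q y * ι q z)
    - (q y * q z) • 1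
  calc ι q y * ι q z * (ι q y * ι q z) = ι q y * (ι q z * ι q y) * ι q z := by
        simp only [mul_assoc]
    _ = QuadraticMap.polar q y z • (ι q y * ι q z) - (ι q y * ι q y) * (ι q z * ι q z) := by
        rw [ι_mul_ι_swap q y z, mul_sub, sub_mul]
        simp only [mul_assoc, mul_smul_comm, smul_mul_assoc, one_mul]
    _ = _ := by rw [ι_mul_self, ι_mul_self, smul_mul_smul_comm, one_mul]

theorem evenMul_mul_evenMul (q : QuadraticForm k V) (x y z : V) :
    evenMul q z x * evenMul q x y =
      q x • (QuadraticMap.polar q y z • 1 - evenMul q y z) := by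
  refine Subtype.ext ?_
  change ι q z * ι q x * (ι q x * ι q y) = q x • (QuadraticMap.polar q y z • 1 - ι q y * ι q z)
  calc ι q z * ι q x * (ι q x * ι q y) = ι q z * (ι q x * ι q x) * ι q y := by
        simp only [mul_assoc]
    _ = _ := by
        rw [ι_mul_self, ← ι_mul_ι_swap]
        simp only [mul_smul_comm, smul_mul_assoc, mul_one]

theorem evenMul_mul_evenMul' (q : QuadraticForm k V) (x y z : V) :
    evenMul q x y * evenMul q z x =
      QuadraticMap.polar q z x • evenMul q x y
        - (QuadraticMap.polar q x y * QuadraticMap.polar q z x) • 1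
        + QuadraticMap.polar q x y • evenMul q z x + q x • evenMul q y z := by
  refine Subtype.ext ?_
  change ι q x * ι q y * (ι q z * ι q x) = QuadraticMap.polar q z x • (ι q x * ι q y)
        - (QuadraticMap.polar q x y * QuadraticMap.polar q z x) • 1
        + QuadraticMap.polar q x y • (ι q z * ι q x) + q x • (ι q y * ι q z)
  calc ι q x * ι q y * (ι q z * ι q x)
      = QuadraticMap.polar q z x • (ι q x * ι q y) - ι q x * (ι q y * ι q x) * ι q z := by
        rw [ι_mul_ι_swap q x z, mul_sub, QuadraticMap.polar_comm q x z, mul_smul_comm, mul_one]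
        simp only [mul_assoc]
    _ = QuadraticMap.polar q z x • (ι q x * ι q y)
          - QuadraticMap.polar q x y • (ι q x * ι q z) + q x • (ι q y * ι q z) := by
        rw [ι_mul_ι_swap q x y, mul_sub, sub_mul, mul_smul_comm, mul_one, smul_mul_assoc,
          ← mul_assoc (ι q x) (ι q x), ι_mul_self, smul_mul_assoc, one_mul, smul_mul_assoc]
        abel
    _ = _ := by
        rw [ι_mul_ι_swap q z x, smul_sub, smul_smul]
        abel

/-- The standard generators of the even Clifford algebra: `1` and `eᵢ₊₁ eᵢ₊₂`. -/
noncomputable def evenGen (e : Basis (Fin 3) k V) (q : QuadraticForm k V) :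
    Option (Fin 3) → even q :=
  fun o => o.elim 1 fun i => evenMul q (e (i + 1)) (e (i + 2))

theorem evenGen_none (e : Basis (Fin 3) k V) (q : QuadraticForm k V) : evenGen e q none = 1 := rfl

theorem evenGen_some (e : Basis (Fin 3) k V) (q : QuadraticForm k V) (i : Fin 3) :
    evenGen e q (some i) = evenMul q (e (i + 1)) (e (i + 2)) := rfl

theorem evenGen_mul_self (e : Basis (Fin 3) k V) (q : QuadraticForm k V) (i : Fin 3) :
    evenGen e q (some i) * evenGen e q (some i) =
      QuadraticMap.polar q (e (i + 1)) (e (i + 2)) • evenGen e q (some i)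
        - (q (e (i + 1)) * q (e (i + 2))) • evenGen e q none :=
  evenMul_mul_self _ _ _

theorem evenGen_mul_add_one (e : Basis (Fin 3) k V) (q : QuadraticForm k V) (i : Fin 3) :
    evenGen e q (some (i + 1)) * evenGen e q (some (i + 2)) =
      q (e i) • (QuadraticMap.polar q (e (i + 1)) (e (i + 2)) • evenGen e q none
        - evenGen e q (some i)) := by
  have := evenMul_mul_evenMul q (e i) (e (i + 1)) (e (i + 2))
  simpa only [evenGen_some, evenGen_none, Fin.add_one_add_one, Fin.add_one_add_two,
    Fin.add_two_add_one, Fin.add_two_add_two] using this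

theorem evenGen_mul_add_two (e : Basis (Fin 3) k V) (q : QuadraticForm k V) (i : Fin 3) :
    evenGen e q (some (i + 2)) * evenGen e q (some (i + 1)) =
      QuadraticMap.polar q (e (i + 2)) (e i) • evenGen e q (some (i + 2))
        - (QuadraticMap.polar q (e i) (e (i + 1)) * QuadraticMap.polar q (e (i + 2)) (e i)) •
          evenGen e q none
        + QuadraticMap.polar q (e i) (e (i + 1)) • evenGen e q (some (i + 1))
        + q (e i) • evenGen e q (some i) := by
  have := evenMul_mul_evenMul' q (e i) (e (i + 1)) (e (i + 2))
  simpa only [evenGen_some, evenGen_none, Fin.add_one_add_one, Fin.add_one_add_two,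
    Fin.add_two_add_one, Fin.add_two_add_two] using this

theorem evenMul_mem_span (e : Basis (Fin 3) k V) (q : QuadraticForm k V) (x y : V) :
    evenMul q x y ∈ Submodule.span k (Set.range (evenGen e q)) := by
  set S := Submodule.span k (Set.range (evenGen e q))
  have hS : ∀ o, evenGen e q o ∈ S := fun o => Submodule.subset_span ⟨o, rfl⟩
  have h1 : (1 : even q) ∈ S := hS none
  have hij : ∀ i j, evenMul q (e i) (e j) ∈ S := by
    intro i j
    rcases Fin.three_cases i j with rfl | rfl | rfl
    · rw [evenMul_self]
      exact S.smul_mem _ h1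
    · have := hS (some (i + 2))
      rwa [evenGen_some, Fin.add_two_add_one, Fin.add_two_add_two] at this
    · have := hS (some (i + 1))
      rw [evenGen_some, Fin.add_one_add_one, Fin.add_one_add_two] at this
      rw [evenMul_swap q (e (i + 2)) (e i)]
      exact S.sub_mem (S.smul_mem _ h1) this
  change evenMulBilin q x y ∈ S
  rw [← e.sum_repr x, ← e.sum_repr y]
  simp only [map_sum, map_smul, LinearMap.sum_apply, LinearMap.smul_apply]
  exact S.sum_mem fun i _ => S.smul_mem _ (S.sum_mem fun j _ => S.smul_mem _ (hij j i))

theorem evenGen_mul_mem_span (e : Basis (Fin 3) k V) (q : QuadraticForm k V)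
    (o o' : Option (Fin 3)) :
    evenGen e q o * evenGen e q o' ∈ Submodule.span k (Set.range (evenGen e q)) := by
  set S := Submodule.span k (Set.range (evenGen e q))
  have hS : ∀ o, evenGen e q o ∈ S := fun o => Submodule.subset_span ⟨o, rfl⟩
  rcases o with _ | i
  · rw [evenGen_none, one_mul]; exact hS _
  rcases o' with _ | j
  · rw [evenGen_none, mul_one]; exact hS _
  rcases Fin.three_cases i j with rfl | rfl | rfl
  · rw [evenGen_mul_self]
    exact S.sub_mem (S.smul_mem _ (hS _)) (S.smul_mem _ (hS _))
  · have := evenGen_mul_add_one e q (i + 2)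
    rw [Fin.add_two_add_one, Fin.add_two_add_two] at this
    rw [this]
    exact S.smul_mem _ (S.sub_mem (S.smul_mem _ (hS _)) (hS _))
  · have := evenGen_mul_add_two e q (i + 1)
    rw [Fin.add_one_add_one, Fin.add_one_add_two] at this
    rw [this]
    exact S.add_mem (S.add_mem (S.sub_mem (S.smul_mem _ (hS _)) (S.smul_mem _ (hS _)))
      (S.smul_mem _ (hS _))) (S.smul_mem _ (hS _))

/-- By the multiplication table the span is closed under products, and it contains all products of
two vectors, which generate the even part. -/
theorem span_evenGen (e : Basis (Fin 3) k V) (q : QuadraticForm k V) :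
    ⊤ ≤ Submodule.span k (Set.range (evenGen e q)) := by
  set S := Submodule.span k (Set.range (evenGen e q)) with hSdef
  have hmul : ∀ x ∈ S, ∀ y ∈ S, x * y ∈ S := by
    intro x hx y hy
    have : S * S ≤ S := by
      rw [hSdef, Submodule.span_mul_span, Submodule.span_le]
      rintro _ ⟨_, ⟨o, rfl⟩, _, ⟨o', rfl⟩, rfl⟩
      exact evenGen_mul_mem_span e q o o'
    exact this (Submodule.mul_mem_mul hx hy)
  rintro ⟨x, hx⟩ -
  induction x, hx using even_induction with
  | algebraMap r =>
    have : r • (1 : even q) ∈ S := S.smul_mem _ (Submodule.subset_span ⟨none, rfl⟩)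
    convert this using 1
    exact Subtype.ext (Algebra.algebraMap_eq_smul_one r)
  | add x y hx hy ihx ihy => exact S.add_mem ihx ihy
  | ι_mul_ι_mul m₁ m₂ x hx ih => exact hmul _ (evenMul_mem_span e q m₁ m₂) _ ih

/-- Contraction with the dual vectors of `eᵢ₊₁` and then `eᵢ₊₂` isolates the coefficient of `eᵢ₊₁ ∧
eᵢ₊₂`. -/
theorem linearIndependent_evenGen_zero (e : Basis (Fin 3) k V) :
    LinearIndependent k (evenGen e (0 : QuadraticForm k V)) := by
  rw [Fintype.linearIndependent_iff]
  intro c hc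
  rw [Fintype.sum_option] at hc
  have hc : c none • (1 : CliffordAlgebra (0 : QuadraticForm k V)) +
      ∑ i, c (some i) • (ι (0 : QuadraticForm k V) (e (i + 1)) *
        ι (0 : QuadraticForm k V) (e (i + 2))) = 0 := by
    have := congrArg Subtype.val hc
    simpa [evenGen, evenMul] using this
  have hinj : ∀ r : k, r • (1 : CliffordAlgebra (0 : QuadraticForm k V)) = 0 → r = 0 := by
    intro r hr
    rw [← Algebra.algebraMap_eq_smul_one] at hr
    exact (ExteriorAlgebra.algebraMap_inj V r 0).mp (hr.trans (map_zero _).symm)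
  have hsome : ∀ i, c (some i) = 0 := by
    intro i
    have h := congrArg (fun x => contractLeft (e.coord (i + 2))
      (contractLeft (e.coord (i + 1)) x)) hc
    have hij : ∀ j, contractLeft (e.coord (i + 2)) (contractLeft (e.coord (i + 1))
        (ι (0 : QuadraticForm k V) (e (j + 1)) * ι (0 : QuadraticForm k V) (e (j + 2)))) =
        if j = i then 1 else 0 := by
      intro j
      simp only [contractLeft_ι_mul, contractLeft_ι, Algebra.algebraMap_eq_smul_one,
        mul_smul_comm, mul_one, map_sub, map_smul]
      fin_cases i <;> fin_cases j <;> simp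
    simp only [map_add, map_sum, map_smul, hij, contractLeft_one, map_zero, smul_zero, zero_add,
      smul_ite, Finset.sum_ite_eq', Finset.mem_univ, if_true] at h
    exact hinj _ h
  intro o
  rcases o with _ | i
  · simp only [hsome, zero_smul, Finset.sum_const_zero, add_zero] at hc
    exact hinj _ hc
  · exact hsome i

/-- The basis `1`, `eᵢ₊₁ ∧ eᵢ₊₂` of the even exterior algebra. -/
noncomputable def wBasis (e : Basis (Fin 3) k V) : Basis (Option (Fin 3)) k (EvenExterior k V) :=
  Basis.mk (linearIndependent_evenGen_zero e) (span_evenGen e 0)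

theorem wBasis_apply (e : Basis (Fin 3) k V) (o : Option (Fin 3)) :
    wBasis e o = evenGen e 0 o := Basis.mk_apply _ _ _

theorem wBasis_none (e : Basis (Fin 3) k V) : wBasis e none = 1 := wBasis_apply e none

theorem wBasis_some (e : Basis (Fin 3) k V) (i : Fin 3) :
    wBasis e (some i) = evenMul 0 (e (i + 1)) (e (i + 2)) := wBasis_apply e (some i)

theorem psi_one (e : Basis (Fin 3) k V) (q : QuadraticForm k V) : psi e q 1 = 1 :=
  Subtype.ext (changeForm_one _)

theorem psi_evenMul (e : Basis (Fin 3) k V) (q : QuadraticForm k V) (x y : V) :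
    psi e q (evenMul q x y) = evenMul 0 x y + bilOf e q x y • 1 := by
  refine Subtype.ext ((changeForm_ι_mul_ι (neg_bilOf_toQuadraticMap e q) x y).trans ?_)
  rw [Algebra.algebraMap_eq_smul_one, LinearMap.neg_apply, LinearMap.neg_apply, neg_smul,
    sub_neg_eq_add]
  rfl

/-- This is why `b(q)` is chosen as it is: it vanishes on `(eᵢ₊₁, eᵢ₊₂)`, so the correction term in
`ψ` disappears on the generators. The multiplication table of `C₀(V, q)` is thereby the table of
`θ(q)` in a basis independent of `q`. -/
theorem psi_evenGen (e : Basis (Fin 3) k V) (q : QuadraticForm k V) (o : Option (Fin 3)) :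
    psi e q (evenGen e q o) = wBasis e o := by
  rcases o with _ | i
  · rw [evenGen_none, psi_one, wBasis_none]
  · have hb : bilOf e q (e (i + 1)) (e (i + 2)) = 0 := by
      rw [← LinearMap.BilinForm.toMatrix_apply e, bilOf, LinearMap.BilinForm.toMatrix_toBilin]
      fin_cases i <;> rfl
    rw [evenGen_some, psi_evenMul, hb, zero_smul, add_zero, wBasis_some]

theorem theta_psi (e : Basis (Fin 3) k V) (q : QuadraticForm k V) (x y : even q) :
    theta e q (psi e q x) (psi e q y) = psi e q (x * y) := by
  change psi e q ((psi e q).symm (psi e q x) * (psi e q).symm (psi e q y)) = _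
  rw [LinearEquiv.symm_apply_apply, LinearEquiv.symm_apply_apply]

theorem theta_wBasis (e : Basis (Fin 3) k V) (q : QuadraticForm k V) (o o' : Option (Fin 3)) :
    theta e q (wBasis e o) (wBasis e o') = psi e q (evenGen e q o * evenGen e q o') := by
  rw [← psi_evenGen e q, ← psi_evenGen e q, theta_psi]

theorem theta_one_left (e : Basis (Fin 3) k V) (q : QuadraticForm k V) (x : EvenExterior k V) :
    theta e q 1 x = x := by
  obtain ⟨x, rfl⟩ := (psi e q).surjective x
  nth_rw 1 [← psi_one e q]
  rw [theta_psi, one_mul]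

theorem theta_one_right (e : Basis (Fin 3) k V) (q : QuadraticForm k V) (x : EvenExterior k V) :
    theta e q x 1 = x := by
  obtain ⟨x, rfl⟩ := (psi e q).surjective x
  nth_rw 1 [← psi_one e q]
  rw [theta_psi, mul_one]

theorem theta_formOf_self {τ : Type*} (e : Basis (Fin 3) k V) (z : FormIdx τ → k) (i : Fin 3) :
    theta e (formOf e z) (wBasis e (some i)) (wBasis e (some i)) =
      mu z i • wBasis e (some i) - (lam z (i + 1) * lam z (i + 2)) • 1 := by
  rw [theta_wBasis, evenGen_mul_self, map_sub, map_smul, map_smul, psi_evenGen, psi_evenGen,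
    polar_formOf, formOf_basis, formOf_basis, wBasis_none]

theorem theta_formOf_add_one {τ : Type*} (e : Basis (Fin 3) k V) (z : FormIdx τ → k) (i : Fin 3) :
    theta e (formOf e z) (wBasis e (some (i + 1))) (wBasis e (some (i + 2))) =
      (lam z i * mu z i) • 1 - lam z i • wBasis e (some i) := by
  rw [theta_wBasis, evenGen_mul_add_one, map_smul, map_sub, map_smul, psi_evenGen, psi_evenGen,
    polar_formOf, formOf_basis, wBasis_none, smul_sub, smul_smul]

theorem theta_formOf_add_two {τ : Type*} (e : Basis (Fin 3) k V) (z : FormIdx τ → k) (i : Fin 3) :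
    theta e (formOf e z) (wBasis e (some (i + 2))) (wBasis e (some (i + 1))) =
      mu z (i + 1) • wBasis e (some (i + 2)) - (mu z (i + 2) * mu z (i + 1)) • 1
        + mu z (i + 2) • wBasis e (some (i + 1)) + lam z i • wBasis e (some i) := by
  have h1 := polar_formOf e z (i + 1)
  have h2 := polar_formOf e z (i + 2)
  rw [Fin.add_one_add_one, Fin.add_one_add_two] at h1
  rw [Fin.add_two_add_one, Fin.add_two_add_two] at h2
  rw [theta_wBasis, evenGen_mul_add_two, map_add, map_add, map_sub, map_smul, map_smul, map_smul,
    map_smul, psi_evenGen, psi_evenGen, psi_evenGen, psi_evenGen, h1, h2, formOf_basis, wBasis_none]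

end EvenClifford

end TernaryForms

namespace TernaryForms

open Module CliffordAlgebra MvPolynomial

/-! ### The parametrisation of the multiplications -/

section Shear

variable {k : Type u} [Field k] {W : Type v} [AddCommGroup W] [Module k W]

theorem algAct_apply (h : W ≃ₗ[k] W) (m : W →ₗ[k] W →ₗ[k] W) (x y : W) :
    algAct h m x y = h (m (h.symm x) (h.symm y)) := rfl

theorem algAct_mul (g h : W ≃ₗ[k] W) (m : W →ₗ[k] W →ₗ[k] W) :
    algAct (g * h) m = algAct g (algAct h m) := rfl

theorem algAct_transvection {f : Dual k W} {w : W} (hf : f w = 0) {m : W →ₗ[k] W →ₗ[k] W}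
    (hl : ∀ x, m w x = x) (hr : ∀ x, m x w = x) (x y : W) :
    algAct (LinearEquiv.transvection hf) m x y =
      m x y + (f (m x y) - f x * f y) • w - f y • x - f x • y := by
  have hs : ∀ x, (LinearEquiv.transvection hf).symm x = x - f x • w := fun x => by
    change x + f x • -w = _
    rw [smul_neg, sub_eq_add_neg]
  have ha : ∀ x, LinearEquiv.transvection hf x = x + f x • w := fun x => rfl
  rw [algAct_apply, hs, hs, ha]
  simp only [map_sub, map_smul, LinearMap.sub_apply, LinearMap.smul_apply, hl, hr, hf, smul_eq_mul]
  module

end Shear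

/-! ### Structure constants of the twisted multiplications -/

section Parametrisation

variable {k : Type u} [Field k] {V : Type v} [AddCommGroup V] [Module k V]

/-- The linear form on the even exterior algebra with coefficients `s` on the `eᵢ₊₁ ∧ eᵢ₊₂`. -/
noncomputable def biForm (e : Basis (Fin 3) k V) (s : Fin 3 → k) : Dual k (EvenExterior k V) :=
  ∑ i, s i • (wBasis e).coord (some i)

theorem biForm_one (e : Basis (Fin 3) k V) (s : Fin 3 → k) : biForm e s 1 = 0 := by
  simp [biForm, ← wBasis_none e]

theorem biForm_wBasis (e : Basis (Fin 3) k V) (s : Fin 3 → k) (i : Fin 3) :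
    biForm e s (wBasis e (some i)) = s i := by
  simp [biForm, Finsupp.single_apply]

/-- The point of the variety of multiplications given by a form and an element of `Lw`. -/
noncomputable def thetaPt (e : Basis (Fin 3) k V) (z : FormIdx (Fin 3) → k) :
    EvenExterior k V →ₗ[k] EvenExterior k V →ₗ[k] EvenExterior k V :=
  algAct (LinearEquiv.transvection (biForm_one e fun i => z (Sum.inr i))) (theta e (formOf e z))

theorem thetaPt_apply (e : Basis (Fin 3) k V) (z : FormIdx (Fin 3) → k) (x y : EvenExterior k V) :
    thetaPt e z x y = theta e (formOf e z) x y
      + (biForm e (fun i => z (Sum.inr i)) (theta e (formOf e z) x y)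
        - biForm e (fun i => z (Sum.inr i)) x * biForm e (fun i => z (Sum.inr i)) y) • 1
      - biForm e (fun i => z (Sum.inr i)) y • x - biForm e (fun i => z (Sum.inr i)) x • y :=
  algAct_transvection _ (theta_one_left e _) (theta_one_right e _) x y

theorem thetaPt_one_left (e : Basis (Fin 3) k V) (z : FormIdx (Fin 3) → k)
    (x : EvenExterior k V) : thetaPt e z 1 x = x := by
  rw [thetaPt_apply, theta_one_left, biForm_one]
  module

theorem thetaPt_one_right (e : Basis (Fin 3) k V) (z : FormIdx (Fin 3) → k)
    (x : EvenExterior k V) : thetaPt e z x 1 = x := by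
  rw [thetaPt_apply, theta_one_right, biForm_one]
  module

theorem thetaPt_self (e : Basis (Fin 3) k V) (z : FormIdx (Fin 3) → k) (i : Fin 3) :
    thetaPt e z (wBasis e (some i)) (wBasis e (some i)) =
      (mu z i - 2 * z (Sum.inr i)) • wBasis e (some i)
        + (mu z i * z (Sum.inr i) - lam z (i + 1) * lam z (i + 2) - z (Sum.inr i) ^ 2) • 1 := by
  rw [thetaPt_apply, theta_formOf_self]
  simp only [map_sub, map_smul, biForm_one, biForm_wBasis, smul_eq_mul]
  module

theorem thetaPt_add_one (e : Basis (Fin 3) k V) (z : FormIdx (Fin 3) → k) (i : Fin 3) :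
    thetaPt e z (wBasis e (some (i + 1))) (wBasis e (some (i + 2))) =
      (lam z i * (mu z i - z (Sum.inr i)) - z (Sum.inr (i + 1)) * z (Sum.inr (i + 2))) • 1
        + (-lam z i) • wBasis e (some i)
        + (-z (Sum.inr (i + 2))) • wBasis e (some (i + 1))
        + (-z (Sum.inr (i + 1))) • wBasis e (some (i + 2)) := by
  rw [thetaPt_apply, theta_formOf_add_one]
  simp only [map_sub, map_smul, biForm_one, biForm_wBasis, smul_eq_mul]
  module

theorem thetaPt_add_two (e : Basis (Fin 3) k V) (z : FormIdx (Fin 3) → k) (i : Fin 3) :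
    thetaPt e z (wBasis e (some (i + 2))) (wBasis e (some (i + 1))) =
      (lam z i * z (Sum.inr i) + mu z (i + 2) * z (Sum.inr (i + 1))
          + mu z (i + 1) * z (Sum.inr (i + 2)) - mu z (i + 2) * mu z (i + 1)
          - z (Sum.inr (i + 1)) * z (Sum.inr (i + 2))) • 1
        + lam z i • wBasis e (some i)
        + (mu z (i + 2) - z (Sum.inr (i + 2))) • wBasis e (some (i + 1))
        + (mu z (i + 1) - z (Sum.inr (i + 1))) • wBasis e (some (i + 2)) := by
  rw [thetaPt_apply, theta_formOf_add_two]
  simp only [map_sub, map_add, map_smul, biForm_one, biForm_wBasis, smul_eq_mul]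
  module

/-- Recovers the coordinates of a form and of an element of `Lw` from structure constants. -/
noncomputable def structureCoords (e : Basis (Fin 3) k V) :
    (EvenExterior k V →ₗ[k] EvenExterior k V →ₗ[k] EvenExterior k V) →ₗ[k]
      (FormIdx (Fin 3) → k) where
  toFun m := pt
    (fun i => -(wBasis e).coord (some i) (m (wBasis e (some (i + 1))) (wBasis e (some (i + 2)))))
    (fun i => (wBasis e).coord (some (i + 2)) (m (wBasis e (some i)) (wBasis e (some (i + 2))))
      - (wBasis e).coord (some (i + 2)) (m (wBasis e (some (i + 2))) (wBasis e (some i))))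
    (fun i => -(wBasis e).coord (some (i + 2)) (m (wBasis e (some (i + 2))) (wBasis e (some i))))
  map_add' m m' := by
    funext s
    rcases s with (i | i) | i <;> simp [pt] <;> ring
  map_smul' c m := by
    funext s
    rcases s with (i | i) | i <;> simp [pt, mul_sub]

/-- Write `εᵢ` for the basis vectors and `tᵢ` for the free coordinates. The coefficient of `εᵢ` in
`εᵢ₊₁ εᵢ₊₂` is `-lam i`. That of `εᵢ₊₂` is `-tᵢ` in `εᵢ₊₂ εᵢ` and `mu i - tᵢ` in `εᵢ εᵢ₊₂`, so the
difference gives `mu i`. -/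
theorem structureCoords_thetaPt (e : Basis (Fin 3) k V) (z : FormIdx (Fin 3) → k) :
    structureCoords e (thetaPt e z) = z := by
  have hl : ∀ i, (wBasis e).coord (some (i + 2))
      (thetaPt e z (wBasis e (some (i + 2))) (wBasis e (some i))) = -z (Sum.inr i) := by
    intro i
    have := thetaPt_add_one e z (i + 1)
    rw [Fin.add_one_add_one, Fin.add_one_add_two] at this
    rw [this, ← wBasis_none e]
    simp
  funext s
  rcases s with (i | i) | i
  · change -(wBasis e).coord (some i)
      (thetaPt e z (wBasis e (some (i + 1))) (wBasis e (some (i + 2)))) = lam z i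
    rw [thetaPt_add_one, ← wBasis_none e]
    simp
  · change (wBasis e).coord (some (i + 2))
      (thetaPt e z (wBasis e (some i)) (wBasis e (some (i + 2)))) -
      (wBasis e).coord (some (i + 2))
        (thetaPt e z (wBasis e (some (i + 2))) (wBasis e (some i))) = mu z i
    have := thetaPt_add_two e z (i + 1)
    rw [Fin.add_one_add_one, Fin.add_one_add_two] at this
    rw [hl, this, ← wBasis_none e]
    simp
  · change -(wBasis e).coord (some (i + 2))
      (thetaPt e z (wBasis e (some (i + 2))) (wBasis e (some i))) = z (Sum.inr i)
    rw [hl, neg_neg]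

/-- Every linear form on the space of bilinear multiplications is a combination of linear forms in
the values at pairs of basis vectors. -/
theorem exists_dual_eq_sum {ι : Type*} [Fintype ι] {W : Type*} [AddCommGroup W] [Module k W]
    (b : Basis ι k W) (l : Dual k (W →ₗ[k] W →ₗ[k] W)) :
    ∃ L : ι → ι → Dual k W, ∀ m, l m = ∑ i, ∑ j, L i j (m (b i) (b j)) := by
  let E : ι → ι → W →ₗ[k] (W →ₗ[k] W →ₗ[k] W) := fun i j =>
    { toFun := fun w => LinearMap.mk₂ k (fun x y => (b.coord i x * b.coord j y) • w)
        (fun x x' y => by rw [map_add, add_mul, add_smul])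
        (fun c x y => by rw [map_smul, smul_eq_mul, mul_assoc, mul_smul])
        (fun x y y' => by rw [map_add, mul_add, add_smul])
        (fun c x y => by rw [map_smul, smul_eq_mul, mul_left_comm, mul_smul])
      map_add' := fun w w' => LinearMap.ext₂ fun x y => smul_add _ _ _
      map_smul' := fun c w => LinearMap.ext₂ fun x y => smul_comm _ _ _ }
  have hE : ∀ i j w x y, E i j w x y = (b.coord i x * b.coord j y) • w := fun _ _ _ _ _ => rfl
  refine ⟨fun i j => l ∘ₗ E i j, fun m => ?_⟩
  have hm : m = ∑ i, ∑ j, E i j (m (b i) (b j)) := by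
    refine b.ext fun i' => b.ext fun j' => ?_
    simp only [LinearMap.sum_apply, hE]
    classical
    rw [Fintype.sum_eq_single i', Fintype.sum_eq_single j']
    · simp
    · intro j hj
      simp [hj.symm]
    · intro i hi
      simp [Finsupp.single_apply, hi.symm]
  conv_lhs => rw [hm]
  simp only [map_sum, LinearMap.comp_apply]

/-- The structure constants are polynomials in the coordinates, and a linear form on multiplications
only sees the products of basis vectors. -/
theorem isPolySection_thetaPt (e : Basis (Fin 3) k V) :
    IsPolySection (structureCoords e) (thetaPt e) where
  left_inv := structureCoords_thetaPt e
  poly l := by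
    obtain ⟨L, hL⟩ := exists_dual_eq_sum (wBasis e) l
    have key : ∀ o o', ∃ N : MvPolynomial (FormIdx (Fin 3)) k,
        ∀ z, L o o' (thetaPt e z (wBasis e o) (wBasis e o')) = eval z N := by
      intro o o'
      generalize L o o' = f
      rcases o with _ | i
      · exact ⟨C (f (wBasis e o')), fun z => by rw [wBasis_none, thetaPt_one_left, eval_C]⟩
      rcases o' with _ | j
      · exact ⟨C (f (wBasis e (some i))), fun z => by rw [wBasis_none, thetaPt_one_right, eval_C]⟩
      rcases Fin.three_cases i j with rfl | rfl | rfl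
      · refine ⟨(mu X j - 2 * X (Sum.inr j)) * C (f (wBasis e (some j)))
          + (mu X j * X (Sum.inr j) - lam X (j + 1) * lam X (j + 2) - X (Sum.inr j) ^ 2) * C (f 1),
          fun z => ?_⟩
        rw [thetaPt_self]
        simp [lam, mu]
      · obtain ⟨i, rfl⟩ : ∃ j, i = j + 1 := ⟨i + 2, (Fin.add_two_add_one i).symm⟩
        refine ⟨(lam X i * (mu X i - X (Sum.inr i)) - X (Sum.inr (i + 1)) * X (Sum.inr (i + 2)))
            * C (f 1)
          + (-lam X i) * C (f (wBasis e (some i)))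
          + (-X (Sum.inr (i + 2))) * C (f (wBasis e (some (i + 1))))
          + (-X (Sum.inr (i + 1))) * C (f (wBasis e (some (i + 2)))), fun z => ?_⟩
        rw [Fin.add_one_add_one, thetaPt_add_one]
        simp [lam, mu]
      · obtain ⟨i, rfl⟩ : ∃ j, i = j + 2 := ⟨i + 1, (Fin.add_one_add_two i).symm⟩
        refine ⟨(lam X i * X (Sum.inr i) + mu X (i + 2) * X (Sum.inr (i + 1))
            + mu X (i + 1) * X (Sum.inr (i + 2)) - mu X (i + 2) * mu X (i + 1)
            - X (Sum.inr (i + 1)) * X (Sum.inr (i + 2))) * C (f 1)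
          + lam X i * C (f (wBasis e (some i)))
          + (mu X (i + 2) - X (Sum.inr (i + 2))) * C (f (wBasis e (some (i + 1))))
          + (mu X (i + 1) - X (Sum.inr (i + 1))) * C (f (wBasis e (some (i + 2)))), fun z => ?_⟩
        rw [Fin.add_two_add_two, thetaPt_add_two]
        simp [lam, mu]
    choose N hN using key
    refine ⟨∑ o, ∑ o', N o o', fun z => ?_⟩
    rw [hL, map_sum]
    simp only [map_sum, hN]

end Parametrisation

/-! ### Isometries and the even Clifford algebra -/

section Isometry

variable {k : Type u} [Field k] {V : Type v} [AddCommGroup V] [Module k V]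

theorem equivOfIsometry_mem_even {q q' : QuadraticForm k V} (g : q.IsometryEquiv q')
    {x : CliffordAlgebra q} (hx : x ∈ even q) : equivOfIsometry g x ∈ even q' := by
  induction x, hx using even_induction with
  | algebraMap r => rw [AlgEquiv.commutes]; exact (even q').algebraMap_mem r
  | add x y hx hy ihx ihy => rw [map_add]; exact (even q').add_mem ihx ihy
  | ι_mul_ι_mul m₁ m₂ x hx ih =>
    have hι : ∀ m, equivOfIsometry g (ι q m) = ι q' (g m) := fun m =>
      map_apply_ι g.toIsometry m
    rw [map_mul, map_mul, hι, hι]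
    exact (even q').mul_mem (ι_mul_ι_mem_evenOdd_zero q' (g m₁) (g m₂)) ih

/-- The isomorphism of even Clifford algebras induced by an isometry. -/
noncomputable def evenCongr {q q' : QuadraticForm k V} (g : q.IsometryEquiv q') :
    even q ≃ₗ[k] even q' where
  toFun x := ⟨equivOfIsometry g x, equivOfIsometry_mem_even g x.2⟩
  map_add' x y := Subtype.ext (map_add (equivOfIsometry g) x.1 y.1)
  map_smul' c x := Subtype.ext (map_smul (equivOfIsometry g) c x.1)
  invFun x := ⟨(equivOfIsometry g).symm x, equivOfIsometry_mem_even g.symm x.2⟩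
  left_inv x := Subtype.ext ((equivOfIsometry g).symm_apply_apply x.1)
  right_inv x := Subtype.ext ((equivOfIsometry g).apply_symm_apply x.1)

theorem evenCongr_mul {q q' : QuadraticForm k V} (g : q.IsometryEquiv q') (x y : even q) :
    evenCongr g (x * y) = evenCongr g x * evenCongr g y :=
  Subtype.ext (map_mul (equivOfIsometry g) x.1 y.1)

theorem evenCongr_one {q q' : QuadraticForm k V} (g : q.IsometryEquiv q') :
    evenCongr g 1 = 1 :=
  Subtype.ext (map_one (equivOfIsometry g))

theorem evenCongr_evenMul {q q' : QuadraticForm k V} (g : q.IsometryEquiv q') (x y : V) :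
    evenCongr g (evenMul q x y) = evenMul q' (g x) (g y) := by
  refine Subtype.ext ((map_mul (equivOfIsometry g) _ _).trans ?_)
  change _ = ι q' (g x) * ι q' (g y)
  congr 1 <;> exact map_apply_ι g.toIsometry _

/-- `g` is an isometry from `q` to `g · q`; transporting the induced isomorphism of even Clifford
algebras through the two maps `ψ` gives `h`. The last clause records that `h` is `Λ²g` modulo the
identity. -/
theorem exists_stab_algAct_theta (e : Basis (Fin 3) k V) (q : QuadraticForm k V) (g : V ≃ₗ[k] V) :
    ∃ h ∈ Stab k (1 : EvenExterior k V), algAct h (theta e q) = theta e (formAct g q) ∧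
      ∀ x y, ∃ c : k, h (evenMul 0 x y) = evenMul 0 (g x) (g y) + c • 1 := by
  let G : q.IsometryEquiv (formAct g q) :=
    { g with map_app' := fun x => congrArg q (g.symm_apply_apply x) }
  let h := (psi e q).symm ≪≫ₗ evenCongr G ≪≫ₗ psi e (formAct g q)
  have hh : ∀ x, h (psi e q x) = psi e (formAct g q) (evenCongr G x) := fun x => by
    simp [h]
  have h1 : h 1 = 1 := by
    rw [← psi_one e q, hh, evenCongr_one, psi_one, psi_one]
  refine ⟨h, h1, ?_, fun x y => ?_⟩
  · refine LinearMap.ext₂ fun x y => ?_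
    obtain ⟨x, rfl⟩ := h.surjective x
    obtain ⟨y, rfl⟩ := h.surjective y
    rw [algAct_apply, h.symm_apply_apply, h.symm_apply_apply]
    obtain ⟨x, rfl⟩ := (psi e q).surjective x
    obtain ⟨y, rfl⟩ := (psi e q).surjective y
    rw [theta_psi, hh, hh, hh, theta_psi, evenCongr_mul]
  · have h2 := hh (evenMul q x y)
    rw [evenCongr_evenMul, psi_evenMul, psi_evenMul, map_add, map_smul, h1] at h2
    refine ⟨bilOf e (formAct g q) (G x) (G y) - bilOf e q x y, ?_⟩
    rw [eq_sub_of_add_eq h2, sub_smul, add_sub_assoc]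
    rfl

end Isometry

end TernaryForms

namespace TernaryForms

open Module CliffordAlgebra

/-! ### The orbits of multiplications -/

section CrossProduct

variable {k : Type u} [Field k]

/-- The cofactors of three vectors. -/
def cofactor (m : Fin 3 → Fin 3 → k) (i s : Fin 3) : k :=
  m (i + 1) (s + 1) * m (i + 2) (s + 2) - m (i + 1) (s + 2) * m (i + 2) (s + 1)

/-- The double adjugate of a 3×3 matrix; cyclic indexing absorbs the signs, and cofactors are not
transposed. -/
theorem cofactor_cofactor (m : Fin 3 → Fin 3 → k) (i s : Fin 3) :
    cofactor (cofactor m) i s = (Matrix.of m).det * m i s := by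
  rw [Matrix.det_fin_three]
  fin_cases i <;> fin_cases s <;> simp [cofactor] <;> ring

theorem sum_cofactor_mul (m : Fin 3 → Fin 3 → k) (i j : Fin 3) :
    ∑ s, cofactor m i s * m j s = if i = j then (Matrix.of m).det else 0 := by
  rw [Matrix.det_fin_three, Fin.sum_univ_three]
  fin_cases i <;> fin_cases j <;> simp [cofactor] <;> ring

end CrossProduct

section Orbits

variable {k : Type u} [Field k] {V : Type v} [AddCommGroup V] [Module k V]

theorem evenMul_zero_eq_sum (e : Basis (Fin 3) k V) (x y : V) :
    evenMul 0 x y = ∑ s, (e.repr x (s + 1) * e.repr y (s + 2) - e.repr x (s + 2) * e.repr y (s + 1))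
      • wBasis e (some s) := by
  have hself : ∀ i, evenMulBilin (0 : QuadraticForm k V) (e i) (e i) = 0 := fun i => by
    change evenMul 0 (e i) (e i) = 0
    rw [evenMul_self]
    simp
  have h1 : ∀ i, evenMulBilin (0 : QuadraticForm k V) (e (i + 1)) (e (i + 2)) =
      wBasis e (some i) := fun i => (wBasis_some e i).symm
  have h2 : ∀ i, evenMulBilin (0 : QuadraticForm k V) (e (i + 2)) (e (i + 1)) =
      -wBasis e (some i) := fun i => by
    change evenMul 0 (e (i + 2)) (e (i + 1)) = _
    rw [evenMul_swap, wBasis_some]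
    simp [QuadraticMap.polar]
  change evenMulBilin 0 x y = _
  conv_lhs => rw [← e.sum_repr x, ← e.sum_repr y]
  have a0 := h1 0
  have a1 := h1 1
  have a2 := h1 2
  have b0 := h2 0
  have b1 := h2 1
  have b2 := h2 2
  simp only [Fin.reduceAdd, zero_add] at a0 a1 a2 b0 b1 b2
  simp only [map_add, map_smul, LinearMap.add_apply, LinearMap.smul_apply, Fin.sum_univ_three,
    hself, a0, a1, a2, b0, b1, b2, Fin.reduceAdd, zero_add]
  module

/-- `h` fixes `1`, so it induces an injective map on the quotient by the line of `1`, and the matrix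
is that of this map. -/
theorem det_coord_ne_zero (e : Basis (Fin 3) k V) {h : EvenExterior k V ≃ₗ[k] EvenExterior k V}
    (h1 : h 1 = 1) :
    (Matrix.of fun i s : Fin 3 => (wBasis e).coord (some s) (h (wBasis e (some i)))).det ≠ 0 := by
  rw [← isUnit_iff_ne_zero, ← Matrix.isUnit_iff_isUnit_det,
    ← Matrix.linearIndependent_rows_iff_isUnit, Fintype.linearIndependent_iff]
  intro c hc
  set y := h (∑ i, c i • wBasis e (some i)) with hy
  have hy' : y = (wBasis e).coord none y • 1 := by
    refine (wBasis e).repr.injective (Finsupp.ext fun o => ?_)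
    rcases o with _ | s
    · simp [← wBasis_none e]
    · have := congrFun hc s
      simpa [← wBasis_none e, hy, Matrix.row] using this
  have h2 : ∑ i, c i • wBasis e (some i) = (wBasis e).coord none y • wBasis e none := by
    apply h.injective
    rw [← hy, map_smul, wBasis_none, h1]
    exact hy'
  intro i
  have := congrArg ((wBasis e).coord (some i)) h2
  simpa [Finsupp.single_apply] using this

/-- Every automorphism `m` of `Λ²V` is some `Λ²g`. The matrix of `Λ²g` consists of the cofactors of
`g`, so take `g = r · cofactor m`, whose cofactors are `r² (det m) m`. The choice `r² = (det m)⁻¹`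
needs only a square root. -/
theorem exists_linearEquiv_evenMul (hk : IsQuadraticallyClosed k) (e : Basis (Fin 3) k V)
    {h : EvenExterior k V ≃ₗ[k] EvenExterior k V} (h1 : h 1 = 1) :
    ∃ g : V ≃ₗ[k] V, ∀ i, ∃ c : k,
      h (wBasis e (some i)) = evenMul 0 (g (e (i + 1))) (g (e (i + 2))) + c • 1 := by
  set m : Fin 3 → Fin 3 → k := fun i s => (wBasis e).coord (some s) (h (wBasis e (some i))) with hm
  set D := (Matrix.of m).det with hD
  have hD0 : D ≠ 0 := det_coord_ne_zero e h1
  obtain ⟨r, hr⟩ := hk.exists_sq D⁻¹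
  have hr2 : r ^ 2 * D = 1 := by rw [hr, inv_mul_cancel₀ hD0]
  have hr0 : r ≠ 0 := by rintro rfl; simp at hr2
  have hli : LinearIndependent k fun i => ∑ s, (r * cofactor m i s) • e s := by
    rw [Fintype.linearIndependent_iff]
    intro c hc j
    have h2 : ∀ s, ∑ i, c i * (r * cofactor m i s) = 0 := fun s => by
      have := congrArg (fun x => e.repr x s) hc
      simpa [Finsupp.single_apply] using this
    have h3 : ∑ s, (∑ i, c i * (r * cofactor m i s)) * m j s = 0 := by simp [h2]
    have h4 : ∑ s, (∑ i, c i * (r * cofactor m i s)) * m j s =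
        ∑ i, c i * r * ∑ s, cofactor m i s * m j s := by
      simp only [Finset.sum_mul, Finset.mul_sum]
      rw [Finset.sum_comm]
      exact Finset.sum_congr rfl fun _ _ => Finset.sum_congr rfl fun _ _ => by ring
    rw [h4] at h3
    simp only [sum_cofactor_mul, mul_ite, mul_zero, Finset.sum_ite_eq', Finset.mem_univ,
      if_true] at h3
    simpa [hr0, hD0, ← hD] using h3
  have := Module.Finite.of_basis e
  let b := basisOfLinearIndependentOfCardEqFinrank hli (finrank_eq_card_basis e).symm
  have hb : ∀ i s, e.repr (b i) s = r * cofactor m i s := fun i s => by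
    simp [b, Finsupp.single_apply]
  refine ⟨e.equiv b (Equiv.refl _), fun i => ⟨(wBasis e).coord none (h (wBasis e (some i))), ?_⟩⟩
  have hcof : ∀ s, e.repr (b (i + 1)) (s + 1) * e.repr (b (i + 2)) (s + 2)
      - e.repr (b (i + 1)) (s + 2) * e.repr (b (i + 2)) (s + 1) = m i s := fun s => by
    have h2 := cofactor_cofactor m i s
    rw [cofactor] at h2
    simp only [hb]
    linear_combination r ^ 2 * h2 + m i s * hr2
  simp only [Basis.equiv_apply, Equiv.refl_apply]
  rw [evenMul_zero_eq_sum e]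
  simp only [hcof]
  conv_lhs => rw [← (wBasis e).sum_repr (h (wBasis e (some i))), Fintype.sum_option, wBasis_none]
  rw [add_comm]
  rfl

theorem eq_transvection_of_mem_Lw (e : Basis (Fin 3) k V)
    {t : EvenExterior k V ≃ₗ[k] EvenExterior k V} (ht : t ∈ Lw k (1 : EvenExterior k V)) :
    ∃ s : Fin 3 → k, t = LinearEquiv.transvection (biForm_one e s) := by
  have h : ∀ i, ∃ c : k, t (wBasis e (some i)) = wBasis e (some i) + c • 1 := fun i => by
    obtain ⟨c, hc⟩ := Submodule.mem_span_singleton.mp (ht.2 (wBasis e (some i)))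
    exact ⟨c, by rw [hc]; abel⟩
  choose s hs using h
  refine ⟨s, (wBasis e).ext' fun o => ?_⟩
  rcases o with _ | i
  · rw [wBasis_none, ht.1]
    change (1 : EvenExterior k V) = 1 + biForm e s 1 • 1
    rw [biForm_one, zero_smul, add_zero]
  · rw [hs]
    change _ = wBasis e (some i) + biForm e s (wBasis e (some i)) • 1
    rw [biForm_wBasis]

theorem transvection_mem_stab (e : Basis (Fin 3) k V) (s : Fin 3 → k) :
    LinearEquiv.transvection (biForm_one e s) ∈ Stab k (1 : EvenExterior k V) := by
  change (1 : EvenExterior k V) + biForm e s 1 • 1 = 1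
  rw [biForm_one, zero_smul, add_zero]

/-- Choose `g` with `h` equal to `Λ²g` modulo `1`, and let `h'` come from the isometry `g`. Then `h
* h'⁻¹` is the identity modulo `1`, hence lies in `Lw`, and `h'` moves `θ(q)` to `θ(g · q)`. -/
theorem exists_eq_transvection_mul (hk : IsQuadraticallyClosed k) (e : Basis (Fin 3) k V)
    (q : QuadraticForm k V) {h : EvenExterior k V ≃ₗ[k] EvenExterior k V}
    (h1 : h ∈ Stab k (1 : EvenExterior k V)) :
    ∃ (g : V ≃ₗ[k] V) (s : Fin 3 → k), algAct h (theta e q) =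
      algAct (LinearEquiv.transvection (biForm_one e s)) (theta e (formAct g q)) := by
  obtain ⟨g, hg⟩ := exists_linearEquiv_evenMul hk e (h1 : h 1 = 1)
  obtain ⟨h', hh', hact, hmul⟩ := exists_stab_algAct_theta e q g
  have hsymm : ∀ x, (h * h'⁻¹) (h' x) = h x := fun x => congrArg h (h'.symm_apply_apply x)
  have ht : h * h'⁻¹ ∈ Lw k (1 : EvenExterior k V) := by
    have ht1 := (Stab k (1 : EvenExterior k V)).mul_mem h1 (inv_mem hh')
    refine ⟨ht1, fun x => ?_⟩
    obtain ⟨x, rfl⟩ := h'.surjective x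
    rw [hsymm]
    induction (wBasis e).mem_span x using Submodule.span_induction with
    | mem x hx =>
      obtain ⟨_ | i, rfl⟩ := hx
      · rw [wBasis_none, show h 1 = 1 from h1, show h' 1 = 1 from hh', sub_self]
        exact zero_mem _
      · obtain ⟨c, hc⟩ := hg i
        obtain ⟨c', hc'⟩ := hmul (e (i + 1)) (e (i + 2))
        rw [← wBasis_some] at hc'
        rw [hc, hc', add_sub_add_left_eq_sub, ← sub_smul]
        exact Submodule.smul_mem _ _ (Submodule.mem_span_singleton_self _)
    | zero => simp
    | add x y _ _ hx hy =>
      rw [map_add, map_add, add_sub_add_comm]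
      exact add_mem hx hy
    | smul c x _ hx =>
      rw [map_smul, map_smul, ← smul_sub]
      exact Submodule.smul_mem _ _ hx
  obtain ⟨s, hs⟩ := eq_transvection_of_mem_Lw e ht
  refine ⟨g, s, ?_⟩
  rw [← hs, ← hact, ← algAct_mul, inv_mul_cancel_right]

theorem image_thetaPt_stratum (hk : IsQuadraticallyClosed k) (e : Basis (Fin 3) k V) (i : Fin 4) :
    thetaPt e '' stratum k (Fin 3) i =
      stabOrbit (1 : EvenExterior k V) (Theta e (stdForm e i) 1) := by
  ext m
  constructor
  · rintro ⟨z, hz, rfl⟩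
    obtain ⟨g, hg⟩ := (formOf_mem_formOrbit_iff hk e z i).mpr hz
    obtain ⟨h, h1, hact, -⟩ := exists_stab_algAct_theta e (stdForm e i) g
    refine ⟨⟨_, (Stab k (1 : EvenExterior k V)).mul_mem
      (transvection_mem_stab e fun i => z (Sum.inr i)) h1⟩, ?_⟩
    change algAct (_ * h) (theta e (stdForm e i)) = _
    rw [algAct_mul, hact]
    change algAct _ (theta e (formAct g (stdForm e i))) = _
    rw [show formAct g (stdForm e i) = _ from hg]
    rfl
  · rintro ⟨⟨h, h1⟩, rfl⟩
    obtain ⟨g, s, hgs⟩ := exists_eq_transvection_mul hk e (stdForm e i) h1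
    refine ⟨coordsOf e (formAct g (stdForm e i)) s, ?_, ?_⟩
    · rw [← formOf_mem_formOrbit_iff hk e, formOf_coordsOf]
      exact ⟨g, rfl⟩
    · refine Eq.trans ?_ hgs.symm
      rw [thetaPt, formOf_coordsOf]
      rfl

end Orbits

end TernaryForms

namespace TernaryForms

open Module CliffordAlgebra

/-! ### Azumaya structures -/

section Azumaya

/-- Every linear endomorphism of `A` is a sum of maps `x ↦ a x b`, so it preserves two-sided ideals;
some endomorphism takes a given nonzero element to `1`. -/
theorem isSimpleRing_of_isAzumaya (k : Type*) [Field k] (A : Type*) [Ring A] [Algebra k A]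
    [Nontrivial A] [h : IsAzumaya k A] : IsSimpleRing A := by
  refine isSimpleRing_iff_isTwoSided_imp.mpr ⟨inferInstance, fun I hI => ?_⟩
  refine or_iff_not_imp_left.mpr fun hne => ?_
  obtain ⟨a, ha, ha0⟩ := I.ne_bot_iff.mp hne
  refine (I.eq_top_iff_one).mpr ?_
  obtain ⟨l, hl⟩ : ∃ l : Dual k A, l a ≠ 0 := by
    by_contra! hl
    exact ha0 ((forall_dual_apply_eq_zero_iff k a).mp hl)
  obtain ⟨t, ht⟩ := h.bij.2 ((l a)⁻¹ • l.smulRight 1)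
  have hmem : ∀ t, AlgHom.mulLeftRight k A t a ∈ I := fun t => by
    induction t using TensorProduct.induction_on with
    | zero => simp
    | tmul x y =>
      rw [AlgHom.mulLeftRight_apply]
      exact I.mul_mem_right _ (I.mul_mem_left _ ha)
    | add x y hx hy =>
      rw [map_add]
      exact I.add_mem hx hy
  have := hmem t
  rwa [ht, LinearMap.smul_apply, LinearMap.smulRight_apply, smul_smul, inv_mul_cancel₀ hl,
    one_smul] at this

theorem nonempty_algEquiv_matrix_two (k : Type*) [Field k] [IsAlgClosed k] (A : Type*) [Ring A]
    [Algebra k A] [IsAzumaya k A] (hA : finrank k A = 4) :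
    Nonempty (A ≃ₐ[k] Matrix (Fin 2) (Fin 2) k) := by
  have : Nontrivial A := nontrivial_of_finrank_pos (R := k) (by rw [hA]; norm_num)
  have := isSimpleRing_of_isAzumaya k A
  obtain ⟨n, hn, ⟨E⟩⟩ := IsSimpleRing.exists_algEquiv_matrix_of_isAlgClosed k A
  have h := E.toLinearEquiv.finrank_eq
  rw [hA, finrank_matrix, finrank_self] at h
  simp only [Fintype.card_fin, mul_one] at h
  obtain rfl : n = 2 := by nlinarith
  exact ⟨E⟩

variable {k : Type u} [Field k] {V : Type v} [AddCommGroup V] [Module k V]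

theorem finrank_even (e : Basis (Fin 3) k V) (q : QuadraticForm k V) : finrank k (even q) = 4 := by
  rw [(psi e q).finrank_eq, finrank_eq_card_basis (wBasis e)]
  rfl

/-- The trace zero matrices as a quadratic space. -/
noncomputable def traceZero (e : Basis (Fin 3) k V) : V →ₗ[k] Matrix (Fin 2) (Fin 2) k where
  toFun x := !![e.repr x 2, e.repr x 0; e.repr x 1, -e.repr x 2]
  map_add' x y := by
    ext i j
    fin_cases i <;> fin_cases j <;> simp [add_comm]
  map_smul' c x := by
    ext i j
    fin_cases i <;> fin_cases j <;> simp

theorem traceZero_mul_self (e : Basis (Fin 3) k V) (x : V) :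
    traceZero e x * traceZero e x = algebraMap k _ (stdForm e 0 x) := by
  rw [stdForm_zero_apply]
  ext i j
  fin_cases i <;> fin_cases j <;>
    simp [traceZero, Matrix.mul_apply, Matrix.algebraMap_matrix_apply] <;> ring

/-- The even Clifford algebra of the split semiregular form acts on a two-dimensional space. -/
noncomputable def evenToMatrix (e : Basis (Fin 3) k V) :
    even (stdForm e 0) →ₐ[k] Matrix (Fin 2) (Fin 2) k :=
  (lift (stdForm e 0) ⟨traceZero e, traceZero_mul_self e⟩).comp (even (stdForm e 0)).val

theorem evenToMatrix_evenMul (e : Basis (Fin 3) k V) (x y : V) :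
    evenToMatrix e (evenMul _ x y) = traceZero e x * traceZero e y := by
  simp [evenToMatrix, evenMul]

theorem evenToMatrix_surjective (e : Basis (Fin 3) k V) :
    Function.Surjective (evenToMatrix e) := by
  intro A
  -- The products `e₀e₁`, `e₁e₂` and `e₂e₀` map to the matrix units `E₀₀`, `E₁₀` and `E₀₁`.
  refine ⟨A 1 1 • 1 + (A 0 0 - A 1 1) • evenMul _ (e 0) (e 1) + A 1 0 • evenMul _ (e 1) (e 2)
    + A 0 1 • evenMul _ (e 2) (e 0), ?_⟩
  simp only [map_add, map_smul, map_one, evenToMatrix_evenMul]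
  ext i j
  fin_cases i <;> fin_cases j <;> simp [traceZero]

theorem nonempty_even_algEquiv_matrix (e : Basis (Fin 3) k V) :
    Nonempty (even (stdForm e 0) ≃ₐ[k] Matrix (Fin 2) (Fin 2) k) := by
  have h4 := finrank_even e (stdForm e 0)
  have := finite_of_finrank_pos (R := k) (M := even (stdForm e 0)) (by rw [h4]; norm_num)
  have hs := evenToMatrix_surjective e
  have hi := (LinearMap.injective_iff_surjective_of_finrank_eq_finrank
    (f := (evenToMatrix e).toLinearMap) (by rw [h4, finrank_matrix]; simp)).mpr hs
  exact ⟨AlgEquiv.ofBijective _ ⟨hi, hs⟩⟩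

/-- Over an algebraically closed field every 4-dimensional Azumaya algebra is `M₂(k)`, as is the
even Clifford algebra of the first standard form. Two structures on `W` with the same identity that
are isomorphic as algebras differ by an element of the stabiliser. -/
theorem setOf_isAzumayaStructure [IsAlgClosed k] (e : Basis (Fin 3) k V) :
    {m | IsAzumayaStructure (1 : EvenExterior k V) m} =
      stabOrbit (1 : EvenExterior k V) (Theta e (stdForm e 0) 1) := by
  obtain ⟨E⟩ := nonempty_even_algEquiv_matrix e
  ext m
  constructor
  · rintro ⟨A, _, _, φ, hA, h1, hmul⟩
    obtain ⟨E'⟩ := nonempty_algEquiv_matrix_two k A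
      (by rw [← φ.finrank_eq]; exact finrank_even e 0)
    let F := E.trans E'.symm
    let h := (psi e (stdForm e 0)).symm ≪≫ₗ F.toLinearEquiv ≪≫ₗ φ.symm
    have hh : ∀ x, φ (h (psi e _ x)) = F x := fun x => by simp [h]
    refine ⟨⟨h, ?_⟩, ?_⟩
    · change h 1 = 1
      apply φ.injective
      rw [← psi_one e (stdForm e 0), hh, map_one, psi_one, h1]
    · refine LinearMap.ext₂ fun x y => ?_
      obtain ⟨x, rfl⟩ := h.surjective x
      obtain ⟨y, rfl⟩ := h.surjective y
      obtain ⟨x, rfl⟩ := (psi e (stdForm e 0)).surjective x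
      obtain ⟨y, rfl⟩ := (psi e (stdForm e 0)).surjective y
      change algAct h (theta e (stdForm e 0)) _ _ = _
      rw [algAct_apply, h.symm_apply_apply, h.symm_apply_apply, theta_psi]
      apply φ.injective
      rw [hh, hmul, hh, hh, map_mul]
  · rintro ⟨⟨h, h1⟩, rfl⟩
    refine ⟨even (stdForm e 0), inferInstance, inferInstance, h.symm ≪≫ₗ (psi e (stdForm e 0)).symm,
      ?_, ?_, fun x y => ?_⟩
    · have := IsAzumaya.matrix k (Fin 2)
      exact IsAzumaya.of_AlgEquiv k _ _ E.symm
    · rw [LinearEquiv.trans_apply, (LinearEquiv.symm_apply_eq h).mpr (show 1 = h 1 from h1.symm),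
        LinearEquiv.symm_apply_eq, psi_one]
    · change (psi e (stdForm e 0)).symm (h.symm (algAct h (theta e (stdForm e 0)) x y)) = _
      rw [algAct_apply, h.symm_apply_apply, LinearEquiv.symm_apply_eq, ← theta_psi]
      simp

/-- The Azumaya structures are the image of the open stratum, which is dense in the coordinate
space, and the image of the whole space is closed. -/
theorem SpAzu_eq_range [IsAlgClosed k] (e : Basis (Fin 3) k V) :
    SpAzu (1 : EvenExterior k V) = Set.range (thetaPt e) := by
  rw [SpAzu, setOf_isAzumayaStructure e,
    ← image_thetaPt_stratum isQuadraticallyClosed_of_isAlgClosed]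
  exact (isPolySection_thetaPt e).isStratification.2.2.1

theorem isStratification_stabOrbit [IsAlgClosed k] (e : Basis (Fin 3) k V) :
    IsStratification k (SpAzu (k := k) (1 : EvenExterior k V))
      (fun i => stabOrbit (1 : EvenExterior k V) (Theta e (stdForm e i) 1)) := by
  have h := (isPolySection_thetaPt e).isStratification
  simpa only [image_thetaPt_stratum isQuadraticallyClosed_of_isAlgClosed, ← SpAzu_eq_range] using h

theorem hasStatedSingularLoci_stabOrbit [IsAlgClosed k] (e : Basis (Fin 3) k V) :
    HasStatedSingularLoci k
      (fun i => stabOrbit (1 : EvenExterior k V) (Theta e (stdForm e i) 1)) := by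
  have h := (isPolySection_thetaPt e).hasStatedSingularLoci
  simpa only [image_thetaPt_stratum isQuadraticallyClosed_of_isAlgClosed] using h

end Azumaya

end TernaryForms

theorem theorem3p23 {k : Type u} [Field k] {V : Type v} [AddCommGroup V] [Module k V]
    (e : Module.Basis (Fin 3) k V) :
    -- classification over a quadratically closed field
    (TernaryForms.IsQuadraticallyClosed k →
      (∃ c : Quotient (TernaryForms.similaritySetoid.{u, v} k) ≃ Fin 4,
        ∀ (M : TernaryForms.TernaryQuadraticModule.{u, v} k) (i : Fin 4),
          c (Quotient.mk _ M) = i ↔ TernaryForms.HasType M.1.form i) ∧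
      ∀ i : Fin 4, {q : QuadraticForm k V | TernaryForms.HasType q i} =
        TernaryForms.formOrbit (TernaryForms.stdForm e i)) ∧
    -- stratifications over an algebraically closed field
    (IsAlgClosed k →
      (TernaryForms.IsStratification k (Set.univ : Set (QuadraticForm k V))
          (fun i => TernaryForms.formOrbit (TernaryForms.stdForm e i)) ∧
        TernaryForms.HasStatedSingularLoci k
          (fun i => TernaryForms.formOrbit (TernaryForms.stdForm e i))) ∧
      (TernaryForms.IsStratification k
          (TernaryForms.SpAzu (k := k) (1 : TernaryForms.EvenExterior k V))
          (fun i => TernaryForms.stabOrbit (1 : TernaryForms.EvenExterior k V)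
            (TernaryForms.Theta e (TernaryForms.stdForm e i) 1)) ∧
        TernaryForms.HasStatedSingularLoci k
          (fun i => TernaryForms.stabOrbit (1 : TernaryForms.EvenExterior k V)
            (TernaryForms.Theta e (TernaryForms.stdForm e i) 1)))) := by
  refine ⟨fun hk => ⟨TernaryForms.exists_similarity_classes_equiv hk e,
    TernaryForms.setOf_hasType hk e⟩, fun _ =>
    ⟨⟨TernaryForms.isStratification_formOrbit e, TernaryForms.hasStatedSingularLoci_formOrbit e⟩,
      TernaryForms.isStratification_stabOrbit e, TernaryForms.hasStatedSingularLoci_stabOrbit e⟩⟩
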